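/- Let $n\ge 1$ and let $\mu\subseteq\lambda$ be partitions with $\lambda'_j-\mu'_j\le n+1$ for all $j$ (the positivity condition; $'$ denotes the conjugate partition). Let $l=l(\lambda)$ be the length of $\lambda$. Then there is a weight-preserving bijection $\phi:P_2(\lambda/\mu)\to P(\lambda/\mu)$, i.e. $z_a^{\phi(p)}=z_a^p$ for all $p\in P_2(\lambda/\mu)$ and $a\in\mathbb C$, where the notation is as follows. **Weights.** $\mathcal Z$ is the commutative ring generated by $z_{i,a},z_{\bar i,a}$ ($1\le i\le n$, $a\in\mathbb C$) with relations $z_{i,a}z_{\bar i,a-2n+2i-4}=z_{i-1,a}z_{\overline{i-1},a-2n+2i-4}$ ($1\le i\le n$), $z_{0,a}=z_{\bar 0,a}=1$. A *path* is a lattice path in $\mathbb Z^2$ with unit E- and N-steps from height $-n-1$ to height $n+1$, with no E-steps at heights $\pm(n+1)$ and an even number of E-steps at height $0$ (the height of $(x,y)$ is $y$). An E-step starting at $(x,y)$ has the factor $z_{n+1+y,a+2x}$ if $y<0$ and $z_{\overline{n+1-y},a+2x}$ if $y>0$; the successive E-steps at $y=0$ have the factors $z_{\bar n,a+2x},z_{n,a+2x},z_{\bar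 n,a+2x},\dots$ alternately (with $x$ the starting position of the step in question). The weight $z_a^{p}$ of a path is the product of the factors of its E-steps, and the weight of a tuple of paths is the product of the weights of its members. **Tuples.** For $\sigma\in\mathfrak S_l$, let $\mathfrak P(\sigma)$ be the set of tuples $p=(p_1,\dots,p_l)$ of paths such that $p_i$ goes from $(\mu_i+1-i,-n-1)$ to $(\lambda_{\sigma(i)}+1-\sigma(i),n+1)$. An intersecting pair $(p_i,p_j)$ is *specially intersecting* if it intersects only at height $0$ and $p_i(0)-p_j(0)$ is odd, where $p_i(0)$ is the horizontal position of the leftmost point of $p_i$ at height $0$; otherwise it is *ordinarily intersecting*. For a tuple $p\in\mathfrak P(\sigma)$ and $0\le r\le n$, let $\alpha_i(-r)$ be the horizontal position of the leftmost point of $p_i$ at height $-r$ and $\beta_{\sigma(i)}(r)$ that of the rightmost point of $p_i$ at height $r$. Put $\alpha^*_i(r)=\alpha_{i-r}(-r)-1-r$ if $i-r\ge1$ and $+\infty$ otherwise; $\beta^*_i(-r)=\beta_{i+r}(r)+1+r$ if $i+r\le l$ and $-\infty$ otherwise; $\alpha_0=+\infty$ and $\beta_{l+1}=-\infty$. **Regions.**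 Let $U$ be a unit lattice square with left edge at $x$. It is an *upper* unit of height $r$ if its lower edge is at height $r$, and a *lower* unit of height $-r$ if its upper edge is at height $-r$ ($0\le r\le n$). It is a I-*unit* (resp. II-*unit*) of $p$ if for some $0\le i\le l$ one has, for an upper unit, $\alpha^*_i(r)\le x<x+1\le\beta_{i+1}(r)$ (resp. $\beta_{i+1}(r)\le x<x+1\le\alpha^*_i(r)$) or, for a lower unit, $\alpha_i(-r)\le x<x+1\le\beta^*_{i+1}(-r)$ (resp. $\beta^*_{i+1}(-r)\le x<x+1\le\alpha_i(-r)$). A II-unit is *boundary* if this holds for some $i$ with $i\le r$, $i=l$ or $r=n$ (upper unit), or with $i=0$, $i\ge l-r$ or $r=n$ (lower unit). Two units are *adjacent* if the upper-left or lower-right vertex of one is a vertex of the other; this generates an equivalence relation on the set of I-units, and one on the set of II-units, whose classes are called connected components. A I-*region* is a connected component of the I-units containing a unit of height $0$; a II-*region* is a connected component of the II-units containing a unit of height $0$ and no boundary II-unit. For $1\le i\le l-1$ put $h_i=\alpha_i(0)-\beta_{i+1}(0)$. A I-region (resp. II-region) $V$ is *odd* if the number of $i$ such that $h_i$ is even,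 $h_i\le 0$ (resp. $h_i>0$), and $V$ contains a unit of height $0$ that satisfies the defining inequalities of I-units (resp. II-units) for this $i$, is odd. **The two sets.** $P_2(\lambda/\mu)$ is the set of all $p\in\bigsqcup_{\sigma\in\mathfrak S_l}\mathfrak P(\sigma)$ with no ordinarily intersecting pair $(p_i,p_j)$, $i\ne j$, and with no odd I-region and no odd II-region. $P(\lambda/\mu)$ is the set of all $p\in\mathfrak P(\mathrm{id})$ with no ordinarily intersecting adjacent pair $(p_i,p_{i+1})$ and no odd II-region. -/

import Mathlib

namespace TypeC

/-! ### Lattice paths -/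

/-- A path of type `C_n`: a sequence of unit E- and N-steps in `ℤ²` from height `-n-1` to height
`n+1`.  Such a sequence is recorded by the horizontal position `start` of its initial point and by
the number `e y` of consecutive E-steps that it makes at each height `y`.  There are no E-steps at
heights `±(n+1)` (nor, of course, outside the strip), and the number of E-steps at height `0` is
even. -/
@[ext]
structure Path (n : ℕ) where
  start : ℤ
  e : ℤ → ℕ
  mem_of_e_ne_zero : ∀ y : ℤ, e y ≠ 0 → -(n : ℤ) ≤ y ∧ y ≤ (n : ℤ)
  even_e_zero : Even (e 0)

namespace Path

variable {n : ℕ}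

/-- Horizontal position of the leftmost point of the path at height `y`. -/
noncomputable def left (p : Path n) (y : ℤ) : ℤ :=
  p.start + ∑ t ∈ Finset.Ico (-(n : ℤ) - 1) y, (p.e t : ℤ)

/-- Horizontal position of the rightmost point of the path at height `y`. -/
noncomputable def right (p : Path n) (y : ℤ) : ℤ := p.left y + (p.e y : ℤ)

/-- Horizontal position of the final point of the path, which is at height `n+1`. -/
noncomputable def finish (p : Path n) : ℤ := p.right ((n : ℤ) + 1)

/-- The lattice point `(x, y)` lies on the path. -/
def Mem (p : Path n) (x y : ℤ) : Prop :=
  (-(n : ℤ) - 1 ≤ y ∧ y ≤ (n : ℤ) + 1) ∧ p.left y ≤ x ∧ x ≤ p.right y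

def Intersecting (p q : Path n) : Prop := ∃ x y : ℤ, p.Mem x y ∧ q.Mem x y

/-- The intersection occurs only at height `0`, and the leftmost points of the two paths at
height `0` have odd distance. -/
def SpeciallyIntersecting (p q : Path n) : Prop :=
  p.Intersecting q ∧ (∀ x y : ℤ, p.Mem x y → q.Mem x y → y = 0) ∧ Odd (p.left 0 - q.left 0)

def OrdinarilyIntersecting (p q : Path n) : Prop :=
  p.Intersecting q ∧ ¬ p.SpeciallyIntersecting q

end Path

/-! ### The ring of weights -/

/-- The alphabet `I = {1, …, n, n̄, …, 1̄}`: `plain k` is the letter `k + 1` and `bar k` is the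
letter `k + 1` with a bar. -/
inductive Letter (n : ℕ) where
  | plain (k : Fin n)
  | bar (k : Fin n)

/-- The variable `z_{i,a}` for `1 ≤ i ≤ n`, and `1` for `i = 0`. -/
noncomputable def polyPlain (n i : ℕ) (a : ℂ) : MvPolynomial (Letter n × ℂ) ℤ :=
  if h : 1 ≤ i ∧ i ≤ n then MvPolynomial.X (Letter.plain ⟨i - 1, by omega⟩, a) else 1

/-- The variable `z_{ī,a}` for `1 ≤ i ≤ n`, and `1` for `i = 0`. -/
noncomputable def polyBar (n i : ℕ) (a : ℂ) : MvPolynomial (Letter n × ℂ) ℤ :=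
  if h : 1 ≤ i ∧ i ≤ n then MvPolynomial.X (Letter.bar ⟨i - 1, by omega⟩, a) else 1

/-- The ideal of the relations
`z_{i,a} z_{ī,a-2n+2i-4} = z_{i-1,a} z_{\overline{i-1},a-2n+2i-4}`, `1 ≤ i ≤ n`, `a ∈ ℂ`. -/
noncomputable def weightIdeal (n : ℕ) : Ideal (MvPolynomial (Letter n × ℂ) ℤ) :=
  Ideal.span {f | ∃ (i : ℕ) (a : ℂ), 1 ≤ i ∧ i ≤ n ∧
    f = polyPlain n i a * polyBar n i (a - 2 * n + 2 * i - 4) -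
        polyPlain n (i - 1) a * polyBar n (i - 1) (a - 2 * n + 2 * i - 4)}

/-- The commutative ring `𝒵` generated by the `z_{i,a}` subject to the relations above. -/
abbrev WeightRing (n : ℕ) : Type := MvPolynomial (Letter n × ℂ) ℤ ⧸ weightIdeal n

noncomputable def zPlain (n i : ℕ) (a : ℂ) : WeightRing n :=
  Ideal.Quotient.mk (weightIdeal n) (polyPlain n i a)

noncomputable def zBar (n i : ℕ) (a : ℂ) : WeightRing n :=
  Ideal.Quotient.mk (weightIdeal n) (polyBar n i a)

/-- The factor `z_{L¹(s), L²(s)}` of the E-step `s` that starts at `(x, y)` and is the `k`-th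
(counted from `0`) E-step of its path at height `y`.  At height `0` the letters are
`n̄, n, n̄, n, …`. -/
noncomputable def stepWeight (n : ℕ) (a : ℂ) (x y : ℤ) (k : ℕ) : WeightRing n :=
  if y < 0 then zPlain n ((n : ℤ) + 1 + y).toNat (a + 2 * x)
  else if y = 0 then
    (if Even k then zBar n n (a + 2 * x) else zPlain n n (a + 2 * x))
  else zBar n ((n : ℤ) + 1 - y).toNat (a + 2 * x)

/-- The weight of a path: the product over all its E-steps. -/
noncomputable def Path.weight {n : ℕ} (a : ℂ) (p : Path n) : WeightRing n :=
  ∏ y ∈ Finset.Icc (-(n : ℤ)) (n : ℤ), ∏ k ∈ Finset.range (p.e y),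
    stepWeight n a (p.left y + k) y k

/-! ### Tuples of paths -/

/-- Elements of the disjoint union over `σ` of the sets of tuples `(p_1, …, p_l)`, `l = l(λ)`,
where `p_i` goes from `(μ_i + 1 - i, -n-1)` to `(λ_{σ(i)} + 1 - σ(i), n+1)`.  Indices in
`Fin l` start at `0`, so that the two positions read `μ_i - i` and `λ_{σ(i)} - σ(i)`. -/
structure PathTuple (n : ℕ) (lam mu : YoungDiagram) where
  σ : Equiv.Perm (Fin (lam.colLen 0))
  path : Fin (lam.colLen 0) → Path n
  start_eq : ∀ i, (path i).start = (mu.rowLen i : ℤ) - (i : ℕ)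
  finish_eq : ∀ i, (path i).finish = (lam.rowLen (σ i) : ℤ) - (σ i : ℕ)

noncomputable def PathTuple.weight {n : ℕ} {lam mu : YoungDiagram} (a : ℂ)
    (p : PathTuple n lam mu) : WeightRing n :=
  ∏ i, (p.path i).weight a

/-! ### Lower and upper paths, duals -/

/-- Position data of a pair `(α; β)` of `l`-tuples of lower and upper paths: `lower i r` is the
horizontal position of the leftmost point of the lower path with index `i` at height `-r`, and
`upper i r` is that of the rightmost point of the upper path with index `i` at height `r`
(indices in `Fin l` start at `0`). -/
structure PathPair (l : ℕ) where
  lower : Fin l → ℕ → ℤ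
  upper : Fin l → ℕ → ℤ

namespace PathPair

variable {l : ℕ}

/-- `α_i(-r)` with indices `1, …, l`, and `+∞` for all other indices. -/
def alpha (c : PathPair l) (i r : ℕ) : WithTop ℤ :=
  if h : 1 ≤ i ∧ i ≤ l then ((c.lower ⟨i - 1, by omega⟩ r : ℤ) : WithTop ℤ) else ⊤

/-- `β_i(r)` with indices `1, …, l`, and `-∞` for all other indices. -/
def beta (c : PathPair l) (i r : ℕ) : WithBot ℤ :=
  if h : 1 ≤ i ∧ i ≤ l then ((c.upper ⟨i - 1, by omega⟩ r : ℤ) : WithBot ℤ) else ⊥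

/-- `α*_i(r) = α_{i-r}(-r) - 1 - r` if `i - r ≥ 1`, and `+∞` otherwise
(for the indices `i ≤ l` that occur below). -/
def alphaDual (c : PathPair l) (i r : ℕ) : WithTop ℤ :=
  if h : 1 ≤ i - r ∧ i - r ≤ l then
    ((c.lower ⟨i - r - 1, by omega⟩ r - 1 - (r : ℤ) : ℤ) : WithTop ℤ) else ⊤

/-- `β*_i(-r) = β_{i+r}(r) + 1 + r` if `i + r ≤ l`, and `-∞` otherwise
(for the indices `i ≥ 1` that occur below). -/
def betaDual (c : PathPair l) (i r : ℕ) : WithBot ℤ :=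
  if h : 1 ≤ i + r ∧ i + r ≤ l then
    ((c.upper ⟨i + r - 1, by omega⟩ r + 1 + (r : ℤ) : ℤ) : WithBot ℤ) else ⊥

/-! ### Units

A unit square is given by its lower-left vertex `(x, y)`.  It lies in `S₊ = ℝ × [0, n+1]` and has
height `r` if `y = r ∈ {0, …, n}`; it lies in `S₋ = ℝ × [-n-1, 0]` and has height `-r` if
`y = -r - 1` with `r ∈ {0, …, n}`. -/

/-- `α*_i(r) ≤ x < x + 1 ≤ β_{i+1}(r)`. -/
def UpperI (c : PathPair l) (i r : ℕ) (x : ℤ) : Prop :=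
  c.alphaDual i r ≤ (x : WithTop ℤ) ∧ ((x + 1 : ℤ) : WithBot ℤ) ≤ c.beta (i + 1) r

/-- `α_i(-r) ≤ x < x + 1 ≤ β*_{i+1}(-r)`. -/
def LowerI (c : PathPair l) (i r : ℕ) (x : ℤ) : Prop :=
  c.alpha i r ≤ (x : WithTop ℤ) ∧ ((x + 1 : ℤ) : WithBot ℤ) ≤ c.betaDual (i + 1) r

/-- `β_{i+1}(r) ≤ x < x + 1 ≤ α*_i(r)`. -/
def UpperII (c : PathPair l) (i r : ℕ) (x : ℤ) : Prop :=
  c.beta (i + 1) r ≤ (x : WithBot ℤ) ∧ ((x + 1 : ℤ) : WithTop ℤ) ≤ c.alphaDual i r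

/-- `β*_{i+1}(-r) ≤ x < x + 1 ≤ α_i(-r)`. -/
def LowerII (c : PathPair l) (i r : ℕ) (x : ℤ) : Prop :=
  c.betaDual (i + 1) r ≤ (x : WithBot ℤ) ∧ ((x + 1 : ℤ) : WithTop ℤ) ≤ c.alpha i r

def UnitI (c : PathPair l) (n : ℕ) (U : ℤ × ℤ) : Prop :=
  ∃ i r : ℕ, i ≤ l ∧ r ≤ n ∧
    ((U.2 = (r : ℤ) ∧ c.UpperI i r U.1) ∨ (U.2 = -(r : ℤ) - 1 ∧ c.LowerI i r U.1))

def UnitII (c : PathPair l) (n : ℕ) (U : ℤ × ℤ) : Prop :=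
  ∃ i r : ℕ, i ≤ l ∧ r ≤ n ∧
    ((U.2 = (r : ℤ) ∧ c.UpperII i r U.1) ∨ (U.2 = -(r : ℤ) - 1 ∧ c.LowerII i r U.1))

def BoundaryUnitII (c : PathPair l) (n : ℕ) (U : ℤ × ℤ) : Prop :=
  ∃ i r : ℕ, i ≤ l ∧ r ≤ n ∧
    ((U.2 = (r : ℤ) ∧ c.UpperII i r U.1 ∧ (i ≤ r ∨ i = l ∨ r = n)) ∨
     (U.2 = -(r : ℤ) - 1 ∧ c.LowerII i r U.1 ∧ (i = 0 ∨ l ≤ i + r ∨ r = n)))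

end PathPair

/-- The four vertices of the unit square with lower-left vertex `U`. -/
def vertices (U : ℤ × ℤ) : Set (ℤ × ℤ) :=
  {(U.1, U.2), (U.1 + 1, U.2), (U.1, U.2 + 1), (U.1 + 1, U.2 + 1)}

/-- The upper-left or the lower-right vertex of `U` is also a vertex of `U'`. -/
def Adjacent (U U' : ℤ × ℤ) : Prop :=
  (U.1, U.2 + 1) ∈ vertices U' ∨ (U.1 + 1, U.2) ∈ vertices U'

/-- `V` is the set of units of a connected component of the set `S` of units, that is, an
equivalence class of the equivalence relation on `S` generated by adjacency. -/
def IsComponent (S V : Set (ℤ × ℤ)) : Prop :=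
  ∃ U : S, V = {W | ∃ hW : W ∈ S,
    Relation.EqvGen (fun A B : S => Adjacent A.1 B.1) U ⟨W, hW⟩}

/-- The unit `U` has height `0` (in `S₊` or in `S₋`). -/
def HeightZero (U : ℤ × ℤ) : Prop := U.2 = 0 ∨ U.2 = -1

namespace PathPair

variable {l : ℕ}

def RegionI (c : PathPair l) (n : ℕ) (V : Set (ℤ × ℤ)) : Prop :=
  IsComponent {U | c.UnitI n U} V ∧ ∃ U ∈ V, HeightZero U

def RegionII (c : PathPair l) (n : ℕ) (V : Set (ℤ × ℤ)) : Prop :=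
  IsComponent {U | c.UnitII n U} V ∧ (∃ U ∈ V, HeightZero U) ∧ ∀ U ∈ V, ¬ c.BoundaryUnitII n U

/-- The indices `i`, `1 ≤ i ≤ l - 1`, for which `(α_i, β_{i+1})` is an even overlap that meets `V`
at height `0`: some unit of height `0` of `V` is one of the I-units enclosed by the overlap. -/
def evenOverlaps (c : PathPair l) (V : Set (ℤ × ℤ)) : Set ℕ :=
  {i | ∃ x y : ℤ, c.alpha i 0 = (x : WithTop ℤ) ∧ c.beta (i + 1) 0 = (y : WithBot ℤ) ∧
    x - y ≤ 0 ∧ Even (x - y) ∧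
    ∃ U ∈ V, (U.2 = 0 ∧ c.UpperI i 0 U.1) ∨ (U.2 = -1 ∧ c.LowerI i 0 U.1)}

/-- The indices `i`, `1 ≤ i ≤ l - 1`, for which `(α_i, β_{i+1})` is an even hole that meets `V`
at height `0`: some unit of height `0` of `V` is one of the II-units enclosed by the hole. -/
def evenHoles (c : PathPair l) (V : Set (ℤ × ℤ)) : Set ℕ :=
  {i | ∃ x y : ℤ, c.alpha i 0 = (x : WithTop ℤ) ∧ c.beta (i + 1) 0 = (y : WithBot ℤ) ∧
    0 < x - y ∧ Even (x - y) ∧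
    ∃ U ∈ V, (U.2 = 0 ∧ c.UpperII i 0 U.1) ∨ (U.2 = -1 ∧ c.LowerII i 0 U.1)}

def OddRegionI (c : PathPair l) (n : ℕ) (V : Set (ℤ × ℤ)) : Prop :=
  c.RegionI n V ∧ Odd (c.evenOverlaps V).ncard

def OddRegionII (c : PathPair l) (n : ℕ) (V : Set (ℤ × ℤ)) : Prop :=
  c.RegionII n V ∧ Odd (c.evenHoles V).ncard

end PathPair

/-! ### The two sets of tuples -/

namespace PathTuple

variable {n : ℕ} {lam mu : YoungDiagram}

/-- The pair `(α; β)` obtained from `p` by removing the E-steps at height `0`.  The lower path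
`α_i` is the lower part of `p_i`; the upper path `β_j`, which ends at `λ_j + 1 - j`, is the upper
part of the path `p_i` with `σ(i) = j`. -/
noncomputable def toPair (p : PathTuple n lam mu) : PathPair (lam.colLen 0) where
  lower i r := (p.path i).left (-(r : ℤ))
  upper j r := (p.path (p.σ.symm j)).right (r : ℤ)

end PathTuple

/-- `P₁(λ/μ)`: no ordinarily intersecting pair. -/
def P₁ (n : ℕ) (lam mu : YoungDiagram) : Set (PathTuple n lam mu) :=
  {p | ∀ i j, i ≠ j → ¬ (p.path i).OrdinarilyIntersecting (p.path j)}

/-- `P₂(λ/μ)`: the elements of `P₁(λ/μ)` without odd I-region and without odd II-region. -/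
def P₂ (n : ℕ) (lam mu : YoungDiagram) : Set (PathTuple n lam mu) :=
  {p | p ∈ P₁ n lam mu ∧
    ¬ ∃ V, p.toPair.OddRegionI n V ∨ p.toPair.OddRegionII n V}

/-- `P(λ/μ)`: tuples with `σ = id`, no ordinarily intersecting adjacent pair `(p_i, p_{i+1})`, and
no odd II-region. -/
def P (n : ℕ) (lam mu : YoungDiagram) : Set (PathTuple n lam mu) :=
  {p | p.σ = 1 ∧
    (∀ i j : Fin (lam.colLen 0), (j : ℕ) = (i : ℕ) + 1 →
      ¬ (p.path i).OrdinarilyIntersecting (p.path j)) ∧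
    ¬ ∃ V, p.toPair.OddRegionII n V}

/-- The positivity condition `d(λ/μ) ≤ n + 1` for the depth `d(λ/μ) = max_j (λ'_j - μ'_j)`. -/
def Positivity (n : ℕ) (lam mu : YoungDiagram) : Prop :=
  ∀ j : ℕ, (lam.colLen j : ℤ) - (mu.colLen j : ℤ) ≤ (n : ℤ) + 1

end TypeC

namespace TypeC

/-! Fold the lower half plane onto the upper one, so that the lower unit at height `-r` starting at
`x + 1 + r` and the upper unit at height `r` starting at `x` become one cell `(x, r)` of a
triangular lattice. A nonintersecting family of lower and upper paths is encoded by two counting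
functions: `A x r` is `r` plus the number of shifted positions `α_j(-r) - 1 - r` beyond `x`, and `B
x r` is the number of positions `β_j(r)` beyond `x`. Both obey the same local rules (`IsProfile`),
and conversely such profiles come from paths (`exists_pattern`). With `N = A - B`, a cell carries
I-units iff `N ≤ -2` and II-units iff `N ≥ 0`; positivity says `N ≥ -1` on row `n`.

The weight depends only on `A + B` (`weight_eq_of_total`): modulo the relations of the ring, a lower
position and the corresponding folded upper position contribute the same factor. Hence `A` and `B`
may be exchanged, up to a constant `c`, on a region of cells whose outer neighbours all have `N =
-c`. This keeps `A + B` and the local rules, and reflects `N` to `-2c - N` inside the region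
(`isProfile_flip`).

The two sets of tuples are the ends of a chain of conditions `InX c`, `c = 2, 4, 8, …`: on row `0`
one has `-c ≤ N ≤ 0`; a parity rule ties the odd values of `N` to the number of intermediate even
values on their right; and closed sets in `N ≤ -c`, as well as closed sets in `N ≥ 0` that avoid row
`n`, have an even number of cells on row `0`. For `c = 2` the rule is vacuous and the two evenness
conditions exclude odd I- and II-regions. For `c > l` the level `-c` is never reached on row `0`, so
only the II-region condition and the rule remain.

The step between `2c` and `c` (`equivFlip`) is a flip at level `-c`. From `2c` to `c` one flips what
is reachable from row `0` inside `N < -c`. The rule makes this side recognisable afterwards: a cell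
of row `0` was below `-c` iff an odd number of cells of level `-c` lie to its right (`lt_iff_odd`).
The inverse flips what is reachable inside `N > -c` from such odd positions. It is legitimate
because a path in `N > -c` separates the cells `N ≤ -c` into closed sets, each with an even number
of cells on row `0`; so parity is constant along such paths and odd positions never reach row `n`
(`odd_iff_of_reached`). The evenness at level `-c` created by the first flip comes from a contact
count on triangles (`finsum_joins_eq_zero`, `even_ncard_of_contacts`).

The remaining condition concerns E-steps at height `0`. It is phrased through a signed count `kap`
that the row-`0` values of `A + B` determine, so flips preserve it. A bound `1` on this count, with
`0 ≤ B - A ≤ 2`, is equivalent to the existence of a permutation for which only special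
intersections occur, and this permutation is unique (`exists_isSpecial`, `IsSpecial.unique`). The
same bound, with `A ≤ B` and the parity rule, is equivalent to the adjacent-pair condition for the
identity permutation (`isAdjacentSpecial_iff`). -/

/-! ### Counting integers to the right of a position -/

/-- The number of integers `y > x` with `Q y`. -/
noncomputable def countAbove (Q : ℤ → Prop) (x : ℤ) : ℕ := {y | x < y ∧ Q y}.ncard

theorem finite_above {Q : ℤ → Prop} {M : ℤ} (hM : ∀ y, M ≤ y → ¬ Q y) (x : ℤ) :
    {y | x < y ∧ Q y}.Finite :=
  (Set.finite_Ioo x M).subset fun y hy => ⟨hy.1, not_le.1 fun h => hM y h hy.2⟩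

theorem countAbove_of_not {Q : ℤ → Prop} {x : ℤ} (h : ¬ Q (x + 1)) :
    countAbove Q x = countAbove Q (x + 1) := by
  unfold countAbove
  congr 1
  ext y
  simp only [Set.mem_ofPred_eq]
  constructor
  · rintro ⟨h1, h2⟩
    refine ⟨?_, h2⟩
    rcases (show x + 1 ≤ y by omega).lt_or_eq with h3 | h3
    · exact h3
    · exact absurd (h3 ▸ h2) h
  · rintro ⟨h1, h2⟩
    exact ⟨by omega, h2⟩

theorem countAbove_of_mem {Q : ℤ → Prop} {M : ℤ} (hM : ∀ y, M ≤ y → ¬ Q y) {x : ℤ}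
    (h : Q (x + 1)) : countAbove Q x = countAbove Q (x + 1) + 1 := by
  unfold countAbove
  rw [← Set.ncard_insert_of_notMem (a := x + 1) (by simp) (finite_above hM _)]
  congr 1
  ext y
  simp only [Set.mem_ofPred_eq, Set.mem_insert_iff]
  constructor
  · rintro ⟨h1, h2⟩
    by_cases h3 : y = x + 1
    · exact Or.inl h3
    · exact Or.inr ⟨by omega, h2⟩
  · rintro (h1 | ⟨h1, h2⟩)
    · subst h1; exact ⟨by omega, h⟩
    · exact ⟨by omega, h2⟩

theorem countAbove_eq_zero {Q : ℤ → Prop} {M : ℤ} (hM : ∀ y, M ≤ y → ¬ Q y) {x : ℤ}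
    (hx : M ≤ x) : countAbove Q x = 0 := by
  unfold countAbove
  have : {y | x < y ∧ Q y} = ∅ := by
    ext y
    simp only [Set.mem_ofPred_eq, Set.mem_empty_iff_false, iff_false, not_and]
    exact fun h => hM y (by omega)
  rw [this, Set.ncard_empty]

theorem countAbove_congr {Q R : ℤ → Prop} (h : ∀ y, Q y ↔ R y) (x : ℤ) :
    countAbove Q x = countAbove R x := by
  simp only [countAbove, h]

theorem countAbove_or {Q R : ℤ → Prop} {M : ℤ} (hM : ∀ y, M ≤ y → ¬ (Q y ∨ R y))
    (hd : ∀ y, ¬ (Q y ∧ R y)) (x : ℤ) :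
    countAbove (fun y => Q y ∨ R y) x = countAbove Q x + countAbove R x := by
  unfold countAbove
  rw [← Set.ncard_union_eq (Set.disjoint_left.2 fun y h1 h2 => hd y ⟨h1.2, h2.2⟩)
    (finite_above (fun y hy h => hM y hy (Or.inl h)) x)
    (finite_above (fun y hy h => hM y hy (Or.inr h)) x)]
  congr 1
  ext y
  simp only [Set.mem_ofPred_eq, Set.mem_union]
  tauto

/-- Downward induction on integers from a bound. -/
theorem int_induction_down {P : ℤ → Prop} {M : ℤ} (h0 : ∀ x, M ≤ x → P x)
    (hs : ∀ x, (∀ y, x < y → P y) → P x) (x : ℤ) : P x := by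
  have key : ∀ k : ℕ, ∀ y, M - k ≤ y → P y := by
    intro k
    induction k with
    | zero => intro y hy; exact h0 y (by simpa using hy)
    | succ k ih =>
      intro y hy
      apply hs
      intro z hz
      exact ih z (by push_cast at hy; omega)
  exact key (M - x).toNat x (by omega)

/-! ### Cells -/

/-- Adjacency of the cells `(x, r)` of the upper half plane. -/
def CellAdj (u v : ℤ × ℕ) : Prop :=
  (v.2 = u.2 ∧ (v.1 = u.1 + 1 ∨ v.1 = u.1 - 1)) ∨
  (v.2 = u.2 + 1 ∧ (v.1 = u.1 ∨ v.1 = u.1 - 1)) ∨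
  (u.2 = v.2 + 1 ∧ (u.1 = v.1 ∨ u.1 = v.1 - 1))

theorem CellAdj.symm {u v : ℤ × ℕ} (h : CellAdj u v) : CellAdj v u := by
  unfold CellAdj at *
  omega

/-- `V` is a set of cells of height at most `n` in `T`, and contains with a cell all the adjacent
ones of this kind. -/
structure ClosedIn (n : ℕ) (T V : Set (ℤ × ℕ)) : Prop where
  mem : ∀ u ∈ V, u ∈ T
  le : ∀ u ∈ V, u.2 ≤ n
  closed : ∀ u ∈ V, ∀ v ∈ T, v.2 ≤ n → CellAdj u v → v ∈ V

/-- The cells of height at most `n` of `T` that can be reached in `T` from the cells `(x, 0)`,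
`x ∈ U`. -/
inductive Reached (n : ℕ) (T : Set (ℤ × ℕ)) (U : Set ℤ) : ℤ × ℕ → Prop
  | base (x : ℤ) (hx : x ∈ U) (hT : (x, 0) ∈ T) : Reached n T U (x, 0)
  | step (u v : ℤ × ℕ) (hu : Reached n T U u) (hv : v ∈ T) (hn : v.2 ≤ n) (h : CellAdj u v) :
      Reached n T U v

theorem closedIn_reached (n : ℕ) (T : Set (ℤ × ℕ)) (U : Set ℤ) :
    ClosedIn n T {v | Reached n T U v} where
  mem u hu := by
    cases hu with
    | base x hx hT => exact hT
    | step u v hu hv hn h => exact hv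
  le u hu := by
    cases hu with
    | base x hx hT => exact Nat.zero_le _
    | step u v hu hv hn h => exact hn
  closed u hu v hv hn h := Reached.step u v hu hv hn h

theorem Reached.exists_mem {n : ℕ} {T : Set (ℤ × ℕ)} {U : Set ℤ} {v : ℤ × ℕ}
    (h : Reached n T U v) : ∃ x ∈ U, Reached n T {x} v := by
  induction h with
  | base x hx hT => exact ⟨x, hx, Reached.base x rfl hT⟩
  | step u v hu hv hn h ih =>
    obtain ⟨x, hx, h'⟩ := ih
    exact ⟨x, hx, Reached.step u v h' hv hn h⟩

/-! ### Profiles -/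

/-- The local rules satisfied by the counting function of a nonintersecting family of paths. -/
structure IsProfile (f : ℤ → ℕ → ℤ) : Prop where
  left_ge : ∀ x r, f x r ≤ f (x - 1) r
  left_le : ∀ x r, f (x - 1) r ≤ f x r + 1
  up_ge : ∀ x r, f x r ≤ f x (r + 1)
  up_le : ∀ x r, f (x - 1) (r + 1) ≤ f x r + 1

/-- A pair of counting functions, for the lower and for the upper paths. -/
@[ext]
structure Heights where
  A : ℤ → ℕ → ℤ
  B : ℤ → ℕ → ℤ

namespace Heights

/-- The level function: I-units are the cells with value at most `-2`, II-units those with value at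
least `0`, and the value `-1` belongs to neither. -/
def N (s : Heights) (x : ℤ) (r : ℕ) : ℤ := s.A x r - s.B x r

/-- The invariant of all flips; it determines both the weight and the signed count on row `0`. -/
def total (s : Heights) (x : ℤ) (r : ℕ) : ℤ := s.A x r + s.B x r

/-- The cells where `N ≤ k`. -/
def sub (s : Heights) (k : ℤ) : Set (ℤ × ℕ) := {u | s.N u.1 u.2 ≤ k}

/-- The cells where `N ≥ k`. -/
def sup (s : Heights) (k : ℤ) : Set (ℤ × ℕ) := {u | k ≤ s.N u.1 u.2}

/-- `s` consists of profiles with the same top rows as `t` and the right limits. -/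
structure Admissible (n l : ℕ) (t s : Heights) : Prop where
  profA : IsProfile s.A
  profB : IsProfile s.B
  top : ∀ x r, n ≤ r → s.A x r = t.A x r ∧ s.B x r = t.B x r
  pos : ∀ x, -1 ≤ s.N x n
  lim : ∃ M : ℤ, ∀ r ≤ n, ∀ x, (M ≤ x → s.A x r = r ∧ s.B x r = 0) ∧
    (x ≤ -M → s.A x r = r + l ∧ s.B x r = l)

/-- Exchange of `A` and `B` (with a shift) on a set of cells; `N` becomes `-2c - N` there. -/
noncomputable def flip (c : ℤ) (F : Set (ℤ × ℕ)) (s : Heights) : Heights := by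
  classical exact
  { A := fun x r => if (x, r) ∈ F then s.B x r - c else s.A x r
    B := fun x r => if (x, r) ∈ F then s.A x r + c else s.B x r }

variable {n l : ℕ} {t s : Heights} {c : ℤ} {F : Set (ℤ × ℕ)}

theorem flip_A_mem {x : ℤ} {r : ℕ} (h : (x, r) ∈ F) : (s.flip c F).A x r = s.B x r - c := by
  simp [flip, h]

theorem flip_A_notMem {x : ℤ} {r : ℕ} (h : (x, r) ∉ F) : (s.flip c F).A x r = s.A x r := by
  simp [flip, h]

theorem flip_B_mem {x : ℤ} {r : ℕ} (h : (x, r) ∈ F) : (s.flip c F).B x r = s.A x r + c := by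
  simp [flip, h]

theorem flip_B_notMem {x : ℤ} {r : ℕ} (h : (x, r) ∉ F) : (s.flip c F).B x r = s.B x r := by
  simp [flip, h]

theorem flip_N_mem {x : ℤ} {r : ℕ} (h : (x, r) ∈ F) :
    (s.flip c F).N x r = -2 * c - s.N x r := by
  simp only [N, flip_A_mem h, flip_B_mem h]; ring

theorem flip_N_notMem {x : ℤ} {r : ℕ} (h : (x, r) ∉ F) : (s.flip c F).N x r = s.N x r := by
  simp only [N, flip_A_notMem h, flip_B_notMem h]

theorem flip_total : (s.flip c F).total = s.total := by
  ext x r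
  by_cases h : (x, r) ∈ F
  · simp only [total, flip_A_mem h, flip_B_mem h]; ring
  · simp only [total, flip_A_notMem h, flip_B_notMem h]

theorem flip_flip : (s.flip c F).flip c F = s := by
  ext x r
  · by_cases h : (x, r) ∈ F
    · rw [flip_A_mem h, flip_B_mem h]; ring
    · rw [flip_A_notMem h, flip_A_notMem h]
  · by_cases h : (x, r) ∈ F
    · rw [flip_B_mem h, flip_A_mem h]; ring
    · rw [flip_B_notMem h, flip_B_notMem h]

/-- If `N = -c` on the cells adjacent to `F`, then the flipped profile agrees on any two adjacent
cells with one of the original profiles. -/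
theorem flip_pair (hF : ∀ u ∈ F, ∀ v, CellAdj u v → v ∉ F → s.N v.1 v.2 = -c)
    {u v : ℤ × ℕ} (huv : CellAdj u v) :
    ((s.flip c F).A u.1 u.2 = s.A u.1 u.2 ∧ (s.flip c F).A v.1 v.2 = s.A v.1 v.2 ∧
      (s.flip c F).B u.1 u.2 = s.B u.1 u.2 ∧ (s.flip c F).B v.1 v.2 = s.B v.1 v.2) ∨
    ((s.flip c F).A u.1 u.2 = s.B u.1 u.2 - c ∧ (s.flip c F).A v.1 v.2 = s.B v.1 v.2 - c ∧
      (s.flip c F).B u.1 u.2 = s.A u.1 u.2 + c ∧ (s.flip c F).B v.1 v.2 = s.A v.1 v.2 + c) := by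
  by_cases hu : u ∈ F <;> by_cases hv : v ∈ F
  · exact Or.inr ⟨flip_A_mem hu, flip_A_mem hv, flip_B_mem hu, flip_B_mem hv⟩
  · have := hF u hu v huv hv
    refine Or.inr ⟨flip_A_mem hu, ?_, flip_B_mem hu, ?_⟩
    · rw [flip_A_notMem hv]; unfold N at this; linarith
    · rw [flip_B_notMem hv]; unfold N at this; linarith
  · have := hF v hv u huv.symm hu
    refine Or.inr ⟨?_, flip_A_mem hv, ?_, flip_B_mem hv⟩
    · rw [flip_A_notMem hu]; unfold N at this; linarith
    · rw [flip_B_notMem hu]; unfold N at this; linarith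
  · exact Or.inl ⟨flip_A_notMem hu, flip_A_notMem hv, flip_B_notMem hu, flip_B_notMem hv⟩

theorem cellAdj_left (x : ℤ) (r : ℕ) : CellAdj (x, r) (x - 1, r) := by simp [CellAdj]
theorem cellAdj_up (x : ℤ) (r : ℕ) : CellAdj (x, r) (x, r + 1) := by simp [CellAdj]
theorem cellAdj_upLeft (x : ℤ) (r : ℕ) : CellAdj (x, r) (x - 1, r + 1) := by simp [CellAdj]

/-- Each rule for profiles involves just two adjacent cells, and on such a pair the flipped
functions are either the old ones or the exchanged ones. The rules are the same for `A` and `B` and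
insensitive to adding a constant. -/
theorem isProfile_flip (hA : IsProfile s.A) (hB : IsProfile s.B)
    (hF : ∀ u ∈ F, ∀ v, CellAdj u v → v ∉ F → s.N v.1 v.2 = -c) :
    IsProfile (s.flip c F).A ∧ IsProfile (s.flip c F).B := by
  refine ⟨⟨?_, ?_, ?_, ?_⟩, ⟨?_, ?_, ?_, ?_⟩⟩ <;> intro x r
  · have := hA.left_ge x r; have := hB.left_ge x r
    rcases flip_pair hF (cellAdj_left x r) with ⟨h1, h2, -, -⟩ | ⟨h1, h2, -, -⟩ <;>
      simp only at h1 h2 <;> rw [h1, h2] <;> linarith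
  · have := hA.left_le x r; have := hB.left_le x r
    rcases flip_pair hF (cellAdj_left x r) with ⟨h1, h2, -, -⟩ | ⟨h1, h2, -, -⟩ <;>
      simp only at h1 h2 <;> rw [h1, h2] <;> linarith
  · have := hA.up_ge x r; have := hB.up_ge x r
    rcases flip_pair hF (cellAdj_up x r) with ⟨h1, h2, -, -⟩ | ⟨h1, h2, -, -⟩ <;>
      simp only at h1 h2 <;> rw [h1, h2] <;> linarith
  · have := hA.up_le x r; have := hB.up_le x r
    rcases flip_pair hF (cellAdj_upLeft x r) with ⟨h1, h2, -, -⟩ | ⟨h1, h2, -, -⟩ <;>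
      simp only at h1 h2 <;> rw [h1, h2] <;> linarith
  · have := hA.left_ge x r; have := hB.left_ge x r
    rcases flip_pair hF (cellAdj_left x r) with ⟨-, -, h1, h2⟩ | ⟨-, -, h1, h2⟩ <;>
      simp only at h1 h2 <;> rw [h1, h2] <;> linarith
  · have := hA.left_le x r; have := hB.left_le x r
    rcases flip_pair hF (cellAdj_left x r) with ⟨-, -, h1, h2⟩ | ⟨-, -, h1, h2⟩ <;>
      simp only at h1 h2 <;> rw [h1, h2] <;> linarith
  · have := hA.up_ge x r; have := hB.up_ge x r
    rcases flip_pair hF (cellAdj_up x r) with ⟨-, -, h1, h2⟩ | ⟨-, -, h1, h2⟩ <;>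
      simp only at h1 h2 <;> rw [h1, h2] <;> linarith
  · have := hA.up_le x r; have := hB.up_le x r
    rcases flip_pair hF (cellAdj_upLeft x r) with ⟨-, -, h1, h2⟩ | ⟨-, -, h1, h2⟩ <;>
      simp only at h1 h2 <;> rw [h1, h2] <;> linarith

namespace Admissible

/-- Along each of the three edge directions both `A` and `B` change by `0` or `1`, with the same
orientation, so their difference changes by at most `1`. This is the discrete continuity behind
every boundary argument below. -/
theorem N_adj (h : Admissible n l t s) {u v : ℤ × ℕ} (huv : CellAdj u v) :
    s.N u.1 u.2 ≤ s.N v.1 v.2 + 1 := by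
  obtain ⟨x, r⟩ := u
  obtain ⟨y, q⟩ := v
  have key : ∀ f, IsProfile f → ∀ x r, f x r ≤ f (x - 1) r ∧ f (x - 1) r ≤ f x r + 1 ∧
      f x r ≤ f x (r + 1) ∧ f x (r + 1) ≤ f x r + 1 ∧ f x r ≤ f (x - 1) (r + 1) ∧
      f (x - 1) (r + 1) ≤ f x r + 1 := by
    intro f hf x r
    have h1 := hf.left_ge x r
    have h2 := hf.left_le x r
    have h3 := hf.up_ge x r
    have h4 := hf.up_le x r
    have h5 := hf.left_ge x (r + 1)
    refine ⟨h1, h2, h3, ?_, ?_, h4⟩ <;> linarith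
  simp only [CellAdj] at huv
  simp only [N]
  rcases huv with ⟨rfl, h1 | h1⟩ | ⟨rfl, h1 | h1⟩ | ⟨rfl, h1 | h1⟩
  · obtain rfl : x = y - 1 := by omega
    have hA := key _ h.profA y q
    have hB := key _ h.profB y q
    omega
  · subst h1
    have hA := key _ h.profA x q
    have hB := key _ h.profB x q
    omega
  · subst h1
    have hA := key _ h.profA y r
    have hB := key _ h.profB y r
    omega
  · subst h1
    have hA := key _ h.profA x r
    have hB := key _ h.profB x r
    omega
  · subst h1
    have hA := key _ h.profA x q
    have hB := key _ h.profB x q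
    omega
  · subst h1
    have hA := key _ h.profA y q
    have hB := key _ h.profB y q
    omega

/-- Flipping a set of cells of height less than `n` inside a bounded range. -/
theorem flip (h : Admissible n l t s) (hn : ∀ u ∈ F, u.2 < n)
    (hF : ∀ u ∈ F, ∀ v, CellAdj u v → v ∉ F → s.N v.1 v.2 = -c)
    (hM : ∃ M : ℤ, ∀ u ∈ F, -M < u.1 ∧ u.1 < M) : Admissible n l t (s.flip c F) := by
  have hp := isProfile_flip h.profA h.profB hF
  have hnot : ∀ x r, n ≤ r → (x, r) ∉ F := fun x r hr hx => absurd (hn _ hx) (by simpa using hr)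
  refine ⟨hp.1, hp.2, ?_, ?_, ?_⟩
  · intro x r hr
    rw [flip_A_notMem (hnot x r hr), flip_B_notMem (hnot x r hr)]
    exact h.top x r hr
  · intro x
    rw [flip_N_notMem (hnot x n le_rfl)]
    exact h.pos x
  · obtain ⟨M, hM⟩ := hM
    obtain ⟨M', hM'⟩ := h.lim
    refine ⟨max M M', fun r hr x => ⟨fun hx => ?_, fun hx => ?_⟩⟩
    · have : (x, r) ∉ F := fun hx' => by
        have := (hM _ hx').2
        have := le_max_left M M'
        simp only at *; omega
      rw [flip_A_notMem this, flip_B_notMem this]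
      exact (hM' r hr x).1 (le_trans (le_max_right _ _) hx)
    · have : (x, r) ∉ F := fun hx' => by
        have := (hM _ hx').1
        have := le_max_left M M'
        simp only at *; omega
      rw [flip_A_notMem this, flip_B_notMem this]
      exact (hM' r hr x).2 (by have := le_max_right M M'; omega)

/-- Far to either side `N` equals the height of the row, which is nonnegative. -/
theorem bounded_of_neg (h : Admissible n l t s) :
    ∃ M : ℤ, ∀ r ≤ n, ∀ x, s.N x r < 0 → -M < x ∧ x < M := by
  obtain ⟨M, hM⟩ := h.lim
  refine ⟨M, fun r hr x hx => ⟨?_, ?_⟩⟩ <;> by_contra hc <;> rw [not_lt] at hc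
  · have := (hM r hr x).2 hc
    unfold N at hx; omega
  · have := (hM r hr x).1 hc
    unfold N at hx; omega

end Admissible

end Heights

/-! ### The interpolating conditions and the parity rule on row `0` -/

namespace Heights

variable {n l : ℕ} {t s : Heights} {c : ℤ}

/-- The family of conditions that interpolates between the two sets of tuples of paths. -/
structure InX (n l : ℕ) (t : Heights) (c : ℤ) (s : Heights) : Prop where
  adm : Admissible n l t s
  le : ∀ x, s.N x 0 ≤ 0
  ge : ∀ x, -c ≤ s.N x 0
  rule : ∀ x k, s.N x 0 = 2 * k - 1 →
    Even (k + (countAbove (fun y => Even (s.N y 0) ∧ s.N y 0 ≠ 0 ∧ s.N y 0 ≠ -c) x : ℤ))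
  evenLow : ∀ V, ClosedIn n (s.sub (-c)) V → Even {x : ℤ | (x, 0) ∈ V}.ncard
  evenHigh : ∀ V, ClosedIn n (s.sup 0) V → (∀ u ∈ V, u.2 ≠ n) → Even {x : ℤ | (x, 0) ∈ V}.ncard

theorem Admissible.exists_bound (h : Admissible n l t s) : ∃ M : ℤ, ∀ y, M ≤ y → s.N y 0 = 0 := by
  obtain ⟨M, hM⟩ := h.lim
  refine ⟨M, fun y hy => ?_⟩
  have := (hM 0 (Nat.zero_le _) y).1 hy
  simp [N, this]

/-- The side of the level `-c` on which a cell of height `0` lies is determined by the parity of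
the number of cells of level `-c` to its right. -/
theorem lt_iff_odd (hc : 2 ≤ c) (hce : Even c) (h : InX n l t (2 * c) s) (x : ℤ)
    (hx : s.N x 0 ≠ -c) : s.N x 0 < -c ↔ Odd (countAbove (fun y => s.N y 0 = -c) x) := by
  obtain ⟨M, hM⟩ := h.adm.exists_bound
  have hMc : ∀ y, M ≤ y → ¬ s.N y 0 = -c := fun y hy h' => by rw [hM y hy] at h'; omega
  have hMe : ∀ y, M ≤ y → ¬ (Even (s.N y 0) ∧ s.N y 0 ≠ 0 ∧ s.N y 0 ≠ -(2 * c)) :=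
    fun y hy h' => h'.2.1 (hM y hy)
  revert hx
  refine int_induction_down (M := M) (P := fun x => s.N x 0 ≠ -c →
    (s.N x 0 < -c ↔ Odd (countAbove (fun y => s.N y 0 = -c) x))) ?_ ?_ x
  · intro x hx _
    rw [countAbove_eq_zero hMc hx, hM x hx]
    simp; omega
  · intro x ih hx
    have hadj : ∀ y, s.N y 0 ≤ s.N (y + 1) 0 + 1 ∧ s.N (y + 1) 0 ≤ s.N y 0 + 1 := fun y =>
      ⟨h.adm.N_adj (u := (y, 0)) (v := (y + 1, 0)) (by simp [CellAdj]),
        h.adm.N_adj (u := (y + 1, 0)) (v := (y, 0)) (by simp [CellAdj])⟩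
    by_cases hx1 : s.N (x + 1) 0 = -c
    · -- the run of cells of level `-c` to the right of `x`
      have hex : ∃ k : ℕ, s.N (x + 1 + k) 0 ≠ -c :=
        ⟨(M - x).toNat, hMc _ (by omega)⟩
      classical
      have hk := Nat.find_spec hex
      have hlt : ∀ j : ℕ, j < Nat.find hex → s.N (x + 1 + j) 0 = -c := fun j hj => by
        by_contra h'
        exact Nat.find_min hex hj h'
      set k := Nat.find hex
      have hk0 : k ≠ 0 := fun h0 => hk (by simpa [h0] using hx1)
      -- Both counts, of level `-c` and of the intermediate even levels, grow by one per cell of the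
      -- run, because `-c` is even and lies strictly between `-2c` and `0`.
      have hcount : ∀ j : ℕ, j ≤ k → ∀ Q : ℤ → Prop, (∀ y, M ≤ y → ¬ Q y) →
          (∀ y, s.N y 0 = -c → Q y) →
          countAbove Q x = countAbove Q (x + j) + j := by
        intro j hj Q hQM hQ
        induction j with
        | zero => simp
        | succ j ihj =>
          rw [ihj (by omega), countAbove_of_mem hQM
            (hQ _ (by have := hlt j (by omega); rwa [add_right_comm] at this))]
          push_cast
          ring_nf
      have hk' : s.N (x + k + 1) 0 ≠ -c := by rwa [add_right_comm] at hk
      have hlast : s.N (x + k) 0 = -c := by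
        have := hlt (k - 1) (by omega)
        rwa [show x + 1 + ((k - 1 : ℕ) : ℤ) = x + k by omega] at this
      have hy := ih (x + k + 1) (by omega) hk'
      have c1 := hcount k le_rfl (fun y => s.N y 0 = -c) hMc (fun y hy => hy)
      rw [countAbove_of_not (x := x + k) hk'] at c1
      have c2 := hcount k le_rfl _ hMe (fun y hy => ⟨by rw [hy]; exact hce.neg, by omega, by omega⟩)
      have a1 := hadj x
      have a2 := hadj (x + k)
      obtain ⟨d, hd⟩ := hce
      have hev : ¬ (Even (s.N (x + k + 1) 0) ∧ s.N (x + k + 1) 0 ≠ 0 ∧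
          s.N (x + k + 1) 0 ≠ -(2 * c)) := by
        rintro ⟨⟨e, he⟩, -, -⟩
        omega
      rw [countAbove_of_not (x := x + k) hev] at c2
      have r1 := h.rule x
      have r2 := h.rule (x + k + 1)
      rw [c2] at r1
      rw [c1]
      generalize countAbove (fun y => s.N y 0 = -c) (x + k + 1) = e1 at *
      generalize countAbove (fun y => Even (s.N y 0) ∧ s.N y 0 ≠ 0 ∧ s.N y 0 ≠ -(2 * c))
        (x + k + 1) = e2 at *
      -- The cells on both sides of the run have odd level `-c ± 1`. Comparing the rule at these two
      -- cells shows that the level is crossed exactly when the run has odd length.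
      have hv1 : s.N x 0 = -c - 1 ∨ s.N x 0 = -c + 1 := by omega
      have hv2 : s.N (x + k + 1) 0 = -c - 1 ∨ s.N (x + k + 1) 0 = -c + 1 := by omega
      rcases hv1 with hv1 | hv1 <;> rcases hv2 with hv2 | hv2
      · have := r1 (-d) (by omega); have := r2 (-d) (by omega)
        simp only [Int.even_iff, Nat.odd_iff] at *
        omega
      · have := r1 (-d) (by omega); have := r2 (-d + 1) (by omega)
        simp only [Int.even_iff, Nat.odd_iff] at *
        omega
      · have := r1 (-d + 1) (by omega); have := r2 (-d) (by omega)
        simp only [Int.even_iff, Nat.odd_iff] at *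
        omega
      · have := r1 (-d + 1) (by omega); have := r2 (-d + 1) (by omega)
        simp only [Int.even_iff, Nat.odd_iff] at *
        omega
    · rw [countAbove_of_not (x := x) hx1, ← ih (x + 1) (by omega) hx1]
      have := hadj x
      omega

/-- Transfer of the parity rule under a flip at level `-c`, on the cells of height `0`. -/
theorem rule_iff (hce : Even c) {N N' : ℤ → ℤ} {F : Set ℤ} {M : ℤ}
    (hc : 2 ≤ c) (hM : ∀ y, M ≤ y → N y = 0)
    (hF : ∀ x ∈ F, N x < -c ∧ -(2 * c) ≤ N x ∧ N' x = -2 * c - N x)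
    (hF' : ∀ x, x ∉ F → -c ≤ N x ∧ N x ≤ 0 ∧ N' x = N x)
    (ho : ∀ x, N x ≠ -c → (x ∈ F ↔ Odd (countAbove (fun y => N y = -c) x))) :
    (∀ x k, N x = 2 * k - 1 →
      Even (k + (countAbove (fun y => Even (N y) ∧ N y ≠ 0 ∧ N y ≠ -(2 * c)) x : ℤ))) ↔
    (∀ x k, N' x = 2 * k - 1 →
      Even (k + (countAbove (fun y => Even (N' y) ∧ N' y ≠ 0 ∧ N' y ≠ -c) x : ℤ))) := by
  -- The reflection `N ↦ -2c - N` exchanges the exceptional levels `-2c` and `0` and fixes `-c`. So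
  -- the intermediate even levels for `2c` are those for `c` together with `-c` itself.
  have hcount : ∀ x, countAbove (fun y => Even (N y) ∧ N y ≠ 0 ∧ N y ≠ -(2 * c)) x =
      countAbove (fun y => Even (N' y) ∧ N' y ≠ 0 ∧ N' y ≠ -c) x +
      countAbove (fun y => N y = -c) x := by
    intro x
    rw [← countAbove_or (M := M)]
    · apply countAbove_congr
      intro y
      by_cases hy : y ∈ F
      · have := hF y hy
        simp only [Int.even_iff] at *
        omega
      · have := hF' y hy
        simp only [Int.even_iff] at *
        omega
    · intro y hy
      have := hM y hy
      by_cases hyF : y ∈ F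
      · have := hF y hyF
        omega
      · have := hF' y hyF
        simp only [Int.even_iff] at *
        omega
    · intro y
      by_cases hyF : y ∈ F
      · have := hF y hyF
        omega
      · have := hF' y hyF
        omega
  obtain ⟨d, hd⟩ := hce
  constructor
  · intro h x k hk
    by_cases hx : x ∈ F
    · have h1 := hF x hx
      have h2 := (ho x (by omega)).1 hx
      -- The reflected form of `2k - 1` is `2(-c - k + 1) - 1`. Passing from `k` to `-c - k + 1`
      -- changes the parity, which compensates the odd number of cells of level `-c` to the right.
      have h3 := h x (-c - k + 1) (by omega)
      rw [hcount] at h3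
      simp only [Int.even_iff, Nat.odd_iff] at *
      push_cast at h3
      omega
    · have h1 := hF' x hx
      have h2 := mt (ho x (by omega)).2 hx
      have h3 := h x k (by omega)
      rw [hcount] at h3
      simp only [Int.even_iff, Nat.odd_iff] at *
      push_cast at h3
      omega
  · intro h x k hk
    rw [hcount]
    by_cases hx : x ∈ F
    · have h1 := hF x hx
      have h2 := (ho x (by omega)).1 hx
      have h3 := h x (-c - k + 1) (by omega)
      simp only [Int.even_iff, Nat.odd_iff] at *
      push_cast
      omega
    · have h1 := hF' x hx
      have h2 := mt (ho x (by omega)).2 hx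
      have h3 := h x k (by omega)
      simp only [Int.even_iff, Nat.odd_iff] at *
      push_cast
      omega

end Heights

/-! ### Two parity arguments in the triangular lattice -/

/-- If the values at the three sides of each triangle add up to `0`, then the sum over the
horizontal edges is the same for two consecutive rows. -/
theorem finsum_row_eq {h v w : ℤ → ℕ → ZMod 2} {r : ℕ}
    (hv : (Function.support fun x => v x r).Finite) (hw : (Function.support fun x => w x r).Finite)
    (t1 : ∀ x, h x r = v x r + w x r) (t2 : ∀ x, h x (r + 1) = v (x + 1) r + w x r) :
    ∑ᶠ x, h x r = ∑ᶠ x, h x (r + 1) := by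
  have hv' : (Function.support fun x => v (x + 1) r).Finite :=
    hv.preimage (f := fun x : ℤ => x + 1) (add_left_injective 1).injOn
  simp only [t1, t2]
  rw [finsum_add_distrib hv hw, finsum_add_distrib hv' hw]
  congr 1
  -- The two rows see the same slanted edges; the vertical ones are only shifted by one.
  exact (finsum_comp_equiv (f := fun x => v x r) (Equiv.addRight (1 : ℤ))).symm

/-- The function that separates the cells outside a set `T` on both sides of a path in `T` from
`(u, 0)` to a cell `w`, up to the jumps along the ray from `w` upwards. -/
theorem exists_separating {n : ℕ} {T : Set (ℤ × ℕ)} {u : ℤ} {w : ℤ × ℕ}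
    (h : Reached n T {u} w) :
    ∃ f : ℤ → ℕ → Prop, (∀ y, (y, 0) ∉ T → (f y 0 ↔ u < y)) ∧
      (∀ y q, (y, q) ∉ T → (y + 1, q) ∉ T →
        ((f y q ↔ f (y + 1) q) ↔ ¬ (y + 1 = w.1 ∧ w.2 ≤ q))) ∧
      (∀ y q, (y, q) ∉ T → (y, q + 1) ∉ T → (f y q ↔ f y (q + 1))) ∧
      (∀ y q, (y, q) ∉ T → (y - 1, q + 1) ∉ T →
        ((f y q ↔ f (y - 1) (q + 1)) ↔ ¬ (y = w.1 ∧ w.2 ≤ q))) := by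
  induction h with
  | base x hx hT =>
    obtain rfl : x = u := hx
    -- For the trivial path the ray is the whole column of `x`, and the separating function is the
    -- step function at this column.
    refine ⟨fun y _ => x ≤ y, fun y hy => ?_, fun y q _ _ => ?_, fun y q _ _ => Iff.rfl,
      fun y q _ _ => ?_⟩
    · have : y ≠ x := fun h => hy (h ▸ hT)
      omega
    · simp only; omega
    · simp only; omega
  | step a b ha hb hn hab ih =>
    obtain ⟨f, h0, hH, hV, hW⟩ := ih
    have haT : a ∈ T := (closedIn_reached n T {u}).mem a ha
    obtain ⟨x, r⟩ := a
    obtain ⟨x', r'⟩ := b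
    have hne : ∀ y q, (y, q) ∉ T → ¬ (y = x ∧ q = r) ∧ ¬ (y = x' ∧ q = r') := by
      intro y q hyq
      constructor
      · rintro ⟨rfl, rfl⟩; exact hyq haT
      · rintro ⟨rfl, rfl⟩; exact hyq hb
    simp only at *
    simp only [CellAdj] at hab
    rcases hab with ⟨h1, h2 | h2⟩ | ⟨h1, h2 | h2⟩ | ⟨h1, h2 | h2⟩
    -- When the end of the path changes column, the jump moves to the new column by negating `f` on
    -- the part of one column that lies between the two rays. Vertical moves need no change, since
    -- the rays then differ only in a cell of `T`.
    · refine ⟨fun y q => (f y q ↔ ¬ (y = x ∧ r ≤ q)), fun y hy => ?_, fun y q h3 h4 => ?_,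
        fun y q h3 h4 => ?_, fun y q h3 h4 => ?_⟩
      · have h5 := hne _ _ hy; have h6 := h0 y hy
        simp only [h6]; omega
      · have h5 := hne _ _ h3; have h6 := hne _ _ h4; have h7 := hH y q h3 h4
        by_cases p : f y q <;> by_cases p' : f (y + 1) q <;>
          simp only [p, p', iff_true, iff_false, true_iff, false_iff, not_true_eq_false,
            not_not] at h7 ⊢ <;> omega
      · have h5 := hne _ _ h3; have h6 := hne _ _ h4; have h7 := hV y q h3 h4
        by_cases p : f y q <;> by_cases p' : f y (q + 1) <;>
          simp only [p, p', iff_true, iff_false, true_iff, false_iff, not_true_eq_false,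
            not_not] at h7 ⊢ <;> omega
      · have h5 := hne _ _ h3; have h6 := hne _ _ h4; have h7 := hW y q h3 h4
        by_cases p : f y q <;> by_cases p' : f (y - 1) (q + 1) <;>
          simp only [p, p', iff_true, iff_false, true_iff, false_iff, not_true_eq_false,
            not_not] at h7 ⊢ <;> omega
    · refine ⟨fun y q => (f y q ↔ ¬ (y = x' ∧ r ≤ q)), fun y hy => ?_, fun y q h3 h4 => ?_,
        fun y q h3 h4 => ?_, fun y q h3 h4 => ?_⟩
      · have h5 := hne _ _ hy; have h6 := h0 y hy
        simp only [h6]; omega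
      · have h5 := hne _ _ h3; have h6 := hne _ _ h4; have h7 := hH y q h3 h4
        by_cases p : f y q <;> by_cases p' : f (y + 1) q <;>
          simp only [p, p', iff_true, iff_false, true_iff, false_iff, not_true_eq_false,
            not_not] at h7 ⊢ <;> omega
      · have h5 := hne _ _ h3; have h6 := hne _ _ h4; have h7 := hV y q h3 h4
        by_cases p : f y q <;> by_cases p' : f y (q + 1) <;>
          simp only [p, p', iff_true, iff_false, true_iff, false_iff, not_true_eq_false,
            not_not] at h7 ⊢ <;> omega
      · have h5 := hne _ _ h3; have h6 := hne _ _ h4; have h7 := hW y q h3 h4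
        by_cases p : f y q <;> by_cases p' : f (y - 1) (q + 1) <;>
          simp only [p, p', iff_true, iff_false, true_iff, false_iff, not_true_eq_false,
            not_not] at h7 ⊢ <;> omega
    · refine ⟨f, h0, fun y q h3 h4 => ?_, hV, fun y q h3 h4 => ?_⟩
      · have h5 := hne _ _ h3; have h6 := hne _ _ h4; have h7 := hH y q h3 h4
        by_cases p : f y q <;> by_cases p' : f (y + 1) q <;>
          simp only [p, p', iff_true, iff_false, true_iff, false_iff, not_true_eq_false,
            not_not] at h7 ⊢ <;> omega
      · have h5 := hne _ _ h3; have h6 := hne _ _ h4; have h7 := hW y q h3 h4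
        by_cases p : f y q <;> by_cases p' : f (y - 1) (q + 1) <;>
          simp only [p, p', iff_true, iff_false, true_iff, false_iff, not_true_eq_false,
            not_not] at h7 ⊢ <;> omega
    · refine ⟨fun y q => (f y q ↔ ¬ (y = x' ∧ r' ≤ q)), fun y hy => ?_, fun y q h3 h4 => ?_,
        fun y q h3 h4 => ?_, fun y q h3 h4 => ?_⟩
      · have h5 := hne _ _ hy; have h6 := h0 y hy
        simp only [h6]; omega
      · have h5 := hne _ _ h3; have h6 := hne _ _ h4; have h7 := hH y q h3 h4
        by_cases p : f y q <;> by_cases p' : f (y + 1) q <;>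
          simp only [p, p', iff_true, iff_false, true_iff, false_iff, not_true_eq_false,
            not_not] at h7 ⊢ <;> omega
      · have h5 := hne _ _ h3; have h6 := hne _ _ h4; have h7 := hV y q h3 h4
        by_cases p : f y q <;> by_cases p' : f y (q + 1) <;>
          simp only [p, p', iff_true, iff_false, true_iff, false_iff, not_true_eq_false,
            not_not] at h7 ⊢ <;> omega
      · have h5 := hne _ _ h3; have h6 := hne _ _ h4; have h7 := hW y q h3 h4
        by_cases p : f y q <;> by_cases p' : f (y - 1) (q + 1) <;>
          simp only [p, p', iff_true, iff_false, true_iff, false_iff, not_true_eq_false,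
            not_not] at h7 ⊢ <;> omega
    · refine ⟨f, h0, fun y q h3 h4 => ?_, hV, fun y q h3 h4 => ?_⟩
      · have h5 := hne _ _ h3; have h6 := hne _ _ h4; have h7 := hH y q h3 h4
        by_cases p : f y q <;> by_cases p' : f (y + 1) q <;>
          simp only [p, p', iff_true, iff_false, true_iff, false_iff, not_true_eq_false,
            not_not] at h7 ⊢ <;> omega
      · have h5 := hne _ _ h3; have h6 := hne _ _ h4; have h7 := hW y q h3 h4
        by_cases p : f y q <;> by_cases p' : f (y - 1) (q + 1) <;>
          simp only [p, p', iff_true, iff_false, true_iff, false_iff, not_true_eq_false,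
            not_not] at h7 ⊢ <;> omega
    · refine ⟨fun y q => (f y q ↔ ¬ (y = x ∧ r ≤ q)), fun y hy => ?_, fun y q h3 h4 => ?_,
        fun y q h3 h4 => ?_, fun y q h3 h4 => ?_⟩
      · have h5 := hne _ _ hy; have h6 := h0 y hy
        simp only [h6]; omega
      · have h5 := hne _ _ h3; have h6 := hne _ _ h4; have h7 := hH y q h3 h4
        by_cases p : f y q <;> by_cases p' : f (y + 1) q <;>
          simp only [p, p', iff_true, iff_false, true_iff, false_iff, not_true_eq_false,
            not_not] at h7 ⊢ <;> omega
      · have h5 := hne _ _ h3; have h6 := hne _ _ h4; have h7 := hV y q h3 h4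
        by_cases p : f y q <;> by_cases p' : f y (q + 1) <;>
          simp only [p, p', iff_true, iff_false, true_iff, false_iff, not_true_eq_false,
            not_not] at h7 ⊢ <;> omega
      · have h5 := hne _ _ h3; have h6 := hne _ _ h4; have h7 := hW y q h3 h4
        by_cases p : f y q <;> by_cases p' : f (y - 1) (q + 1) <;>
          simp only [p, p', iff_true, iff_false, true_iff, false_iff, not_true_eq_false,
            not_not] at h7 ⊢ <;> omega

open scoped Classical in
/-- The number, modulo `2`, of ways in which the pair `(a, b)` joins `V` and `F`. -/
noncomputable def joins (V F : Set (ℤ × ℕ)) (a b : ℤ × ℕ) : ZMod 2 :=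
  (if a ∈ V then 1 else 0) * (if b ∈ F then 1 else 0) +
  (if a ∈ F then 1 else 0) * (if b ∈ V then 1 else 0)

theorem joins_eq_zero {V F : Set (ℤ × ℕ)} {a b : ℤ × ℕ} (ha : a ∉ F) (hb : b ∉ F) :
    joins V F a b = 0 := by
  simp [joins, ha, hb]

theorem finite_support_joins {V F : Set (ℤ × ℕ)} (hM : ∃ M : ℤ, ∀ u ∈ F, -M < u.1 ∧ u.1 < M)
    (i j : ℤ) (q r : ℕ) : (Function.support fun x : ℤ => joins V F (x + i, q) (x + j, r)).Finite := by
  obtain ⟨M, hM⟩ := hM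
  refine ((Set.finite_Ioo (-M - i) (M - i)).union (Set.finite_Ioo (-M - j) (M - j))).subset ?_
  intro x hx
  by_contra h
  simp only [Set.mem_union, Set.mem_Ioo, not_or] at h
  refine hx (joins_eq_zero (fun h' => h.1 ?_) fun h' => h.2 ?_)
  · have := hM _ h'
    simp only at this
    omega
  · have := hM _ h'
    simp only at this
    omega

/-- The Boolean form of the statement on one triangle: two vertices in different sets force the
third vertex into one of them, so the number of edges joining the two sets is `0` or `2`. -/
theorem joins_aux : ∀ p p' q q' r r' : Bool, (p = true → ¬ p' = true) → (q = true → ¬ q' = true) →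
    (r = true → ¬ r' = true) → (p = true → q' = true → r = true ∨ r' = true) →
    (q = true → p' = true → r = true ∨ r' = true) →
    (p = true → r' = true → q = true ∨ q' = true) →
    (r = true → p' = true → q = true ∨ q' = true) →
    (q = true → r' = true → p = true ∨ p' = true) →
    (r = true → q' = true → p = true ∨ p' = true) →
    ((if p = true then 1 else 0) * (if q' = true then 1 else 0) +
      (if p' = true then 1 else 0) * (if q = true then 1 else 0) : ZMod 2) =
    ((if p = true then 1 else 0) * (if r' = true then 1 else 0) +
      (if p' = true then 1 else 0) * (if r = true then 1 else 0)) +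
    ((if q = true then 1 else 0) * (if r' = true then 1 else 0) +
      (if q' = true then 1 else 0) * (if r = true then 1 else 0)) := by
  intro p p' q q' r r'
  cases p <;> cases p' <;> cases q <;> cases q' <;> cases r <;> cases r' <;> simp <;> decide

open scoped Classical in
/-- A set `V` and a set `F` of cells with the property that a cell adjacent to adjacent cells of
`V` and `F` belongs to `V` or `F` have an even number of contacts at height `0`. -/
theorem finsum_joins_eq_zero {n : ℕ} {V F : Set (ℤ × ℕ)} (hd : ∀ u ∈ V, u ∉ F)
    (hF : ∀ u ∈ F, u.2 < n) (hM : ∃ M : ℤ, ∀ u ∈ F, -M < u.1 ∧ u.1 < M)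
    (ht : ∀ a ∈ V, ∀ b ∈ F, ∀ d, d.2 ≤ n → CellAdj a b → CellAdj a d → CellAdj b d →
      d ∈ V ∨ d ∈ F) :
    ∑ᶠ x : ℤ, joins V F (x, 0) (x + 1, 0) = 0 := by
  have tri : ∀ a b d : ℤ × ℕ, a.2 ≤ n → b.2 ≤ n → d.2 ≤ n → CellAdj a b → CellAdj a d →
      CellAdj b d → joins V F a b = joins V F a d + joins V F b d := by
    intro a b d ha hb hdn hab had hbd
    have h1 := fun p q => ht a p b q d hdn hab had hbd
    have h2 := fun p q => ht b p a q d hdn hab.symm hbd had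
    have h3 := fun p q => ht a p d q b hb had hab hbd.symm
    have h4 := fun p q => ht d p a q b hb had.symm hbd.symm hab
    have h5 := fun p q => ht b p d q a ha hbd hab.symm had.symm
    have h6 := fun p q => ht d p b q a ha hbd.symm had.symm hab.symm
    have h := joins_aux (decide (a ∈ V)) (decide (a ∈ F)) (decide (b ∈ V)) (decide (b ∈ F))
      (decide (d ∈ V)) (decide (d ∈ F))
    simp only [decide_eq_true_eq] at h
    simpa only [joins] using h (hd a) (hd b) (hd d) h1 h2 h3 h4 h5 h6
  have hrow : ∀ r, r ≤ n →
      ∑ᶠ x : ℤ, joins V F (x, 0) (x + 1, 0) = ∑ᶠ x : ℤ, joins V F (x, r) (x + 1, r) := by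
    intro r
    induction r with
    | zero => intro _; rfl
    | succ r ih =>
      intro hr
      rw [ih (by omega)]
      refine finsum_row_eq (h := fun x q => joins V F (x, q) (x + 1, q))
        (v := fun x q => joins V F (x, q) (x, q + 1))
        (w := fun x q => joins V F (x + 1, q) (x, q + 1)) ?_ ?_ ?_ ?_
      · simpa using finite_support_joins hM 0 0 r (r + 1)
      · simpa using finite_support_joins hM 1 0 r (r + 1)
      · intro x
        exact tri _ _ _ (by simp; omega) (by simp; omega) hr (by simp [CellAdj]) (by simp [CellAdj])
          (by simp [CellAdj])
      · intro x
        have := tri (x, r + 1) (x + 1, r + 1) (x + 1, r) hr hr (by simp; omega)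
          (by simp [CellAdj]) (by simp [CellAdj]) (by simp [CellAdj])
        simp only [this]
        rw [add_comm]
        congr 1 <;> simp only [joins] <;> ring
  -- The sum is carried up to row `n`, which `F` does not meet.
  rw [hrow n le_rfl]
  apply finsum_eq_zero_of_forall_eq_zero
  intro x
  exact joins_eq_zero (fun h => absurd (hF _ h) (lt_irrefl _)) fun h => absurd (hF _ h) (lt_irrefl _)

open scoped Classical in
theorem finsum_indicator_eq {S : Set ℤ} (hS : S.Finite) :
    ∑ᶠ x : ℤ, (if x ∈ S then (1 : ZMod 2) else 0) = S.ncard := by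
  rw [finsum_eq_sum_of_support_subset (s := hS.toFinset)]
  · rw [Set.ncard_eq_toFinset_card S hS, Finset.sum_ite_of_true]
    · simp
    · intro x hx; simpa using hx
  · intro x hx
    simp only [Function.mem_support, ne_eq, ite_eq_right_iff, one_ne_zero, imp_false,
      not_not] at hx
    simpa using hx

/-! ### The regions to be flipped and the parity along paths -/

namespace Heights

variable {n l : ℕ} {t s : Heights} {c : ℤ}

/-- The cells that can be reached from height `0` inside `N < -c`. -/
def lowSet (n : ℕ) (c : ℤ) (s : Heights) : Set (ℤ × ℕ) :=
  {v | Reached n (s.sub (-c - 1)) Set.univ v}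

/-- The cells that can be reached inside `N > -c` from those cells of height `0` that have an odd
number of cells of level `-c` to their right. -/
def highSet (n : ℕ) (c : ℤ) (s : Heights) : Set (ℤ × ℕ) :=
  {v | Reached n (s.sup (-c + 1)) {x | Odd (countAbove (fun y => s.N y 0 = -c) x)} v}

theorem N_le_of_mem_lowSet {v : ℤ × ℕ} (hv : v ∈ lowSet n c s) : s.N v.1 v.2 ≤ -c - 1 :=
  (closedIn_reached n _ _).mem v hv

theorem le_N_of_mem_highSet {v : ℤ × ℕ} (hv : v ∈ highSet n c s) : -c + 1 ≤ s.N v.1 v.2 :=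
  (closedIn_reached n _ _).mem v hv

theorem mem_lowSet_zero {x : ℤ} : (x, 0) ∈ lowSet n c s ↔ s.N x 0 < -c := by
  constructor
  · intro h
    have := N_le_of_mem_lowSet h
    simp only at this
    omega
  · intro h
    exact Reached.base x (Set.mem_univ x) (show s.N x 0 ≤ -c - 1 by omega)

/-- Here positivity enters: on row `n` the level is at least `-1`, hence not below `-c`. -/
theorem lowSet_lt (h : Admissible n l t s) (hc : 2 ≤ c) {u : ℤ × ℕ} (hu : u ∈ lowSet n c s) :
    u.2 < n := by
  refine lt_of_le_of_ne ((closedIn_reached n _ _).le u hu) fun he => ?_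
  have h1 := N_le_of_mem_lowSet hu
  have h2 := h.pos u.1
  rw [he] at h1
  omega

/-- A neighbour has level at most `-c`, since levels change by at most one. If it were below `-c`,
it would have been reached too, as the region stays under row `n`. -/
theorem lowSet_adj (h : Admissible n l t s) (hc : 2 ≤ c) {u v : ℤ × ℕ} (hu : u ∈ lowSet n c s)
    (huv : CellAdj u v) (hv : v ∉ lowSet n c s) : s.N v.1 v.2 = -c := by
  have h1 := N_le_of_mem_lowSet hu
  have h2 := h.N_adj huv.symm
  have h3 := lowSet_lt h hc hu
  by_contra hne
  refine hv ((closedIn_reached n _ _).closed u hu v ?_ ?_ huv)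
  · change s.N v.1 v.2 ≤ -c - 1
    omega
  · unfold CellAdj at huv
    omega

theorem lowSet_bounded (h : Admissible n l t s) (hc : 2 ≤ c) :
    ∃ M : ℤ, ∀ u ∈ lowSet n c s, -M < u.1 ∧ u.1 < M := by
  obtain ⟨M, hM⟩ := h.bounded_of_neg
  refine ⟨M, fun u hu => hM u.2 (lowSet_lt h hc hu).le u.1 ?_⟩
  have := N_le_of_mem_lowSet hu
  omega

theorem admissible_flip_lowSet (h : Admissible n l t s) (hc : 2 ≤ c) :
    Admissible n l t (s.flip c (lowSet n c s)) :=
  h.flip (fun _ hu => lowSet_lt h hc hu) (fun _ hu _ huv hv => lowSet_adj h hc hu huv hv)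
    (lowSet_bounded h hc)

/-- The reachability in `N > -c` preserves the parity of the number of cells of level `-c` to the
right, and no cell of height `n` is reached if this parity is odd. -/
theorem odd_iff_of_reached (h : InX n l t c s) {u : ℤ} {w : ℤ × ℕ}
    (hw : Reached n (s.sup (-c + 1)) {u} w) :
    (w.2 = n → Even (countAbove (fun y => s.N y 0 = -c) u)) ∧
    (w.2 = 0 → (Odd (countAbove (fun y => s.N y 0 = -c) u) ↔
      Odd (countAbove (fun y => s.N y 0 = -c) w.1))) := by
  obtain ⟨f, h0, hH, hV, hW⟩ := exists_separating hw
  have hwT : -c + 1 ≤ s.N w.1 w.2 := (closedIn_reached n _ _).mem w hw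
  have hT : ∀ y q, (y, q) ∉ s.sup (-c + 1) ↔ s.N y q ≤ -c := by
    intro y q
    change ¬ (-c + 1 ≤ s.N y q) ↔ _
    omega
  have huT : -c + 1 ≤ s.N u 0 := by
    clear h0 hH hV hW hwT
    induction hw with
    | base x hx hT => exact hx ▸ hT
    | step a b ha hb hn hab ih => exact ih
  constructor
  · intro hn
    -- If the path ends on row `n`, the ray inside the strip is the end cell alone, so `f` has no
    -- jump between cells of level at most `-c`. One side of the path is then a closed set whose
    -- trace on row `0` is everything of level `-c` beyond `u`.
    have hcl : ClosedIn n (s.sub (-c)) {v | v.2 ≤ n ∧ s.N v.1 v.2 ≤ -c ∧ f v.1 v.2} := by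
      refine ⟨fun v hv => hv.2.1, fun v hv => hv.1, ?_⟩
      rintro ⟨x, r⟩ ⟨h1, h2, h3⟩ ⟨x', r'⟩ h4 h5 h6
      refine ⟨h5, h4, ?_⟩
      simp only [CellAdj] at h1 h2 h3 h4 h5 h6 ⊢
      replace h4 : s.N x' r' ≤ -c := h4
      have hex : ∀ q, q ≤ n → s.N w.1 q ≤ -c → ¬ w.2 ≤ q := by
        intro q hq hq' hle
        obtain rfl : q = w.2 := by omega
        omega
      rcases h6 with ⟨rfl, rfl | rfl⟩ | ⟨rfl, rfl | rfl⟩ | ⟨rfl, rfl | rfl⟩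
      · refine ((hH x r' ((hT _ _).2 h2) ((hT _ _).2 h4)).2 ?_).1 h3
        rintro ⟨e, hr⟩
        exact hex _ h5 (e ▸ h4) hr
      · have := hH (x - 1) r' ((hT _ _).2 h4) ((hT _ _).2 (by rwa [sub_add_cancel]))
        rw [sub_add_cancel] at this
        refine (this.2 ?_).2 h3
        rintro ⟨e, hr⟩
        exact hex _ h5 (e ▸ h2) hr
      · exact (hV x' r ((hT _ _).2 h2) ((hT _ _).2 h4)).1 h3
      · refine ((hW x r ((hT _ _).2 h2) ((hT _ _).2 h4)).2 ?_).1 h3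
        rintro ⟨e, hr⟩
        exact hex _ h1 (e ▸ h2) hr
      · exact (hV _ r' ((hT _ _).2 h4) ((hT _ _).2 h2)).2 h3
      · refine ((hW x' r' ((hT _ _).2 h4) ((hT _ _).2 h2)).2 ?_).2 h3
        rintro ⟨e, hr⟩
        exact hex _ h5 (e ▸ h4) hr
    convert h.evenLow _ hcl using 1
    unfold countAbove
    congr 1
    ext y
    simp only [Set.mem_ofPred_eq]
    have := h.ge y
    constructor
    · rintro ⟨h1, h2⟩
      exact ⟨Nat.zero_le _, h2.le, (h0 y ((hT _ _).2 h2.le)).2 h1⟩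
    · rintro ⟨-, h1, h2⟩
      exact ⟨(h0 y ((hT _ _).2 h1)).1 h2, by omega⟩
  · intro hw0
    rw [hw0] at hH hW hwT
    -- If the path ends on row `0`, the ray is the full column of `w`, and comparing `f` with the
    -- step function at `w` cancels the jump. The trace on row `0` consists of the cells of level
    -- `-c` strictly between `u` and `w`.
    have hcl : ClosedIn n (s.sub (-c))
        {v | v.2 ≤ n ∧ s.N v.1 v.2 ≤ -c ∧ (f v.1 v.2 ↔ ¬ w.1 ≤ v.1)} := by
      refine ⟨fun v hv => hv.2.1, fun v hv => hv.1, ?_⟩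
      rintro ⟨x, r⟩ ⟨h1, h2, h3⟩ ⟨x', r'⟩ h4 h5 h6
      refine ⟨h5, h4, ?_⟩
      simp only [CellAdj] at h1 h2 h3 h4 h5 h6 ⊢
      replace h4 : s.N x' r' ≤ -c := h4
      rcases h6 with ⟨rfl, rfl | rfl⟩ | ⟨rfl, rfl | rfl⟩ | ⟨rfl, rfl | rfl⟩
      · have := hH x r' ((hT _ _).2 h2) ((hT _ _).2 h4)
        by_cases p : f x r' <;> by_cases p' : f (x + 1) r' <;>
          simp only [p, p', iff_true, iff_false, true_iff, false_iff, not_true_eq_false,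
            not_not] at this h3 ⊢ <;> omega
      · have := hH (x - 1) r' ((hT _ _).2 h4) ((hT _ _).2 (by rwa [sub_add_cancel]))
        rw [sub_add_cancel] at this
        by_cases p : f x r' <;> by_cases p' : f (x - 1) r' <;>
          simp only [p, p', iff_true, iff_false, true_iff, false_iff, not_true_eq_false,
            not_not] at this h3 ⊢ <;> omega
      · rwa [← hV x' r ((hT _ _).2 h2) ((hT _ _).2 h4)]
      · have := hW x r ((hT _ _).2 h2) ((hT _ _).2 h4)
        by_cases p : f x r <;> by_cases p' : f (x - 1) (r + 1) <;>
          simp only [p, p', iff_true, iff_false, true_iff, false_iff, not_true_eq_false,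
            not_not] at this h3 ⊢ <;> omega
      · rwa [hV _ r' ((hT _ _).2 h4) ((hT _ _).2 h2)]
      · have := hW x' r' ((hT _ _).2 h4) ((hT _ _).2 h2)
        by_cases p : f x' r' <;> by_cases p' : f (x' - 1) (r' + 1) <;>
          simp only [p, p', iff_true, iff_false, true_iff, false_iff, not_true_eq_false,
            not_not] at this h3 ⊢ <;> omega
    have hev := h.evenLow _ hcl
    obtain ⟨M, hM⟩ := h.adm.exists_bound
    have hc : 0 < c ∨ c ≤ 0 := lt_or_ge _ _
    rcases hc with hc | hc
    swap
    -- For `c ≤ 0` the start of the path would have positive level on row `0`, which is excluded.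
    -- The other case is needed for the finiteness of the counts.
    · have e1 := h.le u
      have e2 := h.le w.1
      have e3 := h.ge u
      omega
    have hfin : ∀ z : ℤ, {y | z < y ∧ s.N y 0 = -c}.Finite := fun z =>
      finite_above (M := M) (fun y hy h' => by rw [hM y hy] at h'; omega) z
    have hset : ∀ y, (s.N y 0 ≤ -c ∧ (f y 0 ↔ ¬ w.1 ≤ y)) ↔
        s.N y 0 = -c ∧ ((u < y ∧ y < w.1) ∨ (y < u ∧ w.1 < y)) := by
      intro y
      have h1 := h.ge y
      by_cases hy : s.N y 0 ≤ -c
      · have h2 := h0 y ((hT _ _).2 hy)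
        have hyw : y ≠ w.1 := by rintro rfl; omega
        have hyu : y ≠ u := by rintro rfl; omega
        rw [h2]
        omega
      · omega
    have hbot : {x : ℤ | (x, 0) ∈ {v : ℤ × ℕ | v.2 ≤ n ∧ s.N v.1 v.2 ≤ -c ∧
        (f v.1 v.2 ↔ ¬ w.1 ≤ v.1)}} =
        {y | s.N y 0 = -c ∧ ((u < y ∧ y < w.1) ∨ (y < u ∧ w.1 < y))} := by
      ext y
      simp only [Set.mem_ofPred_eq, ← hset y]
      simp
    rw [hbot] at hev
    rcases le_total u w.1 with huw | huw
    · have : countAbove (fun y => s.N y 0 = -c) u =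
          {y | s.N y 0 = -c ∧ ((u < y ∧ y < w.1) ∨ (y < u ∧ w.1 < y))}.ncard +
          countAbove (fun y => s.N y 0 = -c) w.1 := by
        unfold countAbove
        rw [← Set.ncard_union_eq _ ((hfin u).subset _) (hfin w.1)]
        · congr 1
          ext y
          have hyw : s.N y 0 = -c → y ≠ w.1 := by rintro h rfl; omega
          simp only [Set.mem_ofPred_eq, Set.mem_union]
          omega
        · rw [Set.disjoint_left]
          rintro y ⟨h1, h2⟩ ⟨h3, h4⟩
          omega
        · rintro y ⟨h1, h2⟩
          exact ⟨by omega, h1⟩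
      rw [this]
      rw [Nat.odd_add, Nat.odd_iff, Nat.odd_iff, Nat.even_iff]
      rw [Nat.even_iff] at hev
      omega
    · have : countAbove (fun y => s.N y 0 = -c) w.1 =
          {y | s.N y 0 = -c ∧ ((u < y ∧ y < w.1) ∨ (y < u ∧ w.1 < y))}.ncard +
          countAbove (fun y => s.N y 0 = -c) u := by
        unfold countAbove
        rw [← Set.ncard_union_eq _ ((hfin w.1).subset _) (hfin u)]
        · congr 1
          ext y
          have hyw : s.N y 0 = -c → y ≠ u := by rintro h rfl; omega
          simp only [Set.mem_ofPred_eq, Set.mem_union]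
          omega
        · rw [Set.disjoint_left]
          rintro y ⟨h1, h2⟩ ⟨h3, h4⟩
          omega
        · rintro y ⟨h1, h2⟩
          exact ⟨by omega, h1⟩
      rw [this]
      rw [Nat.odd_add, Nat.odd_iff, Nat.odd_iff, Nat.even_iff]
      rw [Nat.even_iff] at hev
      omega

end Heights

/-! ### The flips between the conditions for `2c` and for `c` -/

namespace Heights

variable {n l : ℕ} {t s : Heights} {c : ℤ} {F : Set (ℤ × ℕ)}

/-- A path in `N > -c` to row `n` can only start at an even position, whereas the region starts from
the odd ones. -/
theorem highSet_lt (h : InX n l t c s) {u : ℤ × ℕ} (hu : u ∈ highSet n c s) : u.2 < n := by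
  refine lt_of_le_of_ne ((closedIn_reached n _ _).le u hu) fun he => ?_
  obtain ⟨x, hx, hr⟩ := Reached.exists_mem hu
  exact Nat.not_even_iff_odd.2 hx ((odd_iff_of_reached h hr).1 he)

theorem highSet_adj (h : InX n l t c s) {u v : ℤ × ℕ} (hu : u ∈ highSet n c s)
    (huv : CellAdj u v) (hv : v ∉ highSet n c s) : s.N v.1 v.2 = -c := by
  have h1 := le_N_of_mem_highSet hu
  have h2 := h.adm.N_adj huv
  have h3 := highSet_lt h hu
  by_contra hne
  refine hv ((closedIn_reached n _ _).closed u hu v ?_ ?_ huv)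
  · change -c + 1 ≤ s.N v.1 v.2
    omega
  · unfold CellAdj at huv
    omega

theorem mem_highSet_zero (h : InX n l t c s) {x : ℤ} :
    (x, 0) ∈ highSet n c s ↔
      -c + 1 ≤ s.N x 0 ∧ Odd (countAbove (fun y => s.N y 0 = -c) x) := by
  constructor
  · intro hx
    obtain ⟨y, hy, hr⟩ := Reached.exists_mem hx
    exact ⟨le_N_of_mem_highSet hx, ((odd_iff_of_reached h hr).2 rfl).1 hy⟩
  · rintro ⟨h1, h2⟩
    exact Reached.base x h2 h1

/-- Far out the level equals the height, so the whole column lies in `N > -c`. A cell reached there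
would allow a climb to row `n`. -/
theorem highSet_bounded (h : InX n l t c s) (hc : 2 ≤ c) :
    ∃ M : ℤ, ∀ u ∈ highSet n c s, -M < u.1 ∧ u.1 < M := by
  obtain ⟨M, hM⟩ := h.adm.lim
  have climb : ∀ x : ℤ, (M ≤ x ∨ x ≤ -M) → ∀ r : ℕ, (x, r) ∉ highSet n c s := by
    intro x hx r hr
    have hr' := highSet_lt h hr
    have hN : ∀ q ≤ n, s.N x q = q := fun q hq => by
      rcases hx with hx | hx
      · rw [N, ((hM q hq x).1 hx).1, ((hM q hq x).1 hx).2, sub_zero]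
      · rw [N, ((hM q hq x).2 hx).1, ((hM q hq x).2 hx).2, add_sub_cancel_right]
    have key : ∀ k : ℕ, r + k ≤ n → (x, r + k) ∈ highSet n c s := by
      intro k
      induction k with
      | zero => exact fun _ => hr
      | succ k ih =>
        intro hk
        refine (closedIn_reached n _ _).closed _ (ih (by omega)) _ ?_ hk (cellAdj_up _ _)
        change -c + 1 ≤ s.N x (r + (k + 1))
        rw [hN _ hk]
        omega
    have := highSet_lt h (key (n - r) (by simp at hr'; omega))
    simp only at this hr'
    omega
  refine ⟨M, fun u hu => ⟨?_, ?_⟩⟩ <;> by_contra hcon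
  · exact climb u.1 (Or.inr (by omega)) u.2 hu
  · exact climb u.1 (Or.inl (by omega)) u.2 hu

theorem admissible_flip_highSet (h : InX n l t c s) (hc : 2 ≤ c) :
    Admissible n l t (s.flip c (highSet n c s)) :=
  h.adm.flip (fun _ hu => highSet_lt h hu) (fun _ hu _ huv hv => highSet_adj h hu huv hv)
    (highSet_bounded h hc)

theorem flip_N_eq_neg_iff (hF : ∀ u ∈ F, s.N u.1 u.2 ≠ -c) (x : ℤ) (r : ℕ) :
    (s.flip c F).N x r = -c ↔ s.N x r = -c := by
  by_cases h : (x, r) ∈ F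
  · have h1 := hF _ h
    simp only at h1
    rw [flip_N_mem h]
    omega
  · rw [flip_N_notMem h]

/-- After the flip, the region is below `-c` while its outer neighbours still have level `-c`, so
reachability cannot leave it. On row `0` nothing else is below `-c`. -/
theorem lowSet_flip_highSet (h : InX n l t c s) :
    lowSet n c (s.flip c (highSet n c s)) = highSet n c s := by
  ext v
  constructor
  · intro hv
    induction hv with
    | base x _ hT =>
      by_contra hx
      change (s.flip c (highSet n c s)).N x 0 ≤ -c - 1 at hT
      rw [flip_N_notMem hx] at hT
      have := h.ge x
      omega
    | step u v _ hv _ huv ih =>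
      by_contra hx
      change (s.flip c (highSet n c s)).N v.1 v.2 ≤ -c - 1 at hv
      rw [flip_N_notMem hx, highSet_adj h ih huv hx] at hv
      omega
  · intro hv
    induction hv with
    | base x hx hT =>
      refine Reached.base x trivial ?_
      change (s.flip c (highSet n c s)).N x 0 ≤ -c - 1
      rw [flip_N_mem (show (x, 0) ∈ highSet n c s from Reached.base x hx hT)]
      change -c + 1 ≤ s.N x 0 at hT
      omega
    | step u v hu hv hn huv ih =>
      refine Reached.step u v ih ?_ hn huv
      change (s.flip c (highSet n c s)).N v.1 v.2 ≤ -c - 1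
      rw [flip_N_mem (show v ∈ highSet n c s from Reached.step u v hu hv hn huv)]
      change -c + 1 ≤ s.N v.1 v.2 at hv
      omega

theorem countAbove_flip (hF : ∀ u ∈ F, s.N u.1 u.2 ≠ -c) (x : ℤ) :
    countAbove (fun y => (s.flip c F).N y 0 = -c) x = countAbove (fun y => s.N y 0 = -c) x :=
  countAbove_congr (fun y => flip_N_eq_neg_iff hF y 0) x

/-- The cells of level `-c` are the fixed points of the reflection, so the counts to the right
survive the flip; by `lt_iff_odd` they single out the cells of row `0` that have been flipped. -/
theorem highSet_flip_lowSet (hc : 2 ≤ c) (hce : Even c) (h : InX n l t (2 * c) s) :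
    highSet n c (s.flip c (lowSet n c s)) = lowSet n c s := by
  have hne : ∀ u ∈ lowSet n c s, s.N u.1 u.2 ≠ -c := fun u hu he => by
    have := N_le_of_mem_lowSet hu
    omega
  ext v
  constructor
  · intro hv
    induction hv with
    | base x hx hT =>
      change -c + 1 ≤ (s.flip c (lowSet n c s)).N x 0 at hT
      rw [Set.mem_ofPred_eq, countAbove_flip hne] at hx
      rw [mem_lowSet_zero]
      refine (lt_iff_odd hc hce h x fun he => ?_).2 hx
      rw [(flip_N_eq_neg_iff hne x 0).2 he] at hT
      omega
    | step u v _ hv _ huv ih =>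
      by_contra hx
      change -c + 1 ≤ (s.flip c (lowSet n c s)).N v.1 v.2 at hv
      rw [flip_N_notMem hx, lowSet_adj h.adm hc ih huv hx] at hv
      omega
  · intro hv
    induction hv with
    | base x hx hT =>
      have hx0 : (x, 0) ∈ lowSet n c s := Reached.base x hx hT
      have hx' := mem_lowSet_zero.1 hx0
      refine Reached.base x ?_ ?_
      · rw [Set.mem_ofPred_eq, countAbove_flip hne]
        exact (lt_iff_odd hc hce h x (by omega)).1 hx'
      · change -c + 1 ≤ (s.flip c (lowSet n c s)).N x 0
        rw [flip_N_mem hx0]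
        omega
    | step u v hu hv hn huv ih =>
      refine Reached.step u v ih ?_ hn huv
      change -c + 1 ≤ (s.flip c (lowSet n c s)).N v.1 v.2
      rw [flip_N_mem (show v ∈ lowSet n c s from Reached.step u v hu hv hn huv)]
      change s.N v.1 v.2 ≤ -c - 1 at hv
      omega

open scoped Classical in
-- Summation by parts modulo `2`: with `v` the indicator of `V`, one has `contacts x + v (x + 1) = v
-- x * e x + v (x + 1) * e (x + 1)`. Summed over `x`, the right side is twice the same sum, so the
-- size of `V` has the parity of the number of contacts. Equivalently, an interval of `V` has odd
-- length iff exactly one of its two ends touches `F`.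
theorem even_ncard_of_contacts {N e : ℤ → ℤ} {V F : Set ℤ} (hV : V.Finite)
    (hN : ∀ x ∈ V, N x = -c) (hF : ∀ x ∈ F, N x ≠ -c)
    (hcl : ∀ x, N x = -c → N (x + 1) = -c → (x ∈ V ↔ x + 1 ∈ V))
    (he : ∀ x, N (x + 1) = -c → e x = e (x + 1) + 1)
    (he' : ∀ x, N (x + 1) ≠ -c → e x = e (x + 1))
    (ho : ∀ x, N x ≠ -c → (x ∈ F ↔ Odd (e x)))
    (h0 : ∑ᶠ x : ℤ, ((if x ∈ V then 1 else 0) * (if x + 1 ∈ F then 1 else 0) +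
      (if x ∈ F then 1 else 0) * (if x + 1 ∈ V then 1 else 0) : ZMod 2) = 0) :
    Even V.ncard := by
  have hV' : ((fun x : ℤ => x + 1) ⁻¹' V).Finite := hV.preimage (add_left_injective 1).injOn
  set v : ℤ → ZMod 2 := fun x => if x ∈ V then 1 else 0 with hv
  have hfv : (Function.support v).Finite := hV.subset fun x hx => by
    by_contra h'
    exact hx (by simp [hv, h'])
  have hfv' : (Function.support fun x => v (x + 1)).Finite :=
    hV'.subset fun x hx => by
      by_contra h'
      exact hx (by simp only [hv]; exact if_neg h')
  have hfg : (Function.support fun x => v x * (e x : ZMod 2)).Finite :=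
    hfv.subset (Function.support_mul_subset_left _ _)
  have hfg' : (Function.support fun x => v (x + 1) * (e (x + 1) : ZMod 2)).Finite :=
    hfv'.subset (Function.support_mul_subset_left _ _)
  have hfh : (Function.support fun x : ℤ => ((if x ∈ V then 1 else 0) *
      (if x + 1 ∈ F then 1 else 0) +
      (if x ∈ F then 1 else 0) * (if x + 1 ∈ V then 1 else 0) : ZMod 2)).Finite := by
    refine (hV.union hV').subset fun x hx => ?_
    by_contra h'
    simp only [Set.mem_union, not_or, Set.mem_preimage] at h'
    exact hx (by simp [h'.1, h'.2])
  have key : ∀ x : ℤ, ((if x ∈ V then 1 else 0) * (if x + 1 ∈ F then 1 else 0) +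
      (if x ∈ F then 1 else 0) * (if x + 1 ∈ V then 1 else 0) : ZMod 2) + v (x + 1) =
      v x * (e x : ZMod 2) + v (x + 1) * (e (x + 1) : ZMod 2) := by
    have two : ∀ z : ZMod 2, z + z = 0 := by decide
    have hFe : ∀ x, N x ≠ -c → (if x ∈ F then 1 else 0 : ZMod 2) = (e x : ZMod 2) := by
      intro x hx
      by_cases hxF : x ∈ F
      · rw [if_pos hxF, eq_comm, ZMod.intCast_eq_one_iff_odd]
        exact (ho x hx).1 hxF
      · rw [if_neg hxF, eq_comm, ZMod.intCast_eq_zero_iff_even, ← Int.not_odd_iff_even]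
        exact mt (ho x hx).2 hxF
    intro x
    by_cases h1 : N x = -c <;> by_cases h2 : N (x + 1) = -c
    · have f1 : x ∉ F := fun h => hF x h h1
      have f2 : x + 1 ∉ F := fun h => hF _ h h2
      have hvv : v x = v (x + 1) := by simp only [hv, hcl x h1 h2]
      rw [if_neg f1, if_neg f2, hvv, he x h2]
      push_cast
      linear_combination (-1 : ZMod 2) * two (v (x + 1) * (e (x + 1)))
    · have v2 : x + 1 ∉ V := fun h => h2 (hN _ h)
      have hv2 : v (x + 1) = 0 := if_neg v2
      rw [hFe _ h2, if_neg v2, hv2, he' x h2]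
      ring
    · have v1 : x ∉ V := fun h => h1 (hN _ h)
      have hv1 : v x = 0 := if_neg v1
      rw [hFe _ h1, if_neg v1, hv1, he x h2]
      push_cast
      change _ + ((e (x + 1) : ZMod 2) + 1) * v (x + 1) + v (x + 1) = _
      linear_combination two (v (x + 1))
    · have v1 : x ∉ V := fun h => h1 (hN _ h)
      have v2 : x + 1 ∉ V := fun h => h2 (hN _ h)
      have hv1 : v x = 0 := if_neg v1
      have hv2 : v (x + 1) = 0 := if_neg v2
      rw [if_neg v1, if_neg v2, hv1, hv2]
      ring
  have hshift : ∀ f : ℤ → ZMod 2, ∑ᶠ x : ℤ, f (x + 1) = ∑ᶠ x, f x := fun f =>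
    finsum_comp_equiv (Equiv.addRight (1 : ℤ))
  have hsum := finsum_congr key
  rw [finsum_add_distrib hfh hfv', finsum_add_distrib hfg hfg', h0, zero_add,
    hshift v, hshift fun x => v x * (e x : ZMod 2),
    CharTwo.add_self_eq_zero, finsum_indicator_eq hV, ZMod.natCast_eq_zero_iff_even] at hsum
  exact hsum

/-- A closed set at level `-c` avoids the flipped region and meets row `0` in cells of level exactly
`-c`; the contact count applies to it. A closed set in `N ≥ 0` splits into its flipped part,
formerly in `N ≤ -2c`, and its untouched part; both are even by the conditions for `2c`. -/
theorem inX_flip_lowSet (hc : 2 ≤ c) (hce : Even c) (h : InX n l t (2 * c) s) :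
    InX n l t c (s.flip c (lowSet n c s)) := by
  set F := lowSet n c s with hFdef
  have hne : ∀ u ∈ F, s.N u.1 u.2 ≠ -c := fun u hu he => by
    have := N_le_of_mem_lowSet hu
    omega
  have hFN : ∀ u ∈ F, s.N u.1 u.2 ≤ -c - 1 ∧ (s.flip c F).N u.1 u.2 = -2 * c - s.N u.1 u.2 :=
    fun u hu => ⟨N_le_of_mem_lowSet hu, flip_N_mem hu⟩
  have hFN' : ∀ u, u ∉ F → (s.flip c F).N u.1 u.2 = s.N u.1 u.2 := fun u hu => flip_N_notMem hu
  have hbot : ∀ x, (x, 0) ∈ F ↔ s.N x 0 < -c := fun x => mem_lowSet_zero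
  have hge : ∀ x, -c ≤ (s.flip c F).N x 0 ∧ (s.flip c F).N x 0 ≤ 0 := by
    intro x
    have h1 := h.le x
    have h2 := h.ge x
    by_cases hx : (x, 0) ∈ F
    · have := hFN _ hx
      simp only at this
      omega
    · have h3 := hFN' _ hx
      have h4 := mt (hbot x).2 hx
      simp only at h3
      omega
  obtain ⟨M, hM⟩ := h.adm.exists_bound
  refine ⟨admissible_flip_lowSet h.adm hc, fun x => (hge x).2, fun x => (hge x).1, ?_, ?_, ?_⟩
  · refine (rule_iff (N := fun x => s.N x 0) (N' := fun x => (s.flip c F).N x 0)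
      (F := {x | (x, 0) ∈ F}) hce hc hM ?_ ?_ ?_).1 h.rule
    · intro x hx
      exact ⟨(hbot x).1 hx, h.ge x, (hFN _ hx).2⟩
    · intro x hx
      have := mt (hbot x).2 hx
      exact ⟨by omega, h.le x, hFN' _ hx⟩
    · intro x hx
      rw [← lt_iff_odd hc hce h x hx]
      exact hbot x
  · intro V hV
    have hd : ∀ u ∈ V, u ∉ F := by
      intro u hu hF
      have h1 := hFN u hF
      have h2 : (s.flip c F).N u.1 u.2 ≤ -c := hV.mem u hu
      omega
    -- A common neighbour of a cell of `V` and a cell of `F` lies in `F` or has level `-c`, and in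
    -- the latter case it belongs to `V` by closedness.
    have hcontact := finsum_joins_eq_zero (n := n) hd (fun u hu => lowSet_lt h.adm hc hu)
      (lowSet_bounded h.adm hc) (fun a ha b hb d hd had hbd => by
        intro h3
        by_cases hdF : d ∈ F
        · exact Or.inr hdF
        · refine Or.inl (hV.closed a ha d ?_ hd hbd)
          change (s.flip c F).N d.1 d.2 ≤ -c
          rw [hFN' d hdF, lowSet_adj h.adm hc hb h3 hdF])
    have hVN : ∀ x, (x, 0) ∈ V → s.N x 0 = -c := by
      intro x hx
      have h1 := hFN' _ (hd _ hx)
      have h2 : (s.flip c F).N x 0 ≤ -c := hV.mem _ hx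
      have h3 := (hge x).1
      simp only at h1
      omega
    have hMc : ∀ y, M ≤ y → ¬ s.N y 0 = -c := fun y hy h' => by rw [hM y hy] at h'; omega
    refine even_ncard_of_contacts (c := c) (N := fun x => s.N x 0)
      (e := fun x => (countAbove (fun y => s.N y 0 = -c) x : ℤ))
      (V := {x | (x, 0) ∈ V}) (F := {x | (x, 0) ∈ F}) ?_ hVN (fun x hx => hne _ hx) ?_ ?_ ?_ ?_
      hcontact
    · obtain ⟨M', hM'⟩ := h.adm.bounded_of_neg
      refine (Set.finite_Ioo (-M') M').subset fun x hx => hM' 0 (Nat.zero_le _) x ?_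
      rw [hVN x hx]
      omega
    · intro x h1 h2
      have mem : ∀ y, s.N y 0 = -c → (y, 0) ∈ (s.flip c F).sub (-c) := fun y hy =>
        ((flip_N_eq_neg_iff hne y 0).2 hy).le
      exact ⟨fun hx => hV.closed _ hx _ (mem _ h2) (Nat.zero_le _) (by simp [CellAdj]),
        fun hx => hV.closed _ hx _ (mem _ h1) (Nat.zero_le _) (by simp [CellAdj])⟩
    · intro x hx
      simp only [countAbove_of_mem hMc hx]
      push_cast
      ring
    · intro x hx
      simp only [countAbove_of_not (Q := fun y => s.N y 0 = -c) hx]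
    · intro x hx
      rw [Int.odd_coe_nat, ← lt_iff_odd hc hce h x hx]
      exact hbot x
  · intro V hV hVn
    have h1 : Even {x : ℤ | (x, 0) ∈ V ∩ F}.ncard := by
      refine h.evenLow _ ⟨?_, fun u hu => hV.le u hu.1, ?_⟩
      · rintro u ⟨hu, huF⟩
        have h1 : 0 ≤ (s.flip c F).N u.1 u.2 := hV.mem u hu
        have h2 := hFN u huF
        change s.N u.1 u.2 ≤ -(2 * c)
        omega
      · rintro u ⟨hu, huF⟩ v hv hvn huv
        change s.N v.1 v.2 ≤ -(2 * c) at hv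
        have hvF : v ∈ F := by
          by_contra hvF
          have := lowSet_adj h.adm hc huF huv hvF
          omega
        refine ⟨hV.closed u hu v ?_ hvn huv, hvF⟩
        change 0 ≤ (s.flip c F).N v.1 v.2
        have := hFN v hvF
        omega
    have h2 : Even {x : ℤ | (x, 0) ∈ V \ F}.ncard := by
      refine h.evenHigh _ ⟨?_, fun u hu => hV.le u hu.1, ?_⟩ fun u hu => hVn u hu.1
      · rintro u ⟨hu, huF⟩
        have h1 : 0 ≤ (s.flip c F).N u.1 u.2 := hV.mem u hu
        rw [hFN' u huF] at h1
        exact h1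
      · rintro u ⟨hu, huF⟩ v hv hvn huv
        change 0 ≤ s.N v.1 v.2 at hv
        have hvF : v ∉ F := fun hvF => by
          have := hFN v hvF
          omega
        refine ⟨hV.closed u hu v ?_ hvn huv, hvF⟩
        change 0 ≤ (s.flip c F).N v.1 v.2
        rwa [hFN' v hvF]
    -- If row `0` of `V` is infinite, its `ncard` is `0` by convention, hence even.
    by_cases hfin : {x : ℤ | (x, 0) ∈ V}.Finite
    · have : {x : ℤ | (x, 0) ∈ V} = {x : ℤ | (x, 0) ∈ V ∩ F} ∪ {x : ℤ | (x, 0) ∈ V \ F} := by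
        ext x
        simp only [Set.mem_ofPred_eq, Set.mem_union, Set.mem_inter_iff, Set.mem_sdiff]
        tauto
      rw [this, Set.ncard_union_eq _ (hfin.subset fun x hx => hx.1)
        (hfin.subset fun x hx => hx.1)]
      · exact h1.add h2
      · rw [Set.disjoint_left]
        exact fun x hx hx' => hx'.2 hx.2
    · rw [Set.Infinite.ncard hfin]
      exact Even.zero

/-- A closed set in `N ≤ -2c` meets row `0` only inside the flipped region, where it was formerly in
`N ≥ 0` and away from row `n`. A closed set in `N ≥ 0` after the flip avoids the region and is not
adjacent to it, so nothing has changed for it. -/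
theorem inX_flip_highSet (hc : 2 ≤ c) (hce : Even c) (h : InX n l t c s) :
    InX n l t (2 * c) (s.flip c (highSet n c s)) := by
  set F := highSet n c s with hFdef
  have hne : ∀ u ∈ F, s.N u.1 u.2 ≠ -c := fun u hu he => by
    have := le_N_of_mem_highSet hu
    omega
  have hFN : ∀ u ∈ F, -c + 1 ≤ s.N u.1 u.2 ∧ (s.flip c F).N u.1 u.2 = -2 * c - s.N u.1 u.2 :=
    fun u hu => ⟨le_N_of_mem_highSet hu, flip_N_mem hu⟩
  have hFN' : ∀ u, u ∉ F → (s.flip c F).N u.1 u.2 = s.N u.1 u.2 := fun u hu => flip_N_notMem hu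
  have hge : ∀ x, -(2 * c) ≤ (s.flip c F).N x 0 ∧ (s.flip c F).N x 0 ≤ 0 := by
    intro x
    have h1 := h.le x
    have h2 := h.ge x
    by_cases hx : (x, 0) ∈ F
    · have := hFN _ hx
      simp only at this
      omega
    · have h3 := hFN' _ hx
      simp only at h3
      omega
  obtain ⟨M, hM⟩ := (admissible_flip_highSet h hc).exists_bound
  refine ⟨admissible_flip_highSet h hc, fun x => (hge x).2, fun x => (hge x).1, ?_, ?_, ?_⟩
  · refine (rule_iff (N := fun x => (s.flip c F).N x 0) (N' := fun x => s.N x 0)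
      (F := {x | (x, 0) ∈ F}) hce hc hM ?_ ?_ ?_).2 h.rule
    · intro x hx
      have h1 := hFN _ hx
      have h2 := (hge x).1
      simp only at h1
      omega
    · intro x hx
      have h1 := hFN' _ hx
      have h2 := h.ge x
      have h3 := h.le x
      simp only at h1
      omega
    · intro x hx
      rw [countAbove_flip hne]
      rw [ne_eq, flip_N_eq_neg_iff hne] at hx
      have h1 := h.ge x
      rw [Set.mem_ofPred_eq, mem_highSet_zero h, and_iff_right (by omega)]
  · intro V hV
    have h1 : Even {x : ℤ | (x, 0) ∈ V ∩ F}.ncard := by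
      refine h.evenHigh _ ⟨?_, fun u hu => hV.le u hu.1, ?_⟩
        fun u hu => (highSet_lt h hu.2).ne
      · rintro u ⟨hu, huF⟩
        have h1 : (s.flip c F).N u.1 u.2 ≤ -(2 * c) := hV.mem u hu
        have h2 := hFN u huF
        change 0 ≤ s.N u.1 u.2
        omega
      · rintro u ⟨hu, huF⟩ v hv hvn huv
        change 0 ≤ s.N v.1 v.2 at hv
        have hvF : v ∈ F := by
          by_contra hvF
          have := highSet_adj h huF huv hvF
          omega
        refine ⟨hV.closed u hu v ?_ hvn huv, hvF⟩
        change (s.flip c F).N v.1 v.2 ≤ -(2 * c)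
        have := hFN v hvF
        omega
    convert h1 using 3
    ext x
    simp only [Set.mem_inter_iff]
    refine ⟨fun hx => ⟨hx, ?_⟩, fun hx => hx.1⟩
    by_contra hxF
    have h1 : (s.flip c F).N x 0 ≤ -(2 * c) := hV.mem _ hx
    have h2 := hFN' _ hxF
    have h3 := h.ge x
    simp only at h2
    omega
  · intro V hV hVn
    have hd : ∀ u ∈ V, u ∉ F := by
      intro u hu huF
      have h1 : 0 ≤ (s.flip c F).N u.1 u.2 := hV.mem u hu
      have h2 := hFN u huF
      omega
    refine h.evenHigh V ⟨?_, hV.le, ?_⟩ hVn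
    · intro u hu
      have h1 : 0 ≤ (s.flip c F).N u.1 u.2 := hV.mem u hu
      rw [hFN' u (hd u hu)] at h1
      exact h1
    · intro u hu v hv hvn huv
      have h1 : 0 ≤ (s.flip c F).N u.1 u.2 := hV.mem u hu
      rw [hFN' u (hd u hu)] at h1
      have hvF : v ∉ F := fun hvF => by
        have := highSet_adj h hvF huv.symm (hd u hu)
        omega
      refine hV.closed u hu v ?_ hvn huv
      change 0 ≤ (s.flip c F).N v.1 v.2
      rw [hFN' v hvF]
      exact hv

/-- The conditions for `2c` and `c` are equivalent up to the flips at level `-c`. -/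
noncomputable def equivFlip (hc : 2 ≤ c) (hce : Even c) :
    {s // InX n l t (2 * c) s} ≃ {s // InX n l t c s} where
  toFun s := ⟨s.1.flip c (lowSet n c s.1), inX_flip_lowSet hc hce s.2⟩
  invFun s := ⟨s.1.flip c (highSet n c s.1), inX_flip_highSet hc hce s.2⟩
  left_inv s := Subtype.ext <| by
    change (s.1.flip c (lowSet n c s.1)).flip c (highSet n c (s.1.flip c (lowSet n c s.1))) = s.1
    rw [highSet_flip_lowSet hc hce s.2, flip_flip]
  right_inv s := Subtype.ext <| by
    change (s.1.flip c (highSet n c s.1)).flip c (lowSet n c (s.1.flip c (highSet n c s.1))) = s.1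
    rw [lowSet_flip_highSet s.2, flip_flip]

theorem exists_equiv_inX (n l : ℕ) (t : Heights) (j : ℕ) :
    ∃ φ : {s // InX n l t 2 s} ≃ {s // InX n l t (2 ^ (j + 1)) s},
      ∀ s, (φ s).1.total = s.1.total := by
  induction j with
  | zero => exact ⟨Equiv.refl _, fun _ => rfl⟩
  | succ j ih =>
    obtain ⟨φ, hφ⟩ := ih
    have e : (2 : ℤ) ^ (j + 1 + 1) = 2 * 2 ^ (j + 1) := by ring
    rw [e]
    have hc : (2 : ℤ) ≤ 2 ^ (j + 1) := by
      rw [pow_succ]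
      have : (1 : ℤ) ≤ 2 ^ j := one_le_pow₀ (by norm_num)
      omega
    have hce : Even ((2 : ℤ) ^ (j + 1)) := by
      rw [pow_succ]
      exact even_two.mul_left _
    -- Going up in the chain uses the inverse direction, the flip of the high region at level `-c`.
    refine ⟨φ.trans (equivFlip hc hce).symm, fun s => ?_⟩
    rw [← hφ s]
    exact flip_total

end Heights

/-! ### Strictly decreasing sequences and their counting functions -/

/-- `f x` is the number of members greater than `x` of the decreasing sequence `d`. -/
structure IsCount {l : ℕ} (d : Fin l → ℤ) (f : ℤ → ℤ) : Prop where
  nonneg : ∀ x, 0 ≤ f x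
  le : ∀ x, f x ≤ l
  lt_iff : ∀ j x, x < d j ↔ ((j : ℕ) : ℤ) < f x

/-- The number of members greater than `x`. -/
def cnt {l : ℕ} (d : Fin l → ℤ) (x : ℤ) : ℤ := ((Finset.univ.filter fun j => x < d j).card : ℤ)

theorem card_fin_lt (l k : ℕ) (hk : k ≤ l) :
    (Finset.univ.filter fun j : Fin l => (j : ℕ) < k).card = k := by
  rw [Fin.card_filter_val_lt, min_eq_right hk]

theorem isCount_cnt {l : ℕ} {d : Fin l → ℤ} (hd : StrictAnti d) : IsCount d (cnt d) where
  nonneg x := by unfold cnt; positivity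
  le x := by
    unfold cnt
    have := Finset.card_le_univ (Finset.univ.filter fun j => x < d j)
    rw [Fintype.card_fin] at this
    exact_mod_cast this
  lt_iff j x := by
    unfold cnt
    rw [Nat.cast_lt]
    constructor
    · intro h
      have h1 : (Finset.univ.filter fun i : Fin l => (i : ℕ) < (j : ℕ) + 1) ⊆
          Finset.univ.filter fun i => x < d i := by
        intro i hi
        simp only [Finset.mem_filter, Finset.mem_univ, true_and] at hi ⊢
        exact lt_of_lt_of_le h (hd.antitone (by rw [Fin.le_def]; omega))
      have h2 := Finset.card_le_card h1
      rw [card_fin_lt l _ j.2] at h2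
      omega
    · intro h
      by_contra hx
      have h1 : (Finset.univ.filter fun i => x < d i) ⊆
          Finset.univ.filter fun i : Fin l => (i : ℕ) < (j : ℕ) := by
        intro i hi
        simp only [Finset.mem_filter, Finset.mem_univ, true_and] at hi ⊢
        by_contra hij
        exact hx (lt_of_lt_of_le hi (hd.antitone (by rw [Fin.le_def]; omega)))
      have h2 := Finset.card_le_card h1
      rw [card_fin_lt l _ j.2.le] at h2
      omega

namespace IsCount

variable {l : ℕ} {d d' : Fin l → ℤ} {f g : ℤ → ℤ}

theorem fun_le (h : IsCount d f) (h' : IsCount d g) (x : ℤ) : f x ≤ g x := by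
  by_contra hlt
  have h1 := h.le x
  have h2 := h'.nonneg x
  have h3 := h.lt_iff ⟨(g x).toNat, by omega⟩ x
  have h4 := h'.lt_iff ⟨(g x).toNat, by omega⟩ x
  simp only at h3 h4
  omega

theorem fun_eq (h : IsCount d f) (h' : IsCount d g) : f = g :=
  funext fun x => le_antisymm (fun_le h h' x) (fun_le h' h x)

theorem seq_eq (h : IsCount d f) (h' : IsCount d' f) : d = d' := by
  funext j
  refine le_antisymm ?_ ?_ <;> by_contra hlt
  · have h1 := (h.lt_iff j (d' j)).1 (by omega)
    have h2 := (h'.lt_iff j (d' j)).2 h1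
    omega
  · have h1 := (h'.lt_iff j (d j)).1 (by omega)
    have h2 := (h.lt_iff j (d j)).2 h1
    omega

theorem anti (h : IsCount d f) (x : ℤ) : f x ≤ f (x - 1) := by
  by_contra hlt
  have h1 := h.le x
  have h2 := h.nonneg (x - 1)
  have h3 := h.lt_iff ⟨(f (x - 1)).toNat, by omega⟩ x
  have h4 := h.lt_iff ⟨(f (x - 1)).toNat, by omega⟩ (x - 1)
  simp only at h3 h4
  omega

theorem strictAnti (h : IsCount d f) (hf : ∀ x, f (x - 1) ≤ f x + 1) : StrictAnti d := by
  intro i j hij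
  have h1 := h.lt_iff i (d i)
  have h2 := hf (d i)
  have h3 := h.lt_iff j (d i - 1)
  rw [Fin.lt_def] at hij
  omega

theorem sub_one_le (h : IsCount d f) (hd : StrictAnti d) (x : ℤ) : f (x - 1) ≤ f x + 1 := by
  by_contra hlt
  have h1 := h.le (x - 1)
  have h2 := h.nonneg x
  have h3 := h.lt_iff ⟨(f x).toNat, by omega⟩ x
  have h4 := h.lt_iff ⟨(f x).toNat + 1, by omega⟩ (x - 1)
  have h5 := hd (a := ⟨(f x).toNat, by omega⟩) (b := ⟨(f x).toNat + 1, by omega⟩)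
    (by rw [Fin.lt_def]; simp)
  simp only at h3 h4
  push_cast at h4
  omega

/-- The member with index `j` is one more than the last position at which the function exceeds `j`;
the two limits make this position exist. -/
theorem exists_of (hf : ∀ x, f x ≤ f (x - 1)) {M : ℤ} (hr : ∀ x, M ≤ x → f x = 0)
    (hl : ∀ x, x ≤ -M → f x = l) : ∃ d : Fin l → ℤ, IsCount d f := by
  have hanti : Antitone f := antitone_int_of_succ_le fun x => by
    have := hf (x + 1); rwa [add_sub_cancel_right] at this
  have hb0 : ∀ x, 0 ≤ f x := fun x => by
    have := hanti (le_max_left x M); rwa [hr _ (le_max_right x M)] at this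
  have hbl : ∀ x, f x ≤ l := fun x => by
    have := hanti (min_le_left x (-M)); rwa [hl _ (min_le_right x (-M))] at this
  have key : ∀ j : Fin l, ∃ y : ℤ, ∀ x, x < y ↔ ((j : ℕ) : ℤ) < f x := by
    intro j
    obtain ⟨y, hy, hmax⟩ := Int.exists_greatest_of_bdd (P := fun x => ((j : ℕ) : ℤ) < f x)
      ⟨M, fun z hz => by
        by_contra hzM
        have := hr z (by omega)
        omega⟩ ⟨-M, by rw [hl _ le_rfl]; exact_mod_cast j.2⟩
    refine ⟨y + 1, fun x => ⟨fun hx => lt_of_lt_of_le hy (hanti (by omega)), fun hx => ?_⟩⟩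
    have := hmax x hx
    omega
  choose d hd using key
  exact ⟨d, hb0, hbl, hd⟩

end IsCount

/-! ### Interlacing patterns -/

/-- The inequalities between the positions of nonintersecting lower and upper paths. -/
structure IsPattern {l : ℕ} (c : PathPair l) : Prop where
  lower_le : ∀ i r, c.lower i (r + 1) ≤ c.lower i r
  lower_lt : ∀ i j, i < j → ∀ r, c.lower j r < c.lower i (r + 1)
  upper_le : ∀ i r, c.upper i r ≤ c.upper i (r + 1)
  upper_lt : ∀ i j, i < j → ∀ r, c.upper j (r + 1) < c.upper i r

/-- The counting functions of a pair of tuples of lower and upper paths. -/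
def PathPair.heights {l : ℕ} (c : PathPair l) : Heights where
  A x r := r + cnt (fun j => c.lower j r - 1 - r) x
  B x r := cnt (fun j => c.upper j r) x

namespace IsPattern

variable {l : ℕ} {c : PathPair l}

theorem lower_anti (h : IsPattern c) (r : ℕ) : StrictAnti fun j => c.lower j r - 1 - (r : ℤ) := by
  intro i j hij
  have h1 := h.lower_le i r
  have h2 := h.lower_lt i j hij r
  simp only
  omega

theorem upper_anti (h : IsPattern c) (r : ℕ) : StrictAnti fun j => c.upper j r := by
  intro i j hij
  have h1 := h.upper_le j r
  have h2 := h.upper_lt i j hij r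
  simp only
  omega

theorem isCount_lower (h : IsPattern c) (r : ℕ) :
    IsCount (fun j => c.lower j r - 1 - (r : ℤ)) fun x => c.heights.A x r - r := by
  have := isCount_cnt (h.lower_anti r)
  simpa only [PathPair.heights, add_sub_cancel_left] using this

theorem isCount_upper (h : IsPattern c) (r : ℕ) :
    IsCount (fun j => c.upper j r) fun x => c.heights.B x r :=
  isCount_cnt (h.upper_anti r)

/-- The horizontal rules say that the positions are distinct. Of the vertical ones, `up_ge` is the
interlacing of consecutive paths and `up_le` the monotonicity of a single path; the shift by `-1 -
r` and the summand `r` in `A` are what makes these rules agree with those for `B`. -/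
theorem profile_lower (h : IsPattern c) : IsProfile c.heights.A where
  left_ge x r := by
    have := (h.isCount_lower r).anti x
    omega
  left_le x r := by
    have := (h.isCount_lower r).sub_one_le (h.lower_anti r) x
    omega
  up_ge x r := by
    by_contra hlt
    have h0 := h.isCount_lower r
    have h1 := h.isCount_lower (r + 1)
    have a1 := h0.le x
    have a2 := h1.nonneg x
    push_cast at a2
    set k := (c.heights.A x (r + 1) - (r + 1)).toNat
    have h2 := h1.lt_iff ⟨k, by omega⟩ x
    have h3 := h0.lt_iff ⟨k + 1, by omega⟩ x
    have h4 := h.lower_lt ⟨k, by omega⟩ ⟨k + 1, by omega⟩ (by rw [Fin.lt_def]; simp) r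
    push_cast at h2 h3
    omega
  up_le x r := by
    by_contra hlt
    have h0 := h.isCount_lower r
    have h1 := h.isCount_lower (r + 1)
    have a1 := h1.le (x - 1)
    have a2 := h0.nonneg x
    push_cast at a1
    set k := (c.heights.A x r - r).toNat
    have h2 := h0.lt_iff ⟨k, by omega⟩ x
    have h3 := h1.lt_iff ⟨k, by omega⟩ (x - 1)
    have h4 := h.lower_le ⟨k, by omega⟩ r
    push_cast at h2 h3
    omega

/-- Compared with the lower paths the roles are interchanged: monotonicity gives `up_ge` and
interlacing gives `up_le`. -/
theorem profile_upper (h : IsPattern c) : IsProfile c.heights.B where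
  left_ge x r := (h.isCount_upper r).anti x
  left_le x r := (h.isCount_upper r).sub_one_le (h.upper_anti r) x
  up_ge x r := by
    by_contra hlt
    have h0 := h.isCount_upper r
    have h1 := h.isCount_upper (r + 1)
    have a1 := h0.le x
    have a2 := h1.nonneg x
    set k := (c.heights.B x (r + 1)).toNat
    have h2 := h1.lt_iff ⟨k, by omega⟩ x
    have h3 := h0.lt_iff ⟨k, by omega⟩ x
    have h4 := h.upper_le ⟨k, by omega⟩ r
    simp only at h2 h3
    omega
  up_le x r := by
    by_contra hlt
    have h0 := h.isCount_upper r
    have h1 := h.isCount_upper (r + 1)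
    have a1 := h1.le (x - 1)
    have a2 := h0.nonneg x
    set k := (c.heights.B x r).toNat
    have h2 := h0.lt_iff ⟨k, by omega⟩ x
    have h3 := h1.lt_iff ⟨k + 1, by omega⟩ (x - 1)
    have h4 := h.upper_lt ⟨k, by omega⟩ ⟨k + 1, by omega⟩ (by rw [Fin.lt_def]; simp) r
    push_cast at h2 h3
    omega

theorem of_profiles (hA : IsProfile c.heights.A) (hB : IsProfile c.heights.B)
    (ha : ∀ r, IsCount (fun j => c.lower j r - 1 - (r : ℤ)) fun x => c.heights.A x r - r)
    (hb : ∀ r, IsCount (fun j => c.upper j r) fun x => c.heights.B x r) : IsPattern c where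
  lower_le i r := by
    by_contra hlt
    have h1 := (ha (r + 1)).lt_iff i (c.lower i r - 1 - r - 1)
    have h2 := (ha r).lt_iff i (c.lower i r - 1 - r)
    have h3 := hA.up_le (c.lower i r - 1 - r) r
    push_cast at h1 h2
    omega
  lower_lt i j hij r := by
    by_contra hlt
    have h1 := (ha (r + 1)).lt_iff i (c.lower j r - 1 - r - 1)
    have h2 := (ha r).lt_iff j (c.lower j r - 1 - r - 1)
    have h3 := hA.up_ge (c.lower j r - 1 - r - 1) r
    rw [Fin.lt_def] at hij
    push_cast at h1 h2
    omega
  upper_le i r := by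
    by_contra hlt
    have h1 := (hb (r + 1)).lt_iff i (c.upper i (r + 1))
    have h2 := (hb r).lt_iff i (c.upper i (r + 1))
    have h3 := hB.up_ge (c.upper i (r + 1)) r
    omega
  upper_lt i j hij r := by
    by_contra hlt
    have h1 := (hb (r + 1)).lt_iff j (c.upper i r - 1)
    have h2 := (hb r).lt_iff i (c.upper i r)
    have h3 := hB.up_le (c.upper i r) r
    rw [Fin.lt_def] at hij
    omega

theorem ext_heights {c' : PathPair l} (h : IsPattern c) (h' : IsPattern c')
    (he : c.heights = c'.heights) : c = c' := by
  have h1 : c.lower = c'.lower := by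
    funext j r
    have := congrFun ((h.isCount_lower r).seq_eq (he ▸ h'.isCount_lower r)) j
    omega
  have h2 : c.upper = c'.upper := by
    funext j r
    exact congrFun ((h.isCount_upper r).seq_eq (he ▸ h'.isCount_upper r)) j
  cases c
  cases c'
  simp only at h1 h2
  rw [h1, h2]

end IsPattern

/-- The counting functions that belong to constant positions. -/
def topHeights {l : ℕ} (start finish : Fin l → ℤ) : Heights :=
  PathPair.heights ⟨fun j _ => start j, fun j _ => finish j⟩

theorem exists_pattern {n l : ℕ} {start finish : Fin l → ℤ} (hs : StrictAnti start)
    (hf : StrictAnti finish) {s : Heights}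
    (h : Heights.Admissible n l (topHeights start finish) s) :
    ∃ c : PathPair l, IsPattern c ∧ c.heights = s ∧ (∀ j r, n ≤ r → c.lower j r = start j) ∧
      ∀ j r, n ≤ r → c.upper j r = finish j := by
  obtain ⟨M, hM⟩ := h.lim
  have hA : ∀ r : ℕ, ∃ d : Fin l → ℤ, IsCount (fun j => d j - 1 - (r : ℤ)) (fun x => s.A x r - r) ∧
      (n ≤ r → d = start) := by
    intro r
    -- From row `n` upwards the positions are the prescribed end points. Below it they are recovered
    -- from the limits of the counting function.
    by_cases hr : n ≤ r
    · refine ⟨start, ?_, fun _ => rfl⟩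
      have : (fun x => s.A x r - (r : ℤ)) = cnt fun j => start j - 1 - (r : ℤ) := by
        funext x
        rw [(h.top x r hr).1]
        simp [topHeights, PathPair.heights]
      rw [this]
      exact isCount_cnt fun i j hij => by
        have := hs hij
        omega
    · obtain ⟨d, hd⟩ := IsCount.exists_of (l := l) (f := fun x => s.A x r - (r : ℤ)) (M := M)
        (fun x => by have := h.profA.left_ge x r; omega)
        (fun x hx => by have := ((hM r (by omega) x).1 hx).1; omega)
        (fun x hx => by have := ((hM r (by omega) x).2 hx).1; omega)
      refine ⟨fun j => d j + 1 + r, ?_, fun h => absurd h hr⟩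
      convert hd using 2
      ring
  have hB : ∀ r : ℕ, ∃ d : Fin l → ℤ, IsCount d (fun x => s.B x r) ∧ (n ≤ r → d = finish) := by
    intro r
    by_cases hr : n ≤ r
    · refine ⟨finish, ?_, fun _ => rfl⟩
      have : (fun x => s.B x r) = cnt finish := by
        funext x
        rw [(h.top x r hr).2]
        simp [topHeights, PathPair.heights]
      rw [this]
      exact isCount_cnt hf
    · obtain ⟨d, hd⟩ := IsCount.exists_of (l := l) (f := fun x => s.B x r) (M := M)
        (fun x => h.profB.left_ge x r)
        (fun x hx => ((hM r (by omega) x).1 hx).2)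
        (fun x hx => ((hM r (by omega) x).2 hx).2)
      exact ⟨d, hd, fun h => absurd h hr⟩
  choose a ha ha' using hA
  choose b hb hb' using hB
  have hsa : ∀ r : ℕ, StrictAnti fun j => a r j - 1 - (r : ℤ) := fun r =>
    (ha r).strictAnti fun x => by have := h.profA.left_le x r; omega
  have hsb : ∀ r, StrictAnti (b r) := fun r => (hb r).strictAnti fun x => h.profB.left_le x r
  have he : PathPair.heights ⟨fun j r => a r j, fun j r => b r j⟩ = s := by
    ext x r
    · have := congrFun ((isCount_cnt (hsa r)).fun_eq (ha r)) x
      simp only [PathPair.heights]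
      omega
    · exact congrFun ((isCount_cnt (hsb r)).fun_eq (hb r)) x
  refine ⟨⟨fun j r => a r j, fun j r => b r j⟩, ?_, he, ?_, ?_⟩
  · refine IsPattern.of_profiles ?_ ?_ ?_ ?_ <;> rw [he]
    · exact h.profA
    · exact h.profB
    · exact ha
    · exact hb
  · intro j r hr
    exact congrFun (ha' r hr) j
  · intro j r hr
    exact congrFun (hb' r hr) j

theorem IsPattern.admissible {n l : ℕ} {start finish : Fin l → ℤ} {c : PathPair l}
    (h : IsPattern c) (hs : ∀ j r, n ≤ r → c.lower j r = start j)
    (hf : ∀ j r, n ≤ r → c.upper j r = finish j)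
    (hpos : ∀ x, -1 ≤ (topHeights start finish).N x n) :
    Heights.Admissible n l (topHeights start finish) c.heights where
  profA := h.profile_lower
  profB := h.profile_upper
  top x r hr := by
    simp only [topHeights, PathPair.heights, fun j => hs j r hr, fun j => hf j r hr, and_self]
  pos x := by
    have := hpos x
    simpa only [Heights.N, topHeights, PathPair.heights, fun j => hs j n le_rfl,
      fun j => hf j n le_rfl] using this
  lim := by
    have hb : ∃ M : ℤ, ∀ j : Fin l, ∀ r ∈ Finset.range (n + 1),
        |c.lower j r| ≤ M ∧ |c.upper j r| ≤ M := by
      refine ⟨∑ j : Fin l, ∑ r ∈ Finset.range (n + 1), (|c.lower j r| + |c.upper j r|),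
        fun j r hr => ?_⟩
      have h1 := Finset.single_le_sum (f := fun r => |c.lower j r| + |c.upper j r|)
        (fun _ _ => by positivity) hr
      have h2 := Finset.single_le_sum (s := Finset.univ)
        (f := fun j : Fin l => ∑ r ∈ Finset.range (n + 1), (|c.lower j r| + |c.upper j r|))
        (fun _ _ => Finset.sum_nonneg fun _ _ => by positivity) (Finset.mem_univ j)
      have := abs_nonneg (c.lower j r)
      have := abs_nonneg (c.upper j r)
      constructor <;> linarith
    obtain ⟨M, hM⟩ := hb
    have full : ∀ (d : Fin l → ℤ) (f : ℤ → ℤ) (x : ℤ), IsCount d f → (∀ j, x < d j) → f x = l := by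
      intro d f x hdf hx
      refine le_antisymm (hdf.le x) ?_
      by_contra hlt
      have h0 := hdf.nonneg x
      have h1 := (hdf.lt_iff ⟨(f x).toNat, by omega⟩ x).1 (hx _)
      simp only at h1
      omega
    have zero : ∀ (d : Fin l → ℤ) (f : ℤ → ℤ) (x : ℤ), IsCount d f → (∀ j, d j ≤ x) → f x = 0 := by
      intro d f x hdf hx
      refine le_antisymm ?_ (hdf.nonneg x)
      by_contra hlt
      have h0 := hdf.le x
      have h1 := (hdf.lt_iff ⟨0, by omega⟩ x).2 (by simp only; omega)
      have := hx ⟨0, by omega⟩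
      omega
    refine ⟨M + n + 2, fun r hr x => ⟨fun hx => ⟨?_, ?_⟩, fun hx => ⟨?_, ?_⟩⟩⟩
    · have := zero _ _ x (h.isCount_lower r) fun j => by
        have := abs_le.1 (hM j r (by simp; omega)).1
        omega
      omega
    · exact zero _ _ x (h.isCount_upper r) fun j => by
        have := abs_le.1 (hM j r (by simp; omega)).2
        omega
    · have := full _ _ x (h.isCount_lower r) fun j => by
        have := abs_le.1 (hM j r (by simp; omega)).1
        omega
      omega
    · exact full _ _ x (h.isCount_upper r) fun j => by
        have := abs_le.1 (hM j r (by simp; omega)).2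
        omega

/-! ### Paths as position functions, and separation of two paths -/

namespace Path

variable {n : ℕ}

theorem e_eq_zero (p : Path n) {y : ℤ} (hy : y < -(n : ℤ) ∨ (n : ℤ) < y) : p.e y = 0 := by
  by_contra h
  have := p.mem_of_e_ne_zero y h
  omega

theorem left_of_le (p : Path n) {y : ℤ} (hy : y ≤ -(n : ℤ)) : p.left y = p.start := by
  unfold left
  rw [Finset.sum_eq_zero, add_zero]
  intro t ht
  rw [Finset.mem_Ico] at ht
  rw [p.e_eq_zero (Or.inl (by omega)), Nat.cast_zero]

theorem left_succ (p : Path n) (y : ℤ) : p.left (y + 1) = p.left y + p.e y := by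
  by_cases hy : y < -(n : ℤ) - 1
  · rw [p.left_of_le (by omega), p.left_of_le (by omega), p.e_eq_zero (Or.inl (by omega))]
    simp
  · unfold left
    have : Finset.Ico (-(n : ℤ) - 1) (y + 1) = insert y (Finset.Ico (-(n : ℤ) - 1) y) := by
      ext t
      simp only [Finset.mem_Ico, Finset.mem_insert]
      omega
    rw [this, Finset.sum_insert (by simp)]
    ring

theorem right_eq (p : Path n) (y : ℤ) : p.right y = p.left (y + 1) := (p.left_succ y).symm

theorem left_mono (p : Path n) : Monotone p.left :=
  monotone_int_of_le_succ fun y => by rw [left_succ]; omega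

theorem left_of_ge (p : Path n) {y : ℤ} (hy : (n : ℤ) + 1 ≤ y) : p.left y = p.finish := by
  have key : ∀ k : ℕ, p.left ((n : ℤ) + 1 + k) = p.left ((n : ℤ) + 1) := by
    intro k
    induction k with
    | zero => simp
    | succ k ih =>
      push_cast
      rw [← add_assoc, left_succ, ih, p.e_eq_zero (Or.inr (by omega))]
      simp
  have h1 := key (y - (n + 1)).toNat
  have h2 := key 1
  unfold finish
  rw [right_eq]
  push_cast at h2
  rw [h2, ← h1]
  congr 1
  omega

theorem even_left (p : Path n) : Even (p.left 1 - p.left 0) := by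
  have := p.left_succ 0
  rw [zero_add] at this
  rw [this, add_sub_cancel_left]
  exact_mod_cast p.even_e_zero

theorem ext_left {p q : Path n} (h : ∀ y, p.left y = q.left y) : p = q := by
  ext y
  · rw [← p.left_of_le le_rfl, ← q.left_of_le le_rfl, h]
  · have h1 := p.left_succ y
    have h2 := q.left_succ y
    rw [h, h] at h1
    omega

/-- The path with given positions. -/
def ofLeft (n : ℕ) (f : ℤ → ℤ) (hf : ∀ y, f (y + 1) ≠ f y → -(n : ℤ) ≤ y ∧ y ≤ (n : ℤ))
    (he : Even (f 1 - f 0)) : Path n where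
  start := f (-(n : ℤ) - 1)
  e y := (f (y + 1) - f y).natAbs
  mem_of_e_ne_zero y hy := hf y fun h => hy (by rw [h]; simp)
  even_e_zero := by
    rw [zero_add]
    exact Int.natAbs_even.2 he

theorem left_ofLeft {f : ℤ → ℤ} (hf : ∀ y, f (y + 1) ≠ f y → -(n : ℤ) ≤ y ∧ y ≤ (n : ℤ))
    (he : Even (f 1 - f 0)) (hm : ∀ y, f y ≤ f (y + 1)) (y : ℤ) : (ofLeft n f hf he).left y = f y := by
  have up : ∀ k : ℕ, (ofLeft n f hf he).left (-(n : ℤ) - 1 + k) = f (-(n : ℤ) - 1 + k) := by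
    intro k
    induction k with
    | zero =>
      rw [Nat.cast_zero, add_zero, left_of_le _ (by omega)]
      rfl
    | succ k ih =>
      push_cast
      rw [← add_assoc, left_succ, ih]
      have := hm (-(n : ℤ) - 1 + k)
      simp only [ofLeft]
      omega
  have down : ∀ k : ℕ, f (-(n : ℤ) - 1 - k) = f (-(n : ℤ) - 1) := by
    intro k
    induction k with
    | zero => simp
    | succ k ih =>
      rw [← ih]
      by_contra hne
      have := hf (-(n : ℤ) - 1 - (k + 1 : ℕ)) (by
        rw [show -(n : ℤ) - 1 - ((k + 1 : ℕ) : ℤ) + 1 = -(n : ℤ) - 1 - k by push_cast; ring]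
        exact fun h => hne h.symm)
      omega
  rcases le_total (-(n : ℤ) - 1) y with h | h
  · have := up (y + n + 1).toNat
    rwa [show -(n : ℤ) - 1 + ((y + n + 1).toNat : ℤ) = y by omega] at this
  · have := down (-(n : ℤ) - 1 - y).toNat
    rw [show -(n : ℤ) - 1 - ((-(n : ℤ) - 1 - y).toNat : ℤ) = y by omega] at this
    rw [this, left_of_le _ (by omega)]
    rfl

/-- On one row each path covers an interval, and two intervals are disjoint iff one lies strictly to
the left of the other. A meeting away from height `0` is always ordinary; at height `0` only the
parity of the distance matters. -/
theorem not_ordinarilyIntersecting_iff (p q : Path n) : ¬ p.OrdinarilyIntersecting q ↔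
    (∀ y, -(n : ℤ) - 1 ≤ y → y ≤ (n : ℤ) + 1 → y ≠ 0 →
      p.left (y + 1) < q.left y ∨ q.left (y + 1) < p.left y) ∧
    (q.left 0 ≤ p.left 1 → p.left 0 ≤ q.left 1 → Odd (p.left 0 - q.left 0)) := by
  have hmem : ∀ (p : Path n) x y, p.Mem x y ↔
      (-(n : ℤ) - 1 ≤ y ∧ y ≤ (n : ℤ) + 1) ∧ p.left y ≤ x ∧ x ≤ p.left (y + 1) := fun p x y => by
    unfold Mem
    rw [right_eq]
  have hp : ∀ y, p.left y ≤ p.left (y + 1) := fun y => p.left_mono (by omega)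
  have hq : ∀ y, q.left y ≤ q.left (y + 1) := fun y => q.left_mono (by omega)
  have key : ∀ y, -(n : ℤ) - 1 ≤ y → y ≤ (n : ℤ) + 1 →
      ((∃ x, p.Mem x y ∧ q.Mem x y) ↔ q.left y ≤ p.left (y + 1) ∧ p.left y ≤ q.left (y + 1)) := by
    intro y h1 h2
    simp only [hmem]
    constructor
    · rintro ⟨x, h3, h4⟩
      constructor <;> omega
    · rintro ⟨h3, h4⟩
      have := hp y
      have := hq y
      refine ⟨max (p.left y) (q.left y), ⟨⟨h1, h2⟩, le_max_left _ _, ?_⟩, ⟨h1, h2⟩,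
        le_max_right _ _, ?_⟩ <;> omega
  have key0 := key 0 (by omega) (by omega)
  rw [zero_add] at key0
  constructor
  · intro h
    have hspec : ∀ x y, p.Mem x y → q.Mem x y → y = 0 ∧ Odd (p.left 0 - q.left 0) := by
      intro x y h1 h2
      by_contra hcon
      refine h ⟨⟨x, y, h1, h2⟩, fun hs => hcon ⟨hs.2.1 x y h1 h2, hs.2.2⟩⟩
    constructor
    · intro y h1 h2 h0
      by_contra hcon
      obtain ⟨x, h3, h4⟩ := (key y h1 h2).2 (by omega)
      exact h0 (hspec x y h3 h4).1
    · intro h1 h2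
      obtain ⟨x, h3, h4⟩ := key0.2 ⟨h1, h2⟩
      exact (hspec x 0 h3 h4).2
  · rintro ⟨h1, h2⟩ ⟨hI, hS⟩
    have hy : ∀ x y, p.Mem x y → q.Mem x y → y = 0 := by
      intro x y h3 h4
      by_contra hne
      have h5 := ((hmem p x y).1 h3).1
      have h6 := (key y h5.1 h5.2).1 ⟨x, h3, h4⟩
      have := h1 y h5.1 h5.2 hne
      omega
    obtain ⟨x, y, h3, h4⟩ := hI
    have h0 := hy x y h3 h4
    subst h0
    have h6 := key0.1 ⟨x, h3, h4⟩
    exact hS ⟨⟨x, 0, h3, h4⟩, hy, h2 h6.1 h6.2⟩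

/-- The order at the start persists row by row up to height `0`, because disjoint intervals with
ordered left ends stay ordered. Nothing is claimed beyond height `0`, where the order may change. -/
theorem lower_lt_of_separated {p q : Path n} (h0 : q.start < p.start)
    (h : ∀ y, -(n : ℤ) - 1 ≤ y → y ≤ (n : ℤ) + 1 → y ≠ 0 →
      p.left (y + 1) < q.left y ∨ q.left (y + 1) < p.left y) (r : ℕ) :
    q.left (-(r : ℤ)) < p.left (-((r + 1 : ℕ) : ℤ)) := by
  have hp : ∀ y, p.left y ≤ p.left (y + 1) := fun y => p.left_mono (by omega)
  have key : ∀ k : ℕ, k ≤ n + 1 → q.left (-(n : ℤ) - 1 + k) < p.left (-(n : ℤ) - 1 + k) := by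
    intro k
    induction k with
    | zero =>
      intro _
      rwa [Nat.cast_zero, add_zero, left_of_le _ (by omega), left_of_le _ (by omega)]
    | succ k ih =>
      intro hk
      have h1 := ih (by omega)
      have h2 := h (-(n : ℤ) - 1 + k) (by omega) (by omega) (by omega)
      have h3 := hp (-(n : ℤ) - 1 + k)
      push_cast
      rw [← add_assoc]
      omega
  by_cases hr : r ≤ n
  · have h1 := key (n - r) (by omega)
    rw [show -(n : ℤ) - 1 + ((n - r : ℕ) : ℤ) = -((r + 1 : ℕ) : ℤ) by omega] at h1
    have h2 := h (-((r + 1 : ℕ) : ℤ)) (by omega) (by omega) (by omega)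
    have h3 := hp (-((r + 1 : ℕ) : ℤ))
    rw [show -((r + 1 : ℕ) : ℤ) + 1 = -(r : ℤ) by push_cast; ring] at h2 h3
    omega
  · rwa [left_of_le _ (by omega), left_of_le _ (by omega)]

theorem upper_lt_of_separated {p q : Path n} (h0 : q.finish < p.finish)
    (h : ∀ y, -(n : ℤ) - 1 ≤ y → y ≤ (n : ℤ) + 1 → y ≠ 0 →
      p.left (y + 1) < q.left y ∨ q.left (y + 1) < p.left y) (r : ℕ) :
    q.left ((r : ℤ) + 1 + 1) < p.left ((r : ℤ) + 1) := by
  have hq : ∀ y, q.left y ≤ q.left (y + 1) := fun y => q.left_mono (by omega)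
  have key : ∀ k : ℕ, k ≤ n + 1 → q.left ((n : ℤ) + 2 - k) < p.left ((n : ℤ) + 2 - k) := by
    intro k
    induction k with
    | zero =>
      intro _
      rwa [Nat.cast_zero, sub_zero, left_of_ge _ (by omega), left_of_ge _ (by omega)]
    | succ k ih =>
      intro hk
      have h1 := ih (by omega)
      have h2 := h ((n : ℤ) + 1 - k) (by omega) (by omega) (by omega)
      have h3 := hq ((n : ℤ) + 1 - k)
      rw [show (n : ℤ) + 2 - ((k + 1 : ℕ) : ℤ) = (n : ℤ) + 1 - k by push_cast; ring]
      rw [show (n : ℤ) + 1 - k + 1 = (n : ℤ) + 2 - k by ring] at h2 h3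
      omega
  by_cases hr : r ≤ n
  · have h1 := key (n - r) (by omega)
    rw [show (n : ℤ) + 2 - ((n - r : ℕ) : ℤ) = (r : ℤ) + 1 + 1 by omega] at h1
    have h2 := h ((r : ℤ) + 1) (by omega) (by omega) (by omega)
    have h3 := hq ((r : ℤ) + 1)
    omega
  · rwa [left_of_ge _ (by omega), left_of_ge _ (by omega)]

end Path

/-- Neighbouring inequalities chain together through the monotonicity of the single paths; this is
why adjacent pairs suffice for the identity permutation. -/
theorem IsPattern.of_adjacent {l : ℕ} {c : PathPair l}
    (h1 : ∀ i r, c.lower i (r + 1) ≤ c.lower i r)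
    (h2 : ∀ i j : Fin l, (j : ℕ) = (i : ℕ) + 1 → ∀ r, c.lower j r < c.lower i (r + 1))
    (h3 : ∀ i r, c.upper i r ≤ c.upper i (r + 1))
    (h4 : ∀ i j : Fin l, (j : ℕ) = (i : ℕ) + 1 → ∀ r, c.upper j (r + 1) < c.upper i r) :
    IsPattern c where
  lower_le := h1
  upper_le := h3
  lower_lt := by
    intro i j hij r
    rw [Fin.lt_def] at hij
    obtain ⟨k, hk⟩ := Nat.exists_eq_add_of_lt hij
    induction k generalizing j with
    | zero => exact h2 i j hk r
    | succ k ih =>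
      have e1 := h2 ⟨j - 1, by omega⟩ j (by simp only; omega) r
      have e2 := h1 ⟨j - 1, by omega⟩ r
      have e3 := ih ⟨j - 1, by omega⟩ (by simp only; omega) (by simp only; omega)
      omega
  upper_lt := by
    intro i j hij r
    rw [Fin.lt_def] at hij
    obtain ⟨k, hk⟩ := Nat.exists_eq_add_of_lt hij
    induction k generalizing j with
    | zero => exact h4 i j hk r
    | succ k ih =>
      have e1 := h4 ⟨j - 1, by omega⟩ j (by simp only; omega) r
      have e2 := h3 ⟨j - 1, by omega⟩ r
      have e3 := ih ⟨j - 1, by omega⟩ (by simp only; omega) (by simp only; omega)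
      omega

/-- The horizontal positions `μ_i - i` of the starting points. -/
def starts (l : ℕ) (mu : YoungDiagram) (i : Fin l) : ℤ := (mu.rowLen i : ℤ) - (i : ℕ)

theorem starts_strictAnti (l : ℕ) (mu : YoungDiagram) : StrictAnti (starts l mu) := by
  intro i j hij
  rw [Fin.lt_def] at hij
  have := mu.rowLen_anti i j hij.le
  unfold starts
  omega

/-! ### Tuples of paths as interlacing patterns -/

namespace PathTuple

variable {n : ℕ} {lam mu : YoungDiagram} (p : PathTuple n lam mu)

theorem lower_eq (i : Fin (lam.colLen 0)) (r : ℕ) :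
    p.toPair.lower i r = (p.path i).left (-(r : ℤ)) := rfl

theorem upper_eq (i : Fin (lam.colLen 0)) (r : ℕ) :
    p.toPair.upper (p.σ i) r = (p.path i).left ((r : ℤ) + 1) := by
  simp only [toPair, Equiv.symm_apply_apply, Path.right_eq]

theorem lower_le (i : Fin (lam.colLen 0)) (r : ℕ) :
    p.toPair.lower i (r + 1) ≤ p.toPair.lower i r := by
  rw [lower_eq, lower_eq]
  exact (p.path i).left_mono (by push_cast; omega)

theorem upper_le (i : Fin (lam.colLen 0)) (r : ℕ) :
    p.toPair.upper i r ≤ p.toPair.upper i (r + 1) := by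
  obtain ⟨i, rfl⟩ := p.σ.surjective i
  rw [upper_eq, upper_eq]
  exact (p.path i).left_mono (by push_cast; omega)

theorem lower_of_ge (i : Fin (lam.colLen 0)) (r : ℕ) (hr : n ≤ r) :
    p.toPair.lower i r = starts _ mu i := by
  rw [lower_eq, Path.left_of_le _ (by omega), p.start_eq]
  rfl

theorem upper_of_ge (i : Fin (lam.colLen 0)) (r : ℕ) (hr : n ≤ r) :
    p.toPair.upper i r = starts _ lam i := by
  obtain ⟨i, rfl⟩ := p.σ.surjective i
  rw [upper_eq, Path.left_of_ge _ (by omega), p.finish_eq]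
  rfl

theorem lower_le_upper (i : Fin (lam.colLen 0)) :
    p.toPair.lower i 0 ≤ p.toPair.upper (p.σ i) 0 := by
  rw [upper_eq, lower_eq]
  exact (p.path i).left_mono (by simp)

theorem even_upper_sub_lower (i : Fin (lam.colLen 0)) :
    Even (p.toPair.upper (p.σ i) 0 - p.toPair.lower i 0) := by
  rw [upper_eq, lower_eq]
  simpa using (p.path i).even_left

theorem ext_toPair {p q : PathTuple n lam mu} (hσ : p.σ = q.σ) (h : p.toPair = q.toPair) :
    p = q := by
  have : p.path = q.path := by
    funext i
    refine Path.ext_left fun y => ?_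
    rcases le_or_gt y 0 with hy | hy
    · have h1 := p.lower_eq i (-y).toNat
      have h2 := q.lower_eq i (-y).toNat
      rw [show -((-y).toNat : ℤ) = y by omega] at h1 h2
      rw [← h1, ← h2, h]
    · have h1 := p.upper_eq i (y - 1).toNat
      have h2 := q.upper_eq i (y - 1).toNat
      rw [show ((y - 1).toNat : ℤ) + 1 = y by omega] at h1 h2
      rw [← h1, ← h2, h, hσ]
  cases p
  cases q
  simp only at hσ this
  subst hσ this
  rfl

/-- Lower path `i` is glued to upper path `σ i` by E-steps at height `0`; the gap has to be
nonnegative and even. -/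
theorem exists_tuple {c : PathPair (lam.colLen 0)} (hc : IsPattern c)
    (hs : ∀ j r, n ≤ r → c.lower j r = starts _ mu j)
    (hf : ∀ j r, n ≤ r → c.upper j r = starts _ lam j)
    (σ : Equiv.Perm (Fin (lam.colLen 0))) (hle : ∀ i, c.lower i 0 ≤ c.upper (σ i) 0)
    (he : ∀ i, Even (c.upper (σ i) 0 - c.lower i 0)) :
    ∃ p : PathTuple n lam mu, p.σ = σ ∧ p.toPair = c := by
  set f : Fin (lam.colLen 0) → ℤ → ℤ := fun i y =>
    if y ≤ 0 then c.lower i (-y).toNat else c.upper (σ i) (y - 1).toNat with hfdef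
  have f0 : ∀ i (r : ℕ), f i (-(r : ℤ)) = c.lower i r := fun i r => by
    simp [hfdef]
  have f1 : ∀ i (r : ℕ), f i ((r : ℤ) + 1) = c.upper (σ i) r := fun i r => by
    have : ¬ ((r : ℤ) + 1 ≤ 0) := by omega
    simp [hfdef, this]
  have hcases : ∀ y : ℤ, (∃ r : ℕ, y = -((r + 1 : ℕ) : ℤ)) ∨ y = 0 ∨ ∃ r : ℕ, y = (r : ℤ) + 1 := by
    intro y
    rcases lt_trichotomy y 0 with h | h | h
    · exact Or.inl ⟨(-y - 1).toNat, by omega⟩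
    · exact Or.inr (Or.inl h)
    · exact Or.inr (Or.inr ⟨(y - 1).toNat, by omega⟩)
  have hneg : ∀ r : ℕ, -((r + 1 : ℕ) : ℤ) + 1 = -(r : ℤ) := fun r => by push_cast; ring
  have hz0 : ∀ i, f i 0 = c.lower i 0 := fun i => by simpa using f0 i 0
  have hz1 : ∀ i, f i 1 = c.upper (σ i) 0 := fun i => by simpa using f1 i 0
  have hmono : ∀ i y, f i y ≤ f i (y + 1) := by
    intro i y
    rcases hcases y with ⟨r, rfl⟩ | rfl | ⟨r, rfl⟩
    · rw [hneg, f0, f0]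
      exact hc.lower_le i r
    · rw [zero_add, hz0, hz1]
      exact hle i
    · have := f1 i (r + 1)
      push_cast at this
      rw [this, f1]
      exact hc.upper_le _ r
  have hconst : ∀ i y, f i (y + 1) ≠ f i y → -(n : ℤ) ≤ y ∧ y ≤ (n : ℤ) := by
    intro i y
    contrapose!
    intro hy
    rcases hcases y with ⟨r, rfl⟩ | rfl | ⟨r, rfl⟩
    · rw [hneg, f0, f0, hs i r (by omega), hs i (r + 1) (by omega)]
    · omega
    · have := f1 i (r + 1)
      push_cast at this
      rw [this, f1, hf _ r (by omega), hf _ (r + 1) (by omega)]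
  have heven : ∀ i, Even (f i 1 - f i 0) := fun i => by
    rw [hz0, hz1]
    exact he i
  have hleft : ∀ i y, (Path.ofLeft n (f i) (hconst i) (heven i)).left y = f i y := fun i y =>
    Path.left_ofLeft _ _ (hmono i) y
  refine ⟨⟨σ, fun i => Path.ofLeft n (f i) (hconst i) (heven i), fun i => ?_, fun i => ?_⟩,
    rfl, ?_⟩
  · rw [← Path.left_of_le _ le_rfl, hleft, f0, hs i n le_rfl]
    rfl
  · rw [← Path.left_of_ge _ le_rfl, hleft, f1, hf _ n le_rfl]
    rfl
  · obtain ⟨cl, cu⟩ := c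
    simp only [toPair, Path.right_eq, hleft, f0, f1, Equiv.apply_symm_apply]

theorem isPattern_of_separated
    (h : ∀ i j, i < j → ∀ y, -(n : ℤ) - 1 ≤ y → y ≤ (n : ℤ) + 1 → y ≠ 0 →
      (p.path i).left (y + 1) < (p.path j).left y ∨
      (p.path j).left (y + 1) < (p.path i).left y) : IsPattern p.toPair where
  lower_le := p.lower_le
  upper_le := p.upper_le
  lower_lt := by
    intro i j hij r
    refine Path.lower_lt_of_separated ?_ (h i j hij) r
    rw [p.start_eq, p.start_eq]
    exact starts_strictAnti _ mu hij
  upper_lt := by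
    intro i j hij r
    obtain ⟨i, rfl⟩ := p.σ.surjective i
    obtain ⟨j, rfl⟩ := p.σ.surjective j
    rw [upper_eq, upper_eq]
    refine Path.upper_lt_of_separated ?_ ?_ r
    · rw [p.finish_eq, p.finish_eq]
      exact starts_strictAnti _ lam hij
    · rcases lt_trichotomy i j with h1 | h1 | h1
      · exact h i j h1
      · exact absurd hij (h1 ▸ lt_irrefl _)
      · exact fun y hy hy' h0 => (h j i h1 y hy hy' h0).symm

theorem separated_of_isPattern (h : IsPattern p.toPair) {i j : Fin (lam.colLen 0)} (hij : i ≠ j)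
    {y : ℤ} (hy : y ≠ 0) : (p.path i).left (y + 1) < (p.path j).left y ∨
      (p.path j).left (y + 1) < (p.path i).left y := by
  rcases lt_or_gt_of_ne hy with hy | hy
  · obtain ⟨r, rfl⟩ : ∃ r : ℕ, y = -((r + 1 : ℕ) : ℤ) := ⟨(-y - 1).toNat, by omega⟩
    rw [show -((r + 1 : ℕ) : ℤ) + 1 = -(r : ℤ) by push_cast; ring]
    rcases lt_or_gt_of_ne hij with h1 | h1
    · exact Or.inr (h.lower_lt i j h1 r)
    · exact Or.inl (h.lower_lt j i h1 r)
  · obtain ⟨r, rfl⟩ : ∃ r : ℕ, y = (r : ℤ) + 1 := ⟨(y - 1).toNat, by omega⟩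
    have e : ∀ i, (p.path i).left ((r : ℤ) + 1 + 1) = p.toPair.upper (p.σ i) (r + 1) := fun i => by
      rw [upper_eq]
      push_cast
      rfl
    rw [e, e, ← upper_eq, ← upper_eq]
    rcases lt_or_gt_of_ne (p.σ.injective.ne hij) with h1 | h1
    · exact Or.inr (h.upper_lt _ _ h1 r)
    · exact Or.inl (h.upper_lt _ _ h1 r)

theorem not_ordinarilyIntersecting_iff (h : IsPattern p.toPair) {i j : Fin (lam.colLen 0)}
    (hij : i ≠ j) : ¬ (p.path i).OrdinarilyIntersecting (p.path j) ↔
    (p.toPair.lower j 0 ≤ p.toPair.upper (p.σ i) 0 →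
      p.toPair.lower i 0 ≤ p.toPair.upper (p.σ j) 0 →
      Odd (p.toPair.lower i 0 - p.toPair.lower j 0)) := by
  rw [Path.not_ordinarilyIntersecting_iff,
    and_iff_right fun y _ _ h0 => p.separated_of_isPattern h hij h0]
  simp only [upper_eq, lower_eq, Nat.cast_zero, neg_zero, zero_add]

theorem mem_P₁_iff : p ∈ P₁ n lam mu ↔ IsPattern p.toPair ∧
    ∀ i j, i ≠ j → p.toPair.lower j 0 ≤ p.toPair.upper (p.σ i) 0 →
      p.toPair.lower i 0 ≤ p.toPair.upper (p.σ j) 0 →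
      Odd (p.toPair.lower i 0 - p.toPair.lower j 0) := by
  constructor
  · intro h
    have hp := p.isPattern_of_separated fun i j hij =>
      ((Path.not_ordinarilyIntersecting_iff _ _).1 (h i j hij.ne)).1
    exact ⟨hp, fun i j hij => (p.not_ordinarilyIntersecting_iff hp hij).1 (h i j hij)⟩
  · rintro ⟨hp, h⟩ i j hij
    exact (p.not_ordinarilyIntersecting_iff hp hij).2 (h i j hij)

/-- For the identity permutation one of the two overlap inequalities of an adjacent pair holds
automatically, because the lower positions decrease with the index. -/
theorem mem_P_iff : p ∈ P n lam mu ↔ p.σ = 1 ∧ IsPattern p.toPair ∧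
    (∀ i j : Fin (lam.colLen 0), (j : ℕ) = (i : ℕ) + 1 →
      p.toPair.lower i 0 ≤ p.toPair.upper j 0 →
      Odd (p.toPair.lower i 0 - p.toPair.lower j 0)) ∧
    ¬ ∃ V, p.toPair.OddRegionII n V := by
  have hne : ∀ i j : Fin (lam.colLen 0), (j : ℕ) = (i : ℕ) + 1 → i ≠ j := by
    rintro i j h rfl
    omega
  constructor
  · rintro ⟨hσ, h, hV⟩
    have hp : IsPattern p.toPair := by
      refine IsPattern.of_adjacent p.lower_le (fun i j hij r => ?_) p.upper_le
        (fun i j hij r => ?_)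
      · refine Path.lower_lt_of_separated ?_
          ((Path.not_ordinarilyIntersecting_iff _ _).1 (h i j hij)).1 r
        rw [p.start_eq, p.start_eq]
        exact starts_strictAnti _ mu (by rw [Fin.lt_def]; omega)
      · have e : ∀ i r, p.toPair.upper i r = (p.path i).left ((r : ℤ) + 1) := fun i r => by
          rw [← upper_eq, hσ]
          rfl
        rw [e, e]
        refine Path.upper_lt_of_separated ?_
          ((Path.not_ordinarilyIntersecting_iff _ _).1 (h i j hij)).1 r
        rw [p.finish_eq, p.finish_eq, hσ]
        exact starts_strictAnti _ lam (by rw [Fin.lt_def]; simp only [Equiv.Perm.coe_one, id]; omega)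
    refine ⟨hσ, hp, fun i j hij h1 => ?_, hV⟩
    refine (p.not_ordinarilyIntersecting_iff hp (hne i j hij)).1 (h i j hij) ?_ ?_
    · have h2 := p.lower_le_upper i
      have h3 := hp.lower_anti 0 (a := i) (b := j) (by rw [Fin.lt_def]; omega)
      simp only at h3
      omega
    · rwa [hσ]
  · rintro ⟨hσ, hp, h, hV⟩
    refine ⟨hσ, fun i j hij => ?_, hV⟩
    refine (p.not_ordinarilyIntersecting_iff hp (hne i j hij)).2 fun _ h2 => h i j hij ?_
    rwa [hσ] at h2

end PathTuple

/-- The positivity condition in terms of the level function of the top row. -/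
theorem neg_one_le_topHeights_N {n : ℕ} {lam mu : YoungDiagram} (hpos : Positivity n lam mu)
    (x : ℤ) :
    -1 ≤ (topHeights (starts (lam.colLen 0) mu) (starts (lam.colLen 0) lam)).N x n := by
  have hA := isCount_cnt (d := fun j => starts (lam.colLen 0) mu j - 1 - (n : ℤ))
    fun i j hij => by
      have := starts_strictAnti _ mu hij
      simp only
      omega
  have hB := isCount_cnt (starts_strictAnti (lam.colLen 0) lam)
  have h1 := hA.nonneg x
  have h2 := hB.le x
  change -1 ≤ (n + cnt (fun j => starts (lam.colLen 0) mu j - 1 - (n : ℤ)) x) -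
    cnt (starts (lam.colLen 0) lam) x
  by_contra hlt
  set k := (cnt (starts (lam.colLen 0) lam) x).toNat with hk
  have h3 := hB.lt_iff ⟨k - 1, by omega⟩ x
  have h4 := hA.lt_iff ⟨k - 1 - n - 1, by omega⟩ x
  -- A level of `-2` or less at `x` makes row `k - 1` of `lam` longer than row `k - n - 2` of `mu`.
  -- The last column of that row of `lam` would then violate positivity.
  have h5 : lam.rowLen (k - 1) ≤ mu.rowLen (k - 1 - n - 1) := by
    by_contra hcon
    have hlam : (k - 1, lam.rowLen (k - 1) - 1) ∈ lam := by
      rw [YoungDiagram.mem_iff_lt_rowLen]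
      omega
    rw [YoungDiagram.mem_iff_lt_colLen] at hlam
    have hmu : (k - 1 - n - 1, lam.rowLen (k - 1) - 1) ∈ mu := by
      rw [YoungDiagram.mem_iff_lt_colLen]
      have := hpos (lam.rowLen (k - 1) - 1)
      omega
    rw [YoungDiagram.mem_iff_lt_rowLen] at hmu
    omega
  have e1 : starts (lam.colLen 0) lam ⟨k - 1, by omega⟩ =
      (lam.rowLen (k - 1) : ℤ) - (k - 1 : ℕ) := rfl
  have e2 : starts (lam.colLen 0) mu ⟨k - 1 - n - 1, by omega⟩ =
      (mu.rowLen (k - 1 - n - 1) : ℤ) - (k - 1 - n - 1 : ℕ) := rfl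
  rw [e1] at h3
  rw [e2] at h4
  simp only at h3 h4
  omega

/-! ### The signed counting function of the row of height zero -/

/-- `(-1) ^ z` -/
def sgn (z : ℤ) : ℤ := if z % 2 = 0 then 1 else -1

theorem cnt_eq_sum {l : ℕ} (d : Fin l → ℤ) (x : ℤ) :
    cnt d x = ∑ j, if x < d j then 1 else 0 := by
  unfold cnt
  rw [Finset.natCast_card_filter]

/-- The signed number of steps at height zero over the position `x`, for paths that leave the
lower half plane at the positions `a` and enter the upper half plane at the positions `b`. -/
def kap {l : ℕ} (a b : Fin l → ℤ) (x : ℤ) : ℤ :=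
  ∑ j, ((if x < b j then sgn (x + 1 + b j) else 0) -
    if x < a j - 1 then sgn (x + 1 + a j) else 0)

/-- The function that is determined by `S` as a signed counting function is bounded by `1`. -/
def HasKappa (S : ℤ → ℤ) : Prop :=
  ∃ κ : ℤ → ℤ, (∀ x, |κ x| ≤ 1) ∧ (∀ x, κ x + κ (x + 1) = S x - S (x + 1)) ∧
    ∃ M, ∀ x, M ≤ x → κ x = 0

section kap

variable {l : ℕ} {a b : Fin l → ℤ}

/-- The sign alternates with `x`, so each end point contributes only where it is crossed, and both
kinds of end points do so with the same sign. Thus the count depends on `cnt (a - 1)` and `cnt b`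
only through their sum. -/
theorem kap_rec (a b : Fin l → ℤ) (x : ℤ) : kap a b x + kap a b (x + 1) =
    (cnt (fun j => a j - 1) x + cnt b x) -
      (cnt (fun j => a j - 1) (x + 1) + cnt b (x + 1)) := by
  simp only [kap, cnt_eq_sum, ← Finset.sum_add_distrib, ← Finset.sum_sub_distrib]
  refine Finset.sum_congr rfl fun j _ => ?_
  unfold sgn
  split_ifs <;> omega

theorem exists_fin_bound (d : Fin l → ℤ) : ∃ M : ℤ, ∀ j, |d j| ≤ M :=
  ⟨∑ j, |d j|, fun j => Finset.single_le_sum (f := fun j => |d j|) (fun _ _ => abs_nonneg _)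
    (Finset.mem_univ j)⟩

theorem exists_kap_eq_zero (a b : Fin l → ℤ) : ∃ M, ∀ x, M ≤ x → kap a b x = 0 := by
  obtain ⟨M, hM⟩ := exists_fin_bound a
  obtain ⟨M', hM'⟩ := exists_fin_bound b
  refine ⟨max M M', fun x hx => Finset.sum_eq_zero fun j _ => ?_⟩
  have h1 := (abs_le.1 (hM j)).2
  have h2 := (abs_le.1 (hM' j)).2
  rw [if_neg (by omega), if_neg (by omega), sub_zero]

theorem eq_of_rec {κ κ' : ℤ → ℤ} (h : ∀ x, κ x + κ (x + 1) = κ' x + κ' (x + 1))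
    {M M' : ℤ} (h0 : ∀ x, M ≤ x → κ x = 0) (h0' : ∀ x, M' ≤ x → κ' x = 0) : κ = κ' := by
  funext x
  refine int_induction_down (M := max M M') (P := fun x => κ x = κ' x) ?_ ?_ x
  · intro x hx
    rw [h0 x (le_trans (le_max_left _ _) hx), h0' x (le_trans (le_max_right _ _) hx)]
  · intro x ih
    have h1 := ih (x + 1) (by omega)
    have h2 := h x
    omega

/-- The recursion together with vanishing far to the right has only one solution, namely `kap a b`.
-/
theorem hasKappa_iff {S : ℤ → ℤ} (hS : ∀ x, S x = cnt (fun j => a j - 1) x + cnt b x) :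
    HasKappa S ↔ ∀ x, |kap a b x| ≤ 1 := by
  obtain ⟨M, hM⟩ := exists_kap_eq_zero a b
  constructor
  · rintro ⟨κ, h1, h2, M', h3⟩ x
    rw [← eq_of_rec (κ := κ) (fun x => ?_) h3 hM]
    · exact h1 x
    · rw [h2, kap_rec, hS, hS]
  · intro h
    exact ⟨kap a b, h, fun x => by rw [kap_rec, hS, hS], M, hM⟩

theorem cnt_eq_sum_perm (σ : Equiv.Perm (Fin l)) (x : ℤ) :
    cnt b x = ∑ j, if x < b (σ j) then 1 else 0 := by
  rw [cnt_eq_sum, Equiv.sum_comp σ fun j => if x < b j then (1 : ℤ) else 0]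

theorem kap_eq_perm (σ : Equiv.Perm (Fin l)) (x : ℤ) : kap a b x =
    ∑ j, ((if x < b (σ j) then sgn (x + 1 + b (σ j)) else 0) -
      if x < a j - 1 then sgn (x + 1 + a j) else 0) := by
  rw [kap, Finset.sum_sub_distrib, Finset.sum_sub_distrib,
    Equiv.sum_comp σ fun j => if x < b j then sgn (x + 1 + b j) else 0]

/-! #### Pairwise odd distances -/

/-- Intervals whose left ends have odd distances whenever they overlap. -/
structure IsSpecial (a b : Fin l → ℤ) (σ : Equiv.Perm (Fin l)) : Prop where
  le : ∀ i, a i ≤ b (σ i)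
  even : ∀ i, Even (b (σ i) - a i)
  odd : ∀ i j, i ≠ j → a j ≤ b (σ i) → a i ≤ b (σ j) → Odd (a i - a j)

theorem sum_eq_of_card_le_two {ι : Type*} [DecidableEq ι] (s : Finset ι) (hs : s.card ≤ 2)
    (f : ι → ℤ) (hf : ∀ i ∈ s, |f i| ≤ 1) (hf' : ∀ i ∈ s, ∀ j ∈ s, i ≠ j → f i + f j = 0) :
    |∑ i ∈ s, f i| ≤ 1 := by
  have h : s.card = 0 ∨ s.card = 1 ∨ s.card = 2 := by omega
  rcases h with h | h | h
  · rw [Finset.card_eq_zero.1 h]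
    simp
  · obtain ⟨i, rfl⟩ := Finset.card_eq_one.1 h
    simpa using hf i
  · obtain ⟨i, j, hij, rfl⟩ := Finset.card_eq_two.1 h
    rw [Finset.sum_pair hij, hf' i (by simp) j (by simp) hij]
    simp

/-- The intervals over a position overlap pairwise, so their left ends are pairwise of different
parity. Hence there are at most two of them, and two contribute opposite signs. -/
theorem IsSpecial.bounds {σ : Equiv.Perm (Fin l)} (h : IsSpecial a b σ) (x : ℤ) :
    cnt (fun j => a j - 1) x ≤ cnt b x ∧ cnt b x ≤ cnt (fun j => a j - 1) x + 2 ∧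
      |kap a b x| ≤ 1 := by
  set s : Finset (Fin l) := Finset.univ.filter fun i => a i - 1 ≤ x ∧ x < b (σ i) with hs
  have hcard : cnt b x = cnt (fun j => a j - 1) x + s.card := by
    rw [cnt_eq_sum_perm σ, cnt_eq_sum, hs, Finset.natCast_card_filter, ← Finset.sum_add_distrib]
    refine Finset.sum_congr rfl fun i _ => ?_
    have := h.le i
    split_ifs <;> omega
  have hodd : ∀ i ∈ s, ∀ j ∈ s, i ≠ j → Odd (a i - a j) := by
    intro i hi j hj hij
    simp only [hs, Finset.mem_filter, Finset.mem_univ, true_and] at hi hj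
    exact h.odd i j hij (by omega) (by omega)
  have hs2 : s.card ≤ 2 := by
    by_contra hcon
    obtain ⟨i, hi, j, hj, k, hk, h1, h2, h3⟩ := Finset.two_lt_card.1 (not_le.1 hcon)
    have e1 := hodd i hi j hj h1
    have e2 := hodd i hi k hk h2
    have e3 := hodd j hj k hk h3
    simp only [Int.odd_iff] at e1 e2 e3
    omega
  have hkap : kap a b x = ∑ i ∈ s, sgn (x + 1 + a i) := by
    rw [kap_eq_perm σ, hs, Finset.sum_filter]
    refine Finset.sum_congr rfl fun i _ => ?_
    have h1 := h.le i
    have h2 := h.even i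
    rw [Int.even_iff] at h2
    unfold sgn
    split_ifs <;> omega
  refine ⟨by omega, by omega, ?_⟩
  rw [hkap]
  refine sum_eq_of_card_le_two s hs2 _ (fun i _ => ?_) fun i hi j hj hij => ?_
  · unfold sgn
    split_ifs <;> simp
  · have := hodd i hi j hj hij
    rw [Int.odd_iff] at this
    unfold sgn
    split_ifs <;> omega

/-- Otherwise the interval ending at `b j` would overlap interval `i` with an even distance of left
ends. So the partner of `a i` is the nearest right end of its parity, which determines the
permutation. -/
theorem IsSpecial.le_of_even {σ : Equiv.Perm (Fin l)} (h : IsSpecial a b σ) {i j : Fin l}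
    (h1 : a i ≤ b j) (h2 : Even (b j - a i)) : b (σ i) ≤ b j := by
  by_contra hlt
  obtain ⟨k, rfl⟩ := σ.surjective j
  have hne : i ≠ k := by rintro rfl; omega
  have h3 := h.le k
  have h4 := h.even k
  have h5 := h.odd i k hne (by omega) h1
  simp only [Int.even_iff, Int.odd_iff] at h2 h4 h5
  omega

theorem IsSpecial.unique {σ τ : Equiv.Perm (Fin l)} (hb : Function.Injective b)
    (h : IsSpecial a b σ) (h' : IsSpecial a b τ) : σ = τ := by
  ext1 i
  exact hb (le_antisymm (h.le_of_even (h'.le i) (h'.even i)) (h'.le_of_even (h.le i) (h.even i)))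

/-- Within one parity class the bounds say that at most one interval is open at a time, so left and
right ends of this class alternate. Each left end is matched with the nearest right end of its
class. -/
theorem exists_isSpecial (hinj : Function.Injective a) (hbinj : Function.Injective b)
    (h0 : ∀ x, cnt (fun j => a j - 1) x ≤ cnt b x)
    (h2 : ∀ x, cnt b x ≤ cnt (fun j => a j - 1) x + 2) (hk : ∀ x, |kap a b x| ≤ 1) :
    ∃ σ : Equiv.Perm (Fin l), IsSpecial a b σ := by
  -- Summed over `j`, this is the number of open intervals of the class of `ε`. It equals half of
  -- `cnt b - cnt (a - 1) ± kap`, and the bounds force it to be `0` or `1`.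
  set T : ℤ → ℤ → Fin l → ℤ := fun ε x j =>
    (if x < b j ∧ (b j - ε) % 2 = 0 then 1 else 0) -
      if x < a j - 1 ∧ (a j - ε) % 2 = 0 then 1 else 0 with hT
  have hX : ∀ ε x, 0 ≤ ∑ j, T ε x j ∧ ∑ j, T ε x j ≤ 1 := by
    intro ε x
    have h3 := h0 x
    have h4 := h2 x
    have h5 := abs_le.1 (hk x)
    by_cases hp : (x + 1 - ε) % 2 = 0
    · have : 2 * ∑ j, T ε x j = cnt b x - cnt (fun j => a j - 1) x + kap a b x := by
        simp only [kap, cnt_eq_sum, ← Finset.sum_add_distrib, ← Finset.sum_sub_distrib,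
          Finset.mul_sum]
        refine Finset.sum_congr rfl fun j _ => ?_
        simp only [hT, sgn]
        split_ifs <;> omega
      omega
    · have : 2 * ∑ j, T ε x j = cnt b x - cnt (fun j => a j - 1) x - kap a b x := by
        simp only [kap, cnt_eq_sum, ← Finset.sum_sub_distrib, Finset.mul_sum]
        refine Finset.sum_congr rfl fun j _ => ?_
        simp only [hT, sgn]
        split_ifs <;> omega
      omega
  have hlt : ∀ (i : Fin l) (x y ε : ℤ), (∀ j, T ε x j ≤ T ε y j) → T ε x i < T ε y i →
      ∑ j, T ε x j < ∑ j, T ε y j := fun i x y ε h h' =>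
    Finset.sum_lt_sum (fun j _ => h j) ⟨i, Finset.mem_univ i, h'⟩
  have hpos : ∀ i, 1 ≤ ∑ j, T (a i) (a i - 1) j := by
    intro i
    -- The only position between the two arguments has the wrong parity for a right end of this
    -- class, so the sum increases when `a i` drops out.
    have h3 := hlt i (a i - 1 - 1) (a i - 1) (a i) (fun j => by
      simp only [hT]
      split_ifs <;> omega) (by
      simp only [hT]
      split_ifs <;> omega)
    have h4 := (hX (a i) (a i - 1 - 1)).1
    omega
  have hex : ∀ i, ∃ j, (a i ≤ b j ∧ (b j - a i) % 2 = 0) ∧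
      ∀ k, (a i ≤ b k ∧ (b k - a i) % 2 = 0) → b j ≤ b k := by
    intro i
    obtain ⟨j, hj, hmin⟩ := Finset.exists_min_image
      (Finset.univ.filter fun j => a i ≤ b j ∧ (b j - a i) % 2 = 0) b (by
        by_contra hemp
        rw [Finset.not_nonempty_iff_eq_empty] at hemp
        have h3 : ∑ j, T (a i) (a i - 1) j ≤ 0 := Finset.sum_nonpos fun j _ => by
          have : j ∉ Finset.univ.filter fun j => a i ≤ b j ∧ (b j - a i) % 2 = 0 := by
            rw [hemp]; simp
          simp only [Finset.mem_filter, Finset.mem_univ, true_and] at this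
          simp only [hT]
          split_ifs <;> omega
        have := hpos i
        omega)
    simp only [Finset.mem_filter, Finset.mem_univ, true_and] at hj hmin
    exact ⟨j, hj, fun k hk => hmin k hk⟩
  choose σ hσ hmin using hex
  have hσinj : Function.Injective σ := by
    have key : ∀ i k, a k < a i → σ i ≠ σ k := by
      intro i k hki he
      have e1 := hσ i
      have e2 := hσ k
      rw [he] at e1
      -- If two left ends shared a partner, no right end of their class would lie between them, and
      -- two intervals of this class would be open at the larger left end.
      have h3 := hlt i (a k - 1) (a i - 1) (a k) (fun j => by
        have hm := hmin k j
        simp only [hT]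
        split_ifs <;> omega) (by
        have hm := hmin k i
        simp only [hT]
        split_ifs <;> omega)
      have h4 := hpos k
      have h5 := (hX (a k) (a i - 1)).2
      omega
    intro i k hik
    rcases lt_trichotomy (a i) (a k) with h | h | h
    · exact absurd hik.symm (key k i h)
    · exact hinj h
    · exact absurd hik (key i k h)
  refine ⟨Equiv.ofBijective σ (Finite.injective_iff_bijective.1 hσinj), fun i => (hσ i).1,
    fun i => Int.even_iff.2 (hσ i).2, fun i j hij h3 h4 => ?_⟩
  simp only [Equiv.ofBijective_apply] at h3 h4
  rw [← Int.not_even_iff_odd, Int.even_iff]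
  intro he
  have e1 := hσ i
  have e2 := hσ j
  refine hij (hσinj ?_)
  have key : ∀ i j : Fin l, (a i - a j) % 2 = 0 → a j ≤ a i → a i ≤ b (σ j) → b (σ i) = b (σ j) := by
    intro i j he hji h4
    have e1 := hσ i
    have e2 := hσ j
    have m1 := hmin i (σ j) ⟨h4, by omega⟩
    have m2 := hmin j (σ i) ⟨by omega, by omega⟩
    omega
  have hb : b (σ i) = b (σ j) := by
    rcases le_total (a j) (a i) with h | h
    · exact key i j he h h4
    · exact (key j i (by omega) h h3).symm
  exact hbinj hb

end kap

/-! ### The parity rule for the row of height zero -/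

/-- The data that are read off when the row of height zero is traversed from the right: the
counting functions `A` and `B` of the positions `a - 1` and `b`, the signed count `κ`, and the
number `C` of positions with a positive even number `B - A`. -/
structure Traversal (a b A B κ C : ℤ → ℤ) : Prop where
  stepA : ∀ x, A x = A (x + 1) ∨ (A x = A (x + 1) + 1 ∧ a (A (x + 1)) = x + 2)
  stepB : ∀ x, B x = B (x + 1) ∨ (B x = B (x + 1) + 1 ∧ b (B (x + 1)) = x + 1)
  stepκ : ∀ x, κ x + κ (x + 1) = (A x + B x) - (A (x + 1) + B (x + 1))
  stepC : ∀ x, C x = C (x + 1) +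
    if (B (x + 1) - A (x + 1)) % 2 = 0 ∧ B (x + 1) - A (x + 1) ≠ 0 then 1 else 0
  le : ∀ x, A x ≤ B x
  init : ∃ M, ∀ x, M ≤ x → A x = 0 ∧ B x = 0 ∧ κ x = 0 ∧ C x = 0

/-- The values of `κ` and of `C` modulo `2` in terms of the last interval that is open at `x`. -/
def TraversalValues (b A B κ C : ℤ → ℤ) (x : ℤ) : Prop :=
  (B x - A x = 0 → κ x = 0 ∧ C x % 2 = 0) ∧
  ((B x - A x) % 2 = 1 → (C x - (B x - A x) / 2) % 2 = 0 ∧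
    ((κ x = 1 ∧ (x - b (B x - 1)) % 2 = 1) ∨ (κ x = -1 ∧ (x - b (B x - 1)) % 2 = 0))) ∧
  (0 < B x - A x → (B x - A x) % 2 = 0 → κ x = 0 ∧
    (C x - (B x - A x) / 2 - b (B x - 1) - x) % 2 = 0)

/-- The right ends of the intervals that are open at `x` alternate in parity. -/
def Alternating (b A B : ℤ → ℤ) (x : ℤ) : Prop :=
  ∀ k, A x ≤ k → k < B x → (b k - b (B x - 1) - (B x - 1 - k)) % 2 = 0

namespace Traversal

variable {a b A B κ C : ℤ → ℤ}

/-- Induction from the right. Opening an interval resets the last right end; closing one is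
controlled because alternation relates the right end of the oldest open interval to that of the
latest. -/
theorem values_of_alternating (h : Traversal a b A B κ C) (halt : ∀ x, Alternating b A B x)
    (hab : ∀ x, A x = A (x + 1) + 1 → A (x + 1) < B (x + 1) ∧
      (b (A (x + 1)) - a (A (x + 1))) % 2 = 0) (x : ℤ) : TraversalValues b A B κ C x := by
  obtain ⟨M, hM⟩ := h.init
  refine int_induction_down (M := M) (P := TraversalValues b A B κ C) ?_ ?_ x
  · intro x hx
    obtain ⟨h1, h2, h3, h4⟩ := hM x hx
    unfold TraversalValues
    rw [h1, h2, h3, h4]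
    simp
  · intro x ih
    have ih' := ih (x + 1) (by omega)
    have hA := h.stepA x
    have hB := h.stepB x
    have hκ := h.stepκ x
    have hC := h.stepC x
    have l1 := h.le x
    have l2 := h.le (x + 1)
    have alt1 := halt (x + 1) (A (x + 1))
    have alt2 := halt x (B (x + 1) - 1)
    have ab := hab x
    have hBx : B x = B (x + 1) + 1 → b (B x - 1) = b (B (x + 1)) := fun e => by
      rw [e, add_sub_cancel_right]
    have hBx' : B x = B (x + 1) → b (B x - 1) = b (B (x + 1) - 1) := fun e => by rw [e]
    unfold TraversalValues at ih' ⊢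
    generalize b (B x - 1) = bl' at *
    generalize b (B (x + 1) - 1) = bl at *
    generalize b (B (x + 1)) = bn at *
    generalize b (A (x + 1)) = bA at *
    generalize a (A (x + 1)) = aA at *
    clear halt hab hM ih
    generalize A (x + 1) = p at *
    generalize B (x + 1) = q at *
    generalize κ (x + 1) = k at *
    generalize C (x + 1) = c at *
    generalize A x = p' at *
    generalize B x = q' at *
    generalize κ x = k' at *
    generalize C x = c' at *
    clear h M
    rcases hA with hA | ⟨hA, hA'⟩ <;> rcases hB with hB | ⟨hB, hB'⟩
    · subst hA hB
      have e := hBx' rfl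
      subst e
      split_ifs at hC <;> omega
    · subst hA hB
      have e := hBx rfl
      subst e
      split_ifs at hC <;> omega
    · subst hA hB
      have e := hBx' rfl
      subst e
      obtain ⟨ab1, ab2⟩ := ab rfl
      have alt := alt1 le_rfl ab1
      split_ifs at hC <;> omega
    · subst hA hB
      have e := hBx rfl
      subst e
      obtain ⟨ab1, ab2⟩ := ab rfl
      have alt := alt1 le_rfl ab1
      split_ifs at hC <;> omega

/-- Here alternation is derived together with the values. When an interval opens over another one,
`|κ| ≤ 1` excludes the wrong parity if the number of open intervals was odd, and the rule excludes
it if that number was even. -/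
theorem values_and_alternating (h : Traversal a b A B κ C) (hκ : ∀ x, κ x ≤ 1 ∧ -1 ≤ κ x)
    (hrule : ∀ x, (B x - A x) % 2 = 1 → (C x - (B x - A x) / 2) % 2 = 0) (x : ℤ) :
    TraversalValues b A B κ C x ∧ Alternating b A B x := by
  obtain ⟨M, hM⟩ := h.init
  refine int_induction_down (M := M)
    (P := fun x => TraversalValues b A B κ C x ∧ Alternating b A B x) ?_ ?_ x
  · intro x hx
    obtain ⟨h1, h2, h3, h4⟩ := hM x hx
    unfold TraversalValues Alternating
    rw [h1, h2, h3, h4]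
    refine ⟨by simp, fun k h5 h6 => by omega⟩
  · intro x ih
    obtain ⟨ih', alt⟩ := ih (x + 1) (by omega)
    have hA := h.stepA x
    have hB := h.stepB x
    have hκ' := h.stepκ x
    have hC := h.stepC x
    have l1 := h.le x
    have l2 := h.le (x + 1)
    have k1 := hκ x
    have k2 := hκ (x + 1)
    have r1 := hrule x
    have hBx : B x = B (x + 1) + 1 → b (B x - 1) = b (B (x + 1)) := fun e => by
      rw [e, add_sub_cancel_right]
    have hBx' : B x = B (x + 1) → b (B x - 1) = b (B (x + 1) - 1) := fun e => by rw [e]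
    have hlast : TraversalValues b A B κ C x ∧ (B x = B (x + 1) + 1 → A x < B (x + 1) →
        (b (B (x + 1)) - b (B (x + 1) - 1)) % 2 = 1) := by
      unfold TraversalValues at ih' ⊢
      clear alt hκ hrule hM ih
      generalize b (B x - 1) = bl' at *
      generalize b (B (x + 1) - 1) = bl at *
      generalize b (B (x + 1)) = bn at *
      generalize a (A (x + 1)) = aA at *
      generalize A (x + 1) = p at *
      generalize B (x + 1) = q at *
      generalize κ (x + 1) = k at *
      generalize C (x + 1) = c at *
      generalize A x = p' at *
      generalize B x = q' at *
      generalize κ x = k' at *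
      generalize C x = c' at *
      clear h M
      rcases hA with hA | ⟨hA, hA'⟩ <;> rcases hB with hB | ⟨hB, hB'⟩
      · subst hA hB
        have e := hBx' rfl
        subst e
        split_ifs at hC <;> omega
      · subst hA hB
        have e := hBx rfl
        subst e
        split_ifs at hC <;> omega
      · subst hA hB
        have e := hBx' rfl
        subst e
        split_ifs at hC <;> omega
      · subst hA hB
        have e := hBx rfl
        subst e
        split_ifs at hC <;> omega
    refine ⟨hlast.1, fun k h1 h2 => ?_⟩
    have hlast2 := hlast.2
    rcases hB with hB | ⟨hB, hB'⟩
    · have := alt k (by omega) (by omega)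
      rwa [hB]
    · have hBx := hBx hB
      rw [hBx, hB]
      rcases eq_or_ne k (B (x + 1)) with rfl | hk
      · omega
      · have h3 := alt k (by omega) (by omega)
        have h4 := hlast2 hB (by omega)
        omega

end Traversal

/-- Extension by zero to all integer indices. -/
def extendSeq {l : ℕ} (d : Fin l → ℤ) (k : ℤ) : ℤ :=
  if h : 0 ≤ k ∧ k < l then d ⟨k.toNat, by omega⟩ else 0

theorem extendSeq_val {l : ℕ} (d : Fin l → ℤ) (j : Fin l) : extendSeq d ((j : ℕ) : ℤ) = d j := by
  unfold extendSeq
  rw [dif_pos ⟨by omega, by omega⟩]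
  rfl

theorem IsCount.step {l : ℕ} {d : Fin l → ℤ} {f : ℤ → ℤ} (h : IsCount d f)
    (hd : StrictAnti d) (x : ℤ) : f x = f (x + 1) ∨
      (f x = f (x + 1) + 1 ∧ 0 ≤ f (x + 1) ∧ f (x + 1) < l ∧ extendSeq d (f (x + 1)) = x + 1) := by
  have h1 := h.anti (x + 1)
  have h2 := h.sub_one_le hd (x + 1)
  rw [add_sub_cancel_right] at h1 h2
  have h3 := h.nonneg (x + 1)
  have h4 := h.le x
  by_cases he : f x = f (x + 1)
  · exact Or.inl he
  · have h5 := h.lt_iff ⟨(f (x + 1)).toNat, by omega⟩ x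
    have h6 := h.lt_iff ⟨(f (x + 1)).toNat, by omega⟩ (x + 1)
    refine Or.inr ⟨by omega, h3, by omega, ?_⟩
    unfold extendSeq
    rw [dif_pos ⟨h3, by omega⟩]
    simp only at h5 h6
    omega

theorem IsCount.eq_of_seq {l : ℕ} {d : Fin l → ℤ} {f : ℤ → ℤ} (h : IsCount d f)
    (hd : StrictAnti d) (j : Fin l) {x : ℤ} (hj : d j = x + 1) :
    f x = f (x + 1) + 1 ∧ f (x + 1) = (j : ℕ) := by
  have h1 := h.lt_iff j x
  have h2 := h.lt_iff j (x + 1)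
  have h3 := h.sub_one_le hd (x + 1)
  rw [add_sub_cancel_right] at h3
  omega

section bottom

variable {l : ℕ} {a b : Fin l → ℤ}

theorem traversal (ha : StrictAnti a) (hb : StrictAnti b)
    (hle : ∀ x, cnt (fun j => a j - 1) x ≤ cnt b x) :
    Traversal (extendSeq a) (extendSeq b) (cnt fun j => a j - 1) (cnt b) (kap a b)
      (fun x => (countAbove (fun y => Even (cnt (fun j => a j - 1) y - cnt b y) ∧
        cnt (fun j => a j - 1) y - cnt b y ≠ 0) x : ℤ)) := by
  have ha' : StrictAnti fun j => a j - 1 := fun i j hij => by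
    have := ha hij
    simp only
    omega
  have cA := isCount_cnt ha'
  have cB := isCount_cnt hb
  obtain ⟨M, hM⟩ := exists_kap_eq_zero a b
  obtain ⟨M1, hM1⟩ := exists_fin_bound a
  obtain ⟨M2, hM2⟩ := exists_fin_bound b
  have zA : ∀ x, M1 ≤ x → cnt (fun j => a j - 1) x = 0 := fun x hx => by
    rw [cnt_eq_sum]
    refine Finset.sum_eq_zero fun j _ => if_neg ?_
    have := (abs_le.1 (hM1 j)).2
    omega
  have zB : ∀ x, M2 ≤ x → cnt b x = 0 := fun x hx => by
    rw [cnt_eq_sum]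
    refine Finset.sum_eq_zero fun j _ => if_neg ?_
    have := (abs_le.1 (hM2 j)).2
    omega
  have hQ : ∀ y, max M1 M2 ≤ y → ¬ (Even (cnt (fun j => a j - 1) y - cnt b y) ∧
      cnt (fun j => a j - 1) y - cnt b y ≠ 0) := fun y hy h => by
    rw [zA y (by omega), zB y (by omega)] at h
    exact h.2 rfl
  refine ⟨fun x => ?_, fun x => ?_, kap_rec a b, fun x => ?_, hle, ⟨max M (max M1 M2), ?_⟩⟩
  · rcases cA.step ha' x with h | ⟨h1, h2, h3, h4⟩
    · exact Or.inl h
    · refine Or.inr ⟨h1, ?_⟩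
      unfold extendSeq at h4 ⊢
      rw [dif_pos ⟨h2, h3⟩] at h4 ⊢
      change a _ - 1 = x + 1 at h4
      omega
  · rcases cB.step hb x with h | ⟨h1, h2, h3, h4⟩
    · exact Or.inl h
    · exact Or.inr ⟨h1, h4⟩
  · split_ifs with h
    · rw [countAbove_of_mem hQ (x := x) ⟨Int.even_iff.2 (by omega), by omega⟩]
      push_cast
      ring
    · rw [countAbove_of_not (x := x), add_zero]
      rintro ⟨h1, h2⟩
      rw [Int.even_iff] at h1
      omega
  · intro x hx
    refine ⟨zA x (by omega), zB x (by omega), hM x (by omega), ?_⟩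
    simp only [Nat.cast_eq_zero]
    exact countAbove_eq_zero hQ (by omega)

/-- The conditions on consecutive intervals. -/
structure IsAdjacentSpecial (a b : Fin l → ℤ) : Prop where
  le : ∀ i, a i ≤ b i
  even : ∀ i, Even (b i - a i)
  odd : ∀ i j : Fin l, (j : ℕ) = (i : ℕ) + 1 → a i ≤ b j → Odd (a i - a j)

theorem rule_iff_even {A B : ℤ → ℤ} {C : ℤ → ℤ} :
    (∀ x k, A x - B x = 2 * k - 1 → Even (k + C x)) ↔
      ∀ x, (B x - A x) % 2 = 1 → (C x - (B x - A x) / 2) % 2 = 0 := by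
  constructor
  · intro h x hx
    have := h x ((A x - B x + 1) / 2) (by omega)
    rw [Int.even_iff] at this
    omega
  · intro h x k hk
    have := h x (by omega)
    rw [Int.even_iff]
    omega

/-- The intervals open at `x` have the consecutive indices from `A x` to `B x - 1`, so the adjacent
odd-distance condition says that their right ends alternate in parity. The traversal lemmas
translate this into the bound and the rule, and back. -/
theorem isAdjacentSpecial_iff (ha : StrictAnti a) (hb : StrictAnti b) : IsAdjacentSpecial a b ↔
    (∀ x, cnt (fun j => a j - 1) x ≤ cnt b x) ∧ (∀ x, |kap a b x| ≤ 1) ∧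
    ∀ x k, cnt (fun j => a j - 1) x - cnt b x = 2 * k - 1 →
      Even (k + (countAbove (fun y => Even (cnt (fun j => a j - 1) y - cnt b y) ∧
        cnt (fun j => a j - 1) y - cnt b y ≠ 0) x : ℤ)) := by
  have ha' : StrictAnti fun j => a j - 1 := fun i j hij => by
    have := ha hij
    simp only
    omega
  have cA := isCount_cnt ha'
  have cB := isCount_cnt hb
  constructor
  · intro h
    have hle : ∀ x, cnt (fun j => a j - 1) x ≤ cnt b x := by
      intro x
      rw [cnt_eq_sum, cnt_eq_sum]
      refine Finset.sum_le_sum fun j _ => ?_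
      have := h.le j
      split_ifs <;> omega
    have ht := traversal ha hb hle
    have halt : ∀ x, Alternating (extendSeq b) (cnt fun j => a j - 1) (cnt b) x := by
      intro x
      have key : ∀ d : ℕ, ∀ k, cnt (fun j => a j - 1) x ≤ k → k + d = cnt b x - 1 →
          (extendSeq b k - extendSeq b (cnt b x - 1) - (cnt b x - 1 - k)) % 2 = 0 := by
        intro d
        induction d with
        | zero =>
          intro k _ hk
          rw [show k = cnt b x - 1 by simpa using hk]
          simp
        | succ d ih =>
          intro k h1 h2
          push_cast at h2
          have h3 := ih (k + 1) (by omega) (by omega)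
          have b1 := cA.nonneg x
          have b2 := cB.le x
          obtain ⟨i, hi⟩ : ∃ i : Fin l, ((i : ℕ) : ℤ) = k := ⟨⟨k.toNat, by omega⟩, by simp; omega⟩
          obtain ⟨j, hj⟩ : ∃ j : Fin l, ((j : ℕ) : ℤ) = k + 1 :=
            ⟨⟨(k + 1).toNat, by omega⟩, by simp; omega⟩
          have e1 := cA.lt_iff i x
          have e2 := cB.lt_iff j x
          have e3 := h.odd i j (by omega) (by omega)
          have e4 := h.even i
          have e5 := h.even j
          rw [← hj, extendSeq_val] at h3
          rw [← hi, extendSeq_val]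
          simp only [Int.even_iff, Int.odd_iff] at e3 e4 e5
          omega
      intro k h1 h2
      exact key (cnt b x - 1 - k).toNat k h1 (by omega)
    have hv := ht.values_of_alternating halt fun x hx => by
      rcases cA.step ha' x with e | ⟨-, e1, e2, e3⟩
      · omega
      · set i : Fin l := ⟨(cnt (fun j => a j - 1) (x + 1)).toNat, by omega⟩ with hi
        have hi' : cnt (fun j => a j - 1) (x + 1) = ((i : ℕ) : ℤ) := by simp [hi]; omega
        rw [hi'] at e3 ⊢
        rw [extendSeq_val] at e3
        rw [extendSeq_val, extendSeq_val]
        have h1 := h.le i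
        have h2 := h.even i
        rw [Int.even_iff] at h2
        exact ⟨(cB.lt_iff i (x + 1)).1 (by omega), h2⟩
    refine ⟨hle, fun x => ?_, rule_iff_even.2 fun x hx => ((hv x).2.1 hx).1⟩
    obtain ⟨v1, v2, v3⟩ := hv x
    have := hle x
    rw [abs_le]
    rcases Int.emod_two_eq_zero_or_one (cnt b x - cnt (fun j => a j - 1) x) with hm | hm
    · rcases eq_or_ne (cnt b x - cnt (fun j => a j - 1) x) 0 with h0 | h0
      · rw [(v1 h0).1]
        simp
      · rw [(v3 (by omega) hm).1]
        simp
    · rcases (v2 hm).2 with h0 | h0 <;> omega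
  · rintro ⟨hle, hk, hrule⟩
    have ht := traversal ha hb hle
    have hva := ht.values_and_alternating (fun x => ⟨(abs_le.1 (hk x)).2, (abs_le.1 (hk x)).1⟩)
      (rule_iff_even.1 hrule)
    have hmain : ∀ i, a i ≤ b i ∧ Even (b i - a i) := by
      intro i
      -- The transition from `a i - 1` to `a i - 2` closes interval `i`. The values of `κ` and the
      -- rule there fix the parity of the latest right end, and alternation transfers it to `b i`.
      obtain ⟨e1, e2⟩ := cA.eq_of_seq ha' i (x := a i - 2) (by ring)
      obtain ⟨v, alt⟩ := hva (a i - 2 + 1)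
      have h1 := cB.lt_iff i (a i - 2)
      have h2 := cB.lt_iff i (a i - 2 + 1)
      have h3 := hle (a i - 2)
      have hκ := kap_rec a b (a i - 2)
      have k1 := abs_le.1 (hk (a i - 2))
      have hst := cB.step hb (a i - 2)
      have h4 := hle (a i - 2 + 1)
      have hlt : cnt (fun j => a j - 1) (a i - 2 + 1) < cnt b (a i - 2 + 1) := by
        -- If no interval were open, `A ≤ B` would force a new one to open at the same moment, and
        -- `κ` would jump from `0` to `2`.
        by_contra hcon
        have := v.1 (by omega)
        omega
      have al := alt _ le_rfl hlt
      rw [e2, extendSeq_val] at al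
      refine ⟨by omega, ?_⟩
      rw [Int.even_iff]
      unfold TraversalValues at v
      have hrule' := rule_iff_even.1 hrule (a i - 2)
      have hC := ht.stepC (a i - 2)
      beta_reduce at hC hrule' v
      generalize extendSeq b (cnt b (a i - 2 + 1) - 1) = bl at *
      generalize ((countAbove (fun y => Even (cnt (fun j => a j - 1) y - cnt b y) ∧
        cnt (fun j => a j - 1) y - cnt b y ≠ 0) (a i - 2) : ℕ) : ℤ) = c' at *
      generalize ((countAbove (fun y => Even (cnt (fun j => a j - 1) y - cnt b y) ∧
        cnt (fun j => a j - 1) y - cnt b y ≠ 0) (a i - 2 + 1) : ℕ) : ℤ) = c at *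
      have hst' : cnt b (a i - 2) = cnt b (a i - 2 + 1) ∨
          cnt b (a i - 2) = cnt b (a i - 2 + 1) + 1 := by
        rcases hst with hst | hst
        · exact Or.inl hst
        · exact Or.inr hst.1
      clear hst
      have hk2 := abs_le.1 (hk (a i - 2 + 1))
      clear hk hrule hle ht hva
      generalize cnt (fun j => a j - 1) (a i - 2) = p' at *
      generalize cnt (fun j => a j - 1) (a i - 2 + 1) = p at *
      generalize cnt b (a i - 2) = q' at *
      generalize cnt b (a i - 2 + 1) = q at *
      generalize kap a b (a i - 2) = k' at *
      generalize kap a b (a i - 2 + 1) = k at *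
      clear cA cB alt ha hb ha'
      obtain ⟨v1, v2, v3⟩ := v
      rcases Int.emod_two_eq_zero_or_one (q - p) with hm | hm
      · have w := v3 (by omega) hm
        clear v1 v2 v3
        rw [if_pos ⟨hm, by omega⟩] at hC
        omega
      · have w := v2 hm
        clear v1 v2 v3
        rw [if_neg (by omega)] at hC
        omega
    refine ⟨fun i => (hmain i).1, fun i => (hmain i).2, fun i j hij hab => ?_⟩
    obtain ⟨e1, e2⟩ := cB.eq_of_seq hb j (x := b j - 1) (by ring)
    obtain ⟨v, alt⟩ := hva (b j - 1)
    have h1 := cA.lt_iff i (b j - 1)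
    have h2 := alt ((i : ℕ) : ℤ) (by omega) (by omega)
    rw [e1, e2, add_sub_cancel_right, extendSeq_val, extendSeq_val] at h2
    have h3 := (hmain i).2
    have h4 := (hmain j).2
    simp only [Int.even_iff, Int.odd_iff] at *
    omega

end bottom

/-! ### Components of cells -/

theorem Reached.of_mem {n : ℕ} {T V : Set (ℤ × ℕ)} (hV : ClosedIn n T V) {x : ℤ}
    (hx : (x, 0) ∈ V) {u : ℤ × ℕ} (hu : Reached n T {x} u) : u ∈ V := by
  induction hu with
  | base y hy hT => exact (show y = x from hy) ▸ hx
  | step u v hu hv hn h ih => exact hV.closed u ih v hv hn h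

theorem Reached.symm {n : ℕ} {T : Set (ℤ × ℕ)} {x y : ℤ} (h : Reached n T {x} (y, 0)) :
    Reached n T {y} (x, 0) := by
  have hy : Reached n T {y} (y, 0) := Reached.base y rfl ((closedIn_reached n T {x}).mem _ h)
  have key : ∀ w, Reached n T {x} w → (Reached n T {y} w → Reached n T {y} (x, 0)) := by
    intro w hw
    induction hw with
    | base z hz hT => exact fun h => (show z = x from hz) ▸ h
    | step u v hu hv hn hadj ih =>
      exact fun h' => ih (Reached.step v u h' ((closedIn_reached n T {x}).mem u hu)
        ((closedIn_reached n T {x}).le u hu) hadj.symm)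
  exact key _ h hy

theorem Reached.iff {n : ℕ} {T : Set (ℤ × ℕ)} {x y : ℤ} (h : Reached n T {x} (y, 0))
    (u : ℤ × ℕ) : Reached n T {x} u ↔ Reached n T {y} u :=
  ⟨fun hu => hu.of_mem (closedIn_reached n T {y}) h.symm,
    fun hu => hu.of_mem (closedIn_reached n T {x}) h⟩

/-- A parity condition on the closed sets of cells need only be checked on the components. -/
theorem even_closed_iff {n : ℕ} {T : Set (ℤ × ℕ)} :
    (∀ V, ClosedIn n T V → (∀ u ∈ V, u.2 ≠ n) → Even {x : ℤ | (x, 0) ∈ V}.ncard) ↔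
    ∀ x, (x, 0) ∈ T → (∀ u, Reached n T {x} u → u.2 ≠ n) →
      Even {y : ℤ | Reached n T {x} (y, 0)}.ncard := by
  constructor
  · intro h x _ hn
    exact h _ (closedIn_reached n T {x}) hn
  · intro h V hV hn
    by_cases hfin : {x : ℤ | (x, 0) ∈ V}.Finite
    · classical
      rw [Set.ncard_eq_toFinset_card _ hfin]
      rw [Finset.card_eq_sum_card_image (fun x => {u | Reached n T {x} u})]
      refine Finset.even_sum _ fun Z hZ => ?_
      obtain ⟨x, hx, rfl⟩ := Finset.mem_image.1 hZ
      replace hx : (x, 0) ∈ V := by simpa using hx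
      have hmem : ∀ u, Reached n T {x} u → u ∈ V := fun u hu => hu.of_mem hV hx
      have hev := h x (hV.mem _ hx) fun u hu => hn u (hmem u hu)
      suffices hset : ((Finset.filter (fun y => {u | Reached n T {y} u} = {u | Reached n T {x} u})
          hfin.toFinset : Finset ℤ) : Set ℤ) = {y : ℤ | Reached n T {x} (y, 0)} by
        rwa [← hset, Set.ncard_coe_finset] at hev
      ext y
      simp only [Finset.coe_filter, Set.Finite.mem_toFinset, Set.mem_ofPred_eq]
      constructor
      · rintro ⟨h1, h2⟩
        have : (y, 0) ∈ {u | Reached n T {y} u} := Reached.base y rfl (hV.mem _ h1)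
        rw [h2] at this
        exact this
      · intro h1
        refine ⟨hmem _ h1, ?_⟩
        ext u
        exact (h1.iff u).symm
    · rw [Set.Infinite.ncard hfin]
      exact Even.zero

/-- The parity of a set of integers that is a union of intervals. -/
theorem odd_ncard_iff_of_intervals {W : Set ℤ} (hW : W.Finite) (idx : ℤ → ℕ) (p q : ℕ → ℤ)
    (h : ∀ z ∈ W, ∀ y, (y ∈ W ∧ idx y = idx z) ↔ (p (idx z) ≤ y ∧ y < q (idx z))) :
    Odd W.ncard ↔ Odd {i | (∃ z ∈ W, idx z = i) ∧ Odd (q i - p i)}.ncard := by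
  classical
  rw [Set.ncard_eq_toFinset_card _ hW, Finset.card_eq_sum_card_image idx,
    Finset.odd_sum_iff_odd_card_odd]
  rw [← Set.ncard_coe_finset]
  suffices h' : (↑(Finset.filter (fun i => Odd
      (Finset.filter (fun y => idx y = i) hW.toFinset).card) (Finset.image idx hW.toFinset)) :
      Set ℕ) = {i | (∃ z ∈ W, idx z = i) ∧ Odd (q i - p i)} by rw [h']
  ext i
  simp only [Finset.coe_filter, Finset.mem_image, Set.Finite.mem_toFinset, Set.mem_ofPred_eq]
  refine and_congr_right ?_
  rintro ⟨z, hz, rfl⟩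
  have : Finset.filter (fun y => idx y = idx z) hW.toFinset = Finset.Ico (p (idx z)) (q (idx z)) := by
    ext y
    simp only [Finset.mem_filter, Set.Finite.mem_toFinset, Finset.mem_Ico]
    exact h z hz y
  rw [this, Int.card_Ico]
  have := (h z hz z).1 ⟨hz, rfl⟩
  rw [← Int.odd_coe_nat, Int.toNat_of_nonneg (by omega)]

/-! ### Units and cells -/

/-- The cell on which a unit square of the lower or the upper half plane is folded. -/
def cell (U : ℤ × ℤ) : ℤ × ℕ :=
  if 0 ≤ U.2 then (U.1, U.2.toNat) else (U.1 + U.2, (-U.2 - 1).toNat)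

theorem cell_upper (x : ℤ) (r : ℕ) : cell (x, (r : ℤ)) = (x, r) := by simp [cell]

theorem cell_lower (x : ℤ) (r : ℕ) : cell (x + 1 + r, -(r : ℤ) - 1) = (x, r) := by
  have : ¬ (0 ≤ -(r : ℤ) - 1) := by omega
  simp only [cell, this, if_false, Prod.mk.injEq]
  omega

theorem eq_of_cell {U : ℤ × ℤ} {x : ℤ} {r : ℕ} (h : cell U = (x, r)) :
    U = (x, (r : ℤ)) ∨ U = (x + 1 + r, -(r : ℤ) - 1) := by
  obtain ⟨u, v⟩ := U
  unfold cell at h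
  split_ifs at h with h0
  · simp only [Prod.mk.injEq] at h h0 ⊢
    omega
  · simp only [Prod.mk.injEq] at h h0 ⊢
    omega

theorem adjacent_iff (U U' : ℤ × ℤ) : Adjacent U U' ↔
    (U'.2 = U.2 ∧ (U'.1 = U.1 ∨ U'.1 = U.1 - 1 ∨ U'.1 = U.1 + 1)) ∨
    (U'.2 = U.2 + 1 ∧ (U'.1 = U.1 ∨ U'.1 = U.1 - 1)) ∨
    (U'.2 = U.2 - 1 ∧ (U'.1 = U.1 ∨ U'.1 = U.1 + 1)) := by
  simp only [Adjacent, vertices, Set.mem_insert_iff, Set.mem_singleton_iff, Prod.mk.injEq]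
  omega

theorem cellAdj_of_adjacent {U U' : ℤ × ℤ} (h : Adjacent U U') :
    cell U = cell U' ∨ CellAdj (cell U) (cell U') := by
  rw [adjacent_iff] at h
  obtain ⟨x, y⟩ := U
  obtain ⟨x', y'⟩ := U'
  simp only at h
  unfold cell CellAdj
  simp only
  split_ifs <;> simp only [Prod.mk.injEq] <;> omega

theorem adjacent_upper {u v : ℤ × ℕ} (h : CellAdj u v) :
    Adjacent (u.1, (u.2 : ℤ)) (v.1, (v.2 : ℤ)) := by
  rw [adjacent_iff]
  unfold CellAdj at h
  simp only
  omega

theorem adjacent_lower {u v : ℤ × ℕ} (h : CellAdj u v) :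
    Adjacent (u.1 + 1 + u.2, -(u.2 : ℤ) - 1) (v.1 + 1 + v.2, -(v.2 : ℤ) - 1) := by
  rw [adjacent_iff]
  unfold CellAdj at h
  simp only
  omega

/-- The units that lie on the cells of `T`. -/
def unitsOf (n : ℕ) (T : Set (ℤ × ℕ)) : Set (ℤ × ℤ) := {U | (cell U).2 ≤ n ∧ cell U ∈ T}

/-- Folding respects adjacency, and a path of cells lifts to either half plane. At height `0` the
two units on one cell are themselves adjacent, so a component that meets height `0` contains both
lifts of each of its cells. -/
theorem eqvGen_iff {n : ℕ} {T : Set (ℤ × ℕ)} {x : ℤ} {U : unitsOf n T} (hU : cell U.1 = (x, 0))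
    (W : unitsOf n T) : Relation.EqvGen (fun A B : unitsOf n T => Adjacent A.1 B.1) U W ↔
      Reached n T {x} (cell W.1) := by
  have hxT : (x, 0) ∈ T := hU ▸ U.2.2
  constructor
  · intro h
    have key : ∀ A B : unitsOf n T, Relation.EqvGen (fun A B : unitsOf n T => Adjacent A.1 B.1) A B →
        (Reached n T {x} (cell A.1) ↔ Reached n T {x} (cell B.1)) := by
      intro A B hAB
      induction hAB with
      | rel A B hAB =>
        rcases cellAdj_of_adjacent hAB with h | h
        · rw [h]
        · exact ⟨fun h' => Reached.step _ _ h' B.2.2 B.2.1 h,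
            fun h' => Reached.step _ _ h' A.2.2 A.2.1 h.symm⟩
      | refl A => exact Iff.rfl
      | symm A B _ ih => exact ih.symm
      | trans A B C _ _ ih1 ih2 => exact ih1.trans ih2
    refine (key U W h).1 ?_
    rw [hU]
    exact Reached.base x rfl hxT
  · intro h
    have key : ∀ w, Reached n T {x} w → ∀ W : unitsOf n T, cell W.1 = w →
        Relation.EqvGen (fun A B : unitsOf n T => Adjacent A.1 B.1) U W := by
      intro w hw
      induction hw with
      | base y hy hT =>
        intro W hW
        obtain rfl : y = x := hy
        refine Relation.EqvGen.rel _ _ ?_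
        rw [adjacent_iff]
        have e1 := eq_of_cell hU
        have e2 := eq_of_cell hW
        simp only [Prod.ext_iff, Nat.cast_zero] at e1 e2
        omega
      | step u v hu hv hn hadj ih =>
        intro W hW
        have huT : u ∈ T := (closedIn_reached n T {x}).mem u hu
        have hun : u.2 ≤ n := (closedIn_reached n T {x}).le u hu
        rcases eq_of_cell (x := v.1) (r := v.2) hW with e | e
        · have hc : cell (u.1, (u.2 : ℤ)) = u := cell_upper _ _
          refine Relation.EqvGen.trans _ _ _ (ih ⟨(u.1, (u.2 : ℤ)), ?_, ?_⟩ hc)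
            (Relation.EqvGen.rel _ _ ?_)
          · rwa [hc]
          · rwa [hc]
          · rw [e]
            exact adjacent_upper hadj
        · have hc : cell (u.1 + 1 + u.2, -(u.2 : ℤ) - 1) = u := cell_lower _ _
          refine Relation.EqvGen.trans _ _ _ (ih ⟨(u.1 + 1 + u.2, -(u.2 : ℤ) - 1), ?_, ?_⟩ hc)
            (Relation.EqvGen.rel _ _ ?_)
          · rwa [hc]
          · rwa [hc]
          · rw [e]
            exact adjacent_lower hadj
    exact key _ h W rfl

theorem heightZero_iff (U : ℤ × ℤ) : HeightZero U ↔ (cell U).2 = 0 := by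
  unfold HeightZero cell
  split_ifs <;> simp only <;> omega

/-- The components of a set of units that contain a unit of height zero. -/
theorem isComponent_iff {n : ℕ} {T : Set (ℤ × ℕ)} {V : Set (ℤ × ℤ)} :
    (IsComponent (unitsOf n T) V ∧ ∃ U ∈ V, HeightZero U) ↔
      ∃ x, (x, 0) ∈ T ∧ V = {W | Reached n T {x} (cell W)} := by
  constructor
  · rintro ⟨⟨U, rfl⟩, W, ⟨hW, hUW⟩, h0⟩
    rw [heightZero_iff] at h0
    have hc : cell W = ((cell W).1, 0) := by rw [← h0]
    refine ⟨(cell W).1, hc ▸ hW.2, ?_⟩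
    ext Z
    constructor
    · rintro ⟨hZ, hUZ⟩
      exact (eqvGen_iff (U := ⟨W, hW⟩) hc ⟨Z, hZ⟩).1
        (Relation.EqvGen.trans _ _ _ (Relation.EqvGen.symm _ _ hUW) hUZ)
    · intro hZ
      have hZ' : Z ∈ unitsOf n T := ⟨(closedIn_reached n T _).le _ hZ,
        (closedIn_reached n T _).mem _ hZ⟩
      exact ⟨hZ', Relation.EqvGen.trans _ _ _ hUW
        ((eqvGen_iff (U := ⟨W, hW⟩) hc ⟨Z, hZ'⟩).2 hZ)⟩
  · rintro ⟨x, hx, rfl⟩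
    have hc : cell (x, ((0 : ℕ) : ℤ)) = (x, 0) := cell_upper x 0
    have hU : (x, ((0 : ℕ) : ℤ)) ∈ unitsOf n T := ⟨by rw [hc]; exact Nat.zero_le _, by rwa [hc]⟩
    refine ⟨⟨⟨_, hU⟩, ?_⟩, (x, ((0 : ℕ) : ℤ)), ?_, Or.inl rfl⟩
    · ext Z
      constructor
      · intro hZ
        have hZ' : Z ∈ unitsOf n T := ⟨(closedIn_reached n T _).le _ hZ,
          (closedIn_reached n T _).mem _ hZ⟩
        exact ⟨hZ', (eqvGen_iff (U := ⟨_, hU⟩) hc ⟨Z, hZ'⟩).2 hZ⟩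
      · rintro ⟨hZ, h⟩
        exact (eqvGen_iff (U := ⟨_, hU⟩) hc ⟨Z, hZ⟩).1 h
    · change Reached n T {x} (cell _)
      rw [hc]
      exact Reached.base x rfl hx

/-! ### Units in terms of the counting functions -/

namespace IsPattern

variable {l n : ℕ} {c : PathPair l}

theorem lower_bounds (h : IsPattern c) (x : ℤ) (r : ℕ) :
    (r : ℤ) ≤ c.heights.A x r ∧ c.heights.A x r ≤ l + r := by
  have h1 := (h.isCount_lower r).nonneg x
  have h2 := (h.isCount_lower r).le x
  omega

theorem upper_bounds (h : IsPattern c) (x : ℤ) (r : ℕ) :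
    0 ≤ c.heights.B x r ∧ c.heights.B x r ≤ l :=
  ⟨(h.isCount_upper r).nonneg x, (h.isCount_upper r).le x⟩

theorem alphaDual_le_iff (h : IsPattern c) {i r : ℕ} (hi : i ≤ l) (x : ℤ) :
    c.alphaDual i r ≤ (x : WithTop ℤ) ↔ c.heights.A x r < i := by
  have hb := h.lower_bounds x r
  unfold PathPair.alphaDual
  split_ifs with h0
  · have := (h.isCount_lower r).lt_iff ⟨i - r - 1, by omega⟩ x
    simp only at this
    rw [WithTop.coe_le_coe]
    omega
  · simp only [top_le_iff, WithTop.coe_ne_top, false_iff]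
    omega

theorem le_alphaDual_iff (h : IsPattern c) {i r : ℕ} (hi : i ≤ l) (x : ℤ) :
    ((x + 1 : ℤ) : WithTop ℤ) ≤ c.alphaDual i r ↔ i ≤ c.heights.A x r := by
  have hb := h.lower_bounds x r
  unfold PathPair.alphaDual
  split_ifs with h0
  · have := (h.isCount_lower r).lt_iff ⟨i - r - 1, by omega⟩ x
    simp only at this
    rw [WithTop.coe_le_coe]
    omega
  · simp only [le_top, true_iff]
    omega

theorem beta_le_iff (h : IsPattern c) {i r : ℕ} (hi : i ≤ l) (x : ℤ) :
    c.beta (i + 1) r ≤ (x : WithBot ℤ) ↔ c.heights.B x r ≤ i := by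
  have hb := h.upper_bounds x r
  unfold PathPair.beta
  split_ifs with h0
  · have := (h.isCount_upper r).lt_iff ⟨i + 1 - 1, by omega⟩ x
    simp only at this
    rw [WithBot.coe_le_coe]
    omega
  · simp only [bot_le, true_iff]
    omega

theorem le_beta_iff (h : IsPattern c) {i r : ℕ} (hi : i ≤ l) (x : ℤ) :
    ((x + 1 : ℤ) : WithBot ℤ) ≤ c.beta (i + 1) r ↔ i < c.heights.B x r := by
  have hb := h.upper_bounds x r
  unfold PathPair.beta
  split_ifs with h0
  · have := (h.isCount_upper r).lt_iff ⟨i + 1 - 1, by omega⟩ x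
    simp only at this
    rw [WithBot.coe_le_coe]
    omega
  · simp only [le_bot_iff, WithBot.coe_ne_bot, false_iff]
    omega

theorem alpha_le_iff (h : IsPattern c) {i r : ℕ} (hi : i ≤ l) (x : ℤ) :
    c.alpha i r ≤ ((x + 1 + r : ℤ) : WithTop ℤ) ↔ c.heights.A x r < i + r := by
  have hb := h.lower_bounds x r
  unfold PathPair.alpha
  split_ifs with h0
  · have := (h.isCount_lower r).lt_iff ⟨i - 1, by omega⟩ x
    simp only at this
    rw [WithTop.coe_le_coe]
    omega
  · simp only [top_le_iff, WithTop.coe_ne_top, false_iff]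
    omega

theorem le_alpha_iff (h : IsPattern c) {i r : ℕ} (hi : i ≤ l) (x : ℤ) :
    ((x + 1 + r + 1 : ℤ) : WithTop ℤ) ≤ c.alpha i r ↔ i + r ≤ c.heights.A x r := by
  have hb := h.lower_bounds x r
  unfold PathPair.alpha
  split_ifs with h0
  · have := (h.isCount_lower r).lt_iff ⟨i - 1, by omega⟩ x
    simp only at this
    rw [WithTop.coe_le_coe]
    omega
  · simp only [le_top, true_iff]
    omega

theorem betaDual_le_iff (h : IsPattern c) {i r : ℕ} (x : ℤ) :
    c.betaDual (i + 1) r ≤ ((x + 1 + r : ℤ) : WithBot ℤ) ↔ c.heights.B x r ≤ i + r := by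
  have hb := h.upper_bounds x r
  unfold PathPair.betaDual
  split_ifs with h0
  · have := (h.isCount_upper r).lt_iff ⟨i + 1 + r - 1, by omega⟩ x
    simp only at this
    rw [WithBot.coe_le_coe]
    omega
  · simp only [bot_le, true_iff]
    omega

theorem le_betaDual_iff (h : IsPattern c) {i r : ℕ} (x : ℤ) :
    ((x + 1 + r + 1 : ℤ) : WithBot ℤ) ≤ c.betaDual (i + 1) r ↔ i + r < c.heights.B x r := by
  have hb := h.upper_bounds x r
  unfold PathPair.betaDual
  split_ifs with h0
  · have := (h.isCount_upper r).lt_iff ⟨i + 1 + r - 1, by omega⟩ x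
    simp only at this
    rw [WithBot.coe_le_coe]
    omega
  · simp only [le_bot_iff, WithBot.coe_ne_bot, false_iff]
    omega

theorem upperI_iff (h : IsPattern c) {i r : ℕ} (hi : i ≤ l) (x : ℤ) :
    c.UpperI i r x ↔ c.heights.A x r < i ∧ i < c.heights.B x r :=
  and_congr (h.alphaDual_le_iff hi x) (h.le_beta_iff hi x)

theorem upperII_iff (h : IsPattern c) {i r : ℕ} (hi : i ≤ l) (x : ℤ) :
    c.UpperII i r x ↔ c.heights.B x r ≤ i ∧ i ≤ c.heights.A x r :=
  and_congr (h.beta_le_iff hi x) (h.le_alphaDual_iff hi x)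

theorem lowerI_iff (h : IsPattern c) {i r : ℕ} (hi : i ≤ l) (x : ℤ) :
    c.LowerI i r (x + 1 + r) ↔ c.heights.A x r < i + r ∧ i + r < c.heights.B x r :=
  and_congr (h.alpha_le_iff hi x) (h.le_betaDual_iff x)

theorem lowerII_iff (h : IsPattern c) {i r : ℕ} (hi : i ≤ l) (x : ℤ) :
    c.LowerII i r (x + 1 + r) ↔ c.heights.B x r ≤ i + r ∧ i + r ≤ c.heights.A x r :=
  and_congr (h.betaDual_le_iff x) (h.le_alpha_iff hi x)

theorem unitI_iff (h : IsPattern c) (U : ℤ × ℤ) :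
    c.UnitI n U ↔ U ∈ unitsOf n (c.heights.sub (-2)) := by
  have hsub : ∀ x r, (x, r) ∈ c.heights.sub (-2) ↔ c.heights.A x r + 2 ≤ c.heights.B x r := by
    intro x r
    change c.heights.A x r - c.heights.B x r ≤ -2 ↔ _
    omega
  constructor
  · rintro ⟨i, r, hi, hr, ⟨h1, h2⟩ | ⟨h1, h2⟩⟩
    · have hU : U = (U.1, (r : ℤ)) := Prod.ext rfl h1
      rw [h.upperI_iff hi] at h2
      rw [hU, unitsOf, Set.mem_ofPred_eq, cell_upper, hsub]
      exact ⟨hr, by omega⟩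
    · have hU : U = ((U.1 - 1 - r) + 1 + r, -(r : ℤ) - 1) := Prod.ext (by ring) h1
      rw [show U.1 = (U.1 - 1 - r) + 1 + r by ring, h.lowerI_iff hi] at h2
      rw [hU, unitsOf, Set.mem_ofPred_eq, cell_lower, hsub]
      exact ⟨hr, by omega⟩
  · rintro ⟨h1, h2⟩
    obtain ⟨⟨x, r⟩, hc⟩ : ∃ u, cell U = u := ⟨_, rfl⟩
    rw [hc] at h1 h2
    simp only at h1
    rw [hsub] at h2
    have b1 := h.lower_bounds x r
    have b2 := h.upper_bounds x r
    rcases eq_of_cell hc with rfl | rfl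
    -- An index strictly between `A` and `B` exists iff `B ≥ A + 2`; the smallest one is used.
    · refine ⟨(c.heights.A x r + 1).toNat, r, by omega, h1, Or.inl ⟨rfl, ?_⟩⟩
      rw [h.upperI_iff (by omega)]
      simp only
      omega
    · refine ⟨(c.heights.A x r + 1 - r).toNat, r, by omega, h1, Or.inr ⟨rfl, ?_⟩⟩
      rw [h.lowerI_iff (by omega)]
      omega

theorem mem_sup_zero {x : ℤ} {r : ℕ} :
    (x, r) ∈ c.heights.sup 0 ↔ c.heights.B x r ≤ c.heights.A x r := by
  change 0 ≤ c.heights.A x r - c.heights.B x r ↔ _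
  omega

theorem unitII_iff (h : IsPattern c) (U : ℤ × ℤ) :
    c.UnitII n U ↔ U ∈ unitsOf n (c.heights.sup 0) := by
  constructor
  · rintro ⟨i, r, hi, hr, ⟨h1, h2⟩ | ⟨h1, h2⟩⟩
    · have hU : U = (U.1, (r : ℤ)) := Prod.ext rfl h1
      rw [h.upperII_iff hi] at h2
      rw [hU, unitsOf, Set.mem_ofPred_eq, cell_upper, mem_sup_zero]
      exact ⟨hr, by omega⟩
    · have hU : U = ((U.1 - 1 - r) + 1 + r, -(r : ℤ) - 1) := Prod.ext (by ring) h1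
      rw [show U.1 = (U.1 - 1 - r) + 1 + r by ring, h.lowerII_iff hi] at h2
      rw [hU, unitsOf, Set.mem_ofPred_eq, cell_lower, mem_sup_zero]
      exact ⟨hr, by omega⟩
  · rintro ⟨h1, h2⟩
    obtain ⟨⟨x, r⟩, hc⟩ : ∃ u, cell U = u := ⟨_, rfl⟩
    rw [hc] at h1 h2
    simp only at h1
    rw [mem_sup_zero] at h2
    have b1 := h.lower_bounds x r
    have b2 := h.upper_bounds x r
    rcases eq_of_cell hc with rfl | rfl
    · refine ⟨(c.heights.B x r).toNat, r, by omega, h1, Or.inl ⟨rfl, ?_⟩⟩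
      rw [h.upperII_iff (by omega)]
      simp only
      omega
    · refine ⟨(c.heights.A x r - r).toNat, r, by omega, h1, Or.inr ⟨rfl, ?_⟩⟩
      rw [h.lowerII_iff (by omega)]
      omega

/-- An index for a II-unit ranges over the integers from `B` to `A`, truncated to the allowed
indices. Only the extreme choices matter for the boundary conditions, and they give the same
condition for upper and for lower units. -/
theorem boundaryUnitII_iff (h : IsPattern c) {U : ℤ × ℤ} {x : ℤ} {r : ℕ} (hc : cell U = (x, r)) :
    c.BoundaryUnitII n U ↔ r ≤ n ∧ c.heights.B x r ≤ c.heights.A x r ∧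
      (c.heights.B x r ≤ r ∨ l ≤ c.heights.A x r ∨ r = n) := by
  have b1 := h.lower_bounds x r
  have b2 := h.upper_bounds x r
  constructor
  · rintro ⟨i, q, hi, hq, ⟨h1, h2, h3⟩ | ⟨h1, h2, h3⟩⟩
    · have hU : U = (U.1, (q : ℤ)) := Prod.ext rfl h1
      rw [hU, cell_upper, Prod.mk.injEq] at hc
      obtain ⟨rfl, rfl⟩ := hc
      rw [h.upperII_iff hi] at h2
      omega
    · have hU : U = ((U.1 - 1 - q) + 1 + q, -(q : ℤ) - 1) := Prod.ext (by ring) h1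
      rw [hU, cell_lower, Prod.mk.injEq] at hc
      rw [show U.1 = (U.1 - 1 - q) + 1 + q by ring, h.lowerII_iff hi] at h2
      obtain ⟨rfl, rfl⟩ := hc
      omega
  · rintro ⟨h1, h2, h3⟩
    rcases eq_of_cell hc with rfl | rfl
    · by_cases hA : (l : ℤ) ≤ c.heights.A x r
      · refine ⟨l, r, le_rfl, h1, Or.inl ⟨rfl, ?_, by omega⟩⟩
        rw [h.upperII_iff le_rfl]
        simp only
        omega
      · refine ⟨(c.heights.B x r).toNat, r, by omega, h1, Or.inl ⟨rfl, ?_, by omega⟩⟩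
        rw [h.upperII_iff (by omega)]
        simp only
        omega
    · by_cases hB : c.heights.B x r ≤ r
      · refine ⟨0, r, Nat.zero_le _, h1, Or.inr ⟨rfl, ?_, by omega⟩⟩
        rw [h.lowerII_iff (Nat.zero_le _)]
        push_cast
        omega
      · refine ⟨(c.heights.A x r - r).toNat, r, by omega, h1, Or.inr ⟨rfl, ?_, by omega⟩⟩
        rw [h.lowerII_iff (by omega)]
        omega

/-- A boundary II-unit is connected with the top row. -/
theorem exists_top_of_boundary (h : IsPattern c) {x₀ : ℤ} {x : ℤ} {r : ℕ}
    (hr : Reached n (c.heights.sup 0) {x₀} (x, r)) (hb : c.heights.B x r ≤ r ∨ l ≤ c.heights.A x r) :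
    ∃ y, Reached n (c.heights.sup 0) {x₀} (y, n) := by
  have hcl := closedIn_reached n (c.heights.sup 0) {x₀}
  have hrn : r ≤ n := hcl.le _ hr
  obtain ⟨k, rfl⟩ := Nat.exists_eq_add_of_le hrn
  induction k generalizing x r with
  | zero => exact ⟨x, hr⟩
  | succ k ih =>
    have hadd : r + (k + 1) = r + 1 + k := by omega
    rcases hb with hb | hb
    · have h1 := h.profile_upper.up_le x r
      have h2 := h.lower_bounds (x - 1) (r + 1)
      have hstep : Reached (r + (k + 1)) (c.heights.sup 0) {x₀} (x - 1, r + 1) := by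
        refine Reached.step (x, r) (x - 1, r + 1) hr ?_ (by simp) (by simp [CellAdj])
        rw [mem_sup_zero]
        push_cast at h2
        omega
      rw [hadd] at hstep hcl ⊢
      exact ih (Or.inl (by push_cast; omega)) hstep hcl (by omega)
    -- Going straight up keeps `A ≥ l`, and `B ≤ l` always holds.
    · have h1 := h.profile_lower.up_ge x r
      have h2 := h.upper_bounds x (r + 1)
      have hstep : Reached (r + (k + 1)) (c.heights.sup 0) {x₀} (x, r + 1) := by
        refine Reached.step (x, r) (x, r + 1) hr ?_ (by simp) (by simp [CellAdj])
        rw [mem_sup_zero]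
        omega
      rw [hadd] at hstep hcl ⊢
      exact ih (Or.inr (by omega)) hstep hcl (by omega)

end IsPattern

/-! ### Odd regions in terms of cells on row `0` -/

/-- Cells of height zero on an interval inside `T` are connected. -/
theorem Reached.interval {n : ℕ} {T : Set (ℤ × ℕ)} {x₀ z p q : ℤ} (hz : Reached n T {x₀} (z, 0))
    (hpz : p ≤ z) (hzq : z < q) (hT : ∀ y, p ≤ y → y < q → (y, 0) ∈ T) {y : ℤ} (hpy : p ≤ y)
    (hyq : y < q) : Reached n T {x₀} (y, 0) := by
  have up : ∀ k : ℕ, z + k < q → Reached n T {x₀} (z + k, 0) := by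
    intro k
    induction k with
    | zero => intro _; simpa using hz
    | succ k ih =>
      intro hk
      push_cast at hk
      refine Reached.step (z + k, 0) _ (ih (by omega)) (hT _ (by push_cast; omega)
        (by push_cast; omega)) (Nat.zero_le _) ?_
      exact Or.inl ⟨rfl, Or.inl (by push_cast; ring)⟩
  have down : ∀ k : ℕ, p ≤ z - k → Reached n T {x₀} (z - k, 0) := by
    intro k
    induction k with
    | zero => intro _; simpa using hz
    | succ k ih =>
      intro hk
      push_cast at hk
      refine Reached.step (z - k, 0) _ (ih (by omega)) (hT _ (by push_cast; omega)
        (by push_cast; omega)) (Nat.zero_le _) ?_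
      exact Or.inl ⟨rfl, Or.inr (by push_cast; ring)⟩
  rcases le_total z y with h | h
  · have := up (y - z).toNat (by omega)
    rwa [show z + ((y - z).toNat : ℤ) = y by omega] at this
  · have := down (z - y).toNat (by omega)
    rwa [show z - ((z - y).toNat : ℤ) = y by omega] at this

namespace PathPair

variable {l n : ℕ} (c : PathPair l)

theorem alpha_eq_coe_iff (i r : ℕ) (x : ℤ) : c.alpha i r = (x : WithTop ℤ) ↔
    ∃ h : 1 ≤ i ∧ i ≤ l, c.lower ⟨i - 1, by omega⟩ r = x := by
  unfold alpha
  split_ifs with h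
  · rw [WithTop.coe_inj]
    exact ⟨fun h' => ⟨h, h'⟩, fun ⟨_, h'⟩ => h'⟩
  · simp only [WithTop.top_ne_coe, h, false_iff, not_exists]
    exact fun h' => absurd h' id

theorem beta_eq_coe_iff (i r : ℕ) (x : ℤ) : c.beta (i + 1) r = (x : WithBot ℤ) ↔
    ∃ h : i < l, c.upper ⟨i, h⟩ r = x := by
  unfold beta
  split_ifs with h
  · rw [WithBot.coe_inj]
    exact ⟨fun h' => ⟨by omega, h'⟩, fun ⟨_, h'⟩ => h'⟩
  · simp only [WithBot.bot_ne_coe, false_iff, not_exists]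
    intro h'
    omega

end PathPair

namespace IsPattern

variable {l n : ℕ} {c : PathPair l}

/-- The index of the overlap in which a cell of height zero lies, for the overlaps in a component. -/
theorem odd_overlaps_iff (h : IsPattern c) (h2 : ∀ x, -2 ≤ c.heights.N x 0) {x : ℤ}
    (hfin : {y : ℤ | Reached n (c.heights.sub (-2)) {x} (y, 0)}.Finite) :
    Odd (c.evenOverlaps {W | Reached n (c.heights.sub (-2)) {x} (cell W)}).ncard ↔
      Odd {y : ℤ | Reached n (c.heights.sub (-2)) {x} (y, 0)}.ncard := by
  have hlow : ∀ (i : ℕ) (hi : i < l) (y : ℤ), y < c.lower ⟨i, hi⟩ 0 - 1 ↔ i < c.heights.A y 0 := by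
    intro i hi y
    have := (h.isCount_lower 0).lt_iff ⟨i, hi⟩ y
    simp only [Nat.cast_zero, sub_zero] at this
    exact this
  have hup : ∀ (i : ℕ) (hi : i < l) (y : ℤ), y < c.upper ⟨i, hi⟩ 0 ↔ i < c.heights.B y 0 :=
    fun i hi y => (h.isCount_upper 0).lt_iff ⟨i, hi⟩ y
  have hmem : ∀ y, (y, 0) ∈ c.heights.sub (-2) ↔ c.heights.A y 0 + 2 ≤ c.heights.B y 0 := by
    intro y
    change c.heights.A y 0 - c.heights.B y 0 ≤ -2 ↔ _
    omega
  have hT : ∀ y, Reached n (c.heights.sub (-2)) {x} (y, 0) →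
      c.heights.A y 0 + 2 = c.heights.B y 0 := by
    intro y hy
    have h3 := (hmem y).1 ((closedIn_reached n _ _).mem _ hy)
    have h4 := h2 y
    unfold Heights.N at h4
    omega
  -- On row `0` overlap `i` fills the cells from `α_i(0) - 1` to `β_{i+1}(0) - 1`. Their number is
  -- `1 - h_i`, which is odd iff the overlap is even.
  set p : ℕ → ℤ := fun i => if h : 1 ≤ i ∧ i ≤ l then c.lower ⟨i - 1, by omega⟩ 0 - 1 else 0 with hp
  set q : ℕ → ℤ := fun i => if h : i < l then c.upper ⟨i, h⟩ 0 else 0 with hq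
  rw [odd_ncard_iff_of_intervals hfin (fun y => (c.heights.A y 0 + 1).toNat) p q]
  · suffices hset : c.evenOverlaps {W | Reached n (c.heights.sub (-2)) {x} (cell W)} =
        {i | (∃ z ∈ {y : ℤ | Reached n (c.heights.sub (-2)) {x} (y, 0)},
          (c.heights.A z 0 + 1).toNat = i) ∧ Odd (q i - p i)} by rw [hset]
    ext i
    constructor
    · rintro ⟨a, b, ha, hb, hab, he, U, hU, hU'⟩
      obtain ⟨hi, ha⟩ := (c.alpha_eq_coe_iff i 0 a).1 ha
      obtain ⟨hil, hb⟩ := (c.beta_eq_coe_iff i 0 b).1 hb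
      have hpi : p i = a - 1 := by rw [hp]; simp only; rw [dif_pos hi, ha]
      have hqi : q i = b := by rw [hq]; simp only; rw [dif_pos hil, hb]
      have hodd : Odd (q i - p i) := by
        rw [hpi, hqi]
        rw [Int.even_iff] at he
        rw [Int.odd_iff]
        omega
      rcases hU' with ⟨h0, h3⟩ | ⟨h0, h3⟩
      · have hc : cell U = (U.1, 0) := by
          rw [show U = (U.1, ((0 : ℕ) : ℤ)) from Prod.ext rfl h0, cell_upper]
        replace hU : Reached n (c.heights.sub (-2)) {x} (cell U) := hU
        rw [hc] at hU
        rw [h.upperI_iff hi.2] at h3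
        have := hT _ hU
        exact ⟨⟨U.1, hU, by omega⟩, hodd⟩
      · have e : U = (U.1 - 1 + 1 + ((0 : ℕ) : ℤ), -((0 : ℕ) : ℤ) - 1) :=
          Prod.ext (by simp) (by simp [h0])
        have hc : cell U = (U.1 - 1, 0) := by
          rw [e, cell_lower]
          simp
        replace hU : Reached n (c.heights.sub (-2)) {x} (cell U) := hU
        rw [hc] at hU
        rw [show U.1 = U.1 - 1 + 1 + ((0 : ℕ) : ℤ) by simp, h.lowerI_iff hi.2] at h3
        have := hT _ hU
        exact ⟨⟨U.1 - 1, hU, by omega⟩, hodd⟩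
    · rintro ⟨⟨z, hz, hzi⟩, hodd⟩
      replace hz : Reached n (c.heights.sub (-2)) {x} (z, 0) := hz
      have h3 := hT z hz
      have b1 := h.lower_bounds z 0
      have b2 := h.upper_bounds z 0
      have hi : 1 ≤ i ∧ i ≤ l := by omega
      have hil : i < l := by omega
      have e1 := hlow (i - 1) (by omega) z
      have e2 := hup i hil z
      rw [hp, hq] at hodd
      simp only at hodd
      rw [dif_pos hi, dif_pos hil, Int.odd_iff] at hodd
      refine ⟨_, _, (c.alpha_eq_coe_iff i 0 _).2 ⟨hi, rfl⟩, (c.beta_eq_coe_iff i 0 _).2 ⟨hil, rfl⟩,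
        by omega, ?_, (z, ((0 : ℕ) : ℤ)), ?_, Or.inl ⟨rfl, ?_⟩⟩
      · rw [Int.even_iff]
        omega
      · change Reached n (c.heights.sub (-2)) {x} (cell _)
        rwa [cell_upper]
      · rw [h.upperI_iff hi.2]
        simp only
        omega
  · intro z hz y
    replace hz : Reached n (c.heights.sub (-2)) {x} (z, 0) := hz
    have h3 := hT z hz
    have b1 := h.lower_bounds z 0
    have b2 := h.upper_bounds z 0
    set i := (c.heights.A z 0 + 1).toNat with hi'
    have hi : 1 ≤ i ∧ i ≤ l := by omega
    have hil : i < l := by omega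
    have hpi : p i = c.lower ⟨i - 1, by omega⟩ 0 - 1 := by rw [hp]; simp only; rw [dif_pos hi]
    have hqi : q i = c.upper ⟨i, hil⟩ 0 := by rw [hq]; simp only; rw [dif_pos hil]
    have e1 := hlow (i - 1) (by omega)
    have e2 := hup i hil
    rw [hpi, hqi]
    have key : ∀ y, c.lower ⟨i - 1, by omega⟩ 0 - 1 ≤ y → y < c.upper ⟨i, hil⟩ 0 →
        c.heights.A y 0 + 1 = i ∧ (y, 0) ∈ c.heights.sub (-2) := by
      intro y h5 h6
      have e1' := e1 y
      have e2' := e2 y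
      have h7 := h2 y
      rw [hmem]
      unfold Heights.N at h7
      omega
    constructor
    · rintro ⟨hy, hyi⟩
      have h4 := hT y hy
      have e1' := e1 y
      have e2' := e2 y
      have b3 := h.lower_bounds y 0
      omega
    · rintro ⟨h5, h6⟩
      have e1' := e1 z
      have e2' := e2 z
      have := (key y h5 h6).1
      exact ⟨hz.interval (by omega) (by omega) (fun y h7 h8 => (key y h7 h8).2) h5 h6, by omega⟩

/-- Hole `i` fills `h_i - 1` cells of row `0`, an odd number iff the hole is even. The bounds in
`hin` make sure that both `α_i` and `β_{i+1}` are finite. -/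
theorem odd_holes_iff (h : IsPattern c) (h0 : ∀ x, c.heights.N x 0 ≤ 0) {x : ℤ}
    (hin : ∀ y, Reached n (c.heights.sup 0) {x} (y, 0) →
      0 < c.heights.B y 0 ∧ c.heights.A y 0 < l)
    (hfin : {y : ℤ | Reached n (c.heights.sup 0) {x} (y, 0)}.Finite) :
    Odd (c.evenHoles {W | Reached n (c.heights.sup 0) {x} (cell W)}).ncard ↔
      Odd {y : ℤ | Reached n (c.heights.sup 0) {x} (y, 0)}.ncard := by
  have hlow : ∀ (i : ℕ) (hi : i < l) (y : ℤ), y < c.lower ⟨i, hi⟩ 0 - 1 ↔ i < c.heights.A y 0 := by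
    intro i hi y
    have := (h.isCount_lower 0).lt_iff ⟨i, hi⟩ y
    simp only [Nat.cast_zero, sub_zero] at this
    exact this
  have hup : ∀ (i : ℕ) (hi : i < l) (y : ℤ), y < c.upper ⟨i, hi⟩ 0 ↔ i < c.heights.B y 0 :=
    fun i hi y => (h.isCount_upper 0).lt_iff ⟨i, hi⟩ y
  have hT : ∀ y, Reached n (c.heights.sup 0) {x} (y, 0) →
      c.heights.A y 0 = c.heights.B y 0 := by
    intro y hy
    have h3 := mem_sup_zero.1 ((closedIn_reached n _ _).mem _ hy)
    have h4 := h0 y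
    unfold Heights.N at h4
    omega
  set p : ℕ → ℤ := fun i => if h : i < l then c.upper ⟨i, h⟩ 0 else 0 with hp
  set q : ℕ → ℤ := fun i => if h : 1 ≤ i ∧ i ≤ l then c.lower ⟨i - 1, by omega⟩ 0 - 1 else 0 with hq
  rw [odd_ncard_iff_of_intervals hfin (fun y => (c.heights.A y 0).toNat) p q]
  · suffices hset : c.evenHoles {W | Reached n (c.heights.sup 0) {x} (cell W)} =
        {i | (∃ z ∈ {y : ℤ | Reached n (c.heights.sup 0) {x} (y, 0)},
          (c.heights.A z 0).toNat = i) ∧ Odd (q i - p i)} by rw [hset]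
    ext i
    constructor
    · rintro ⟨a, b, ha, hb, hab, he, U, hU, hU'⟩
      obtain ⟨hi, ha⟩ := (c.alpha_eq_coe_iff i 0 a).1 ha
      obtain ⟨hil, hb⟩ := (c.beta_eq_coe_iff i 0 b).1 hb
      have hqi : q i = a - 1 := by rw [hq]; simp only; rw [dif_pos hi, ha]
      have hpi : p i = b := by rw [hp]; simp only; rw [dif_pos hil, hb]
      have hodd : Odd (q i - p i) := by
        rw [hpi, hqi]
        rw [Int.even_iff] at he
        rw [Int.odd_iff]
        omega
      rcases hU' with ⟨h0, h3⟩ | ⟨h0, h3⟩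
      · have hc : cell U = (U.1, 0) := by
          rw [show U = (U.1, ((0 : ℕ) : ℤ)) from Prod.ext rfl h0, cell_upper]
        replace hU : Reached n (c.heights.sup 0) {x} (cell U) := hU
        rw [hc] at hU
        rw [h.upperII_iff hi.2] at h3
        have := hT _ hU
        exact ⟨⟨U.1, hU, by omega⟩, hodd⟩
      · have e : U = (U.1 - 1 + 1 + ((0 : ℕ) : ℤ), -((0 : ℕ) : ℤ) - 1) :=
          Prod.ext (by simp) (by simp [h0])
        have hc : cell U = (U.1 - 1, 0) := by
          rw [e, cell_lower]
          simp
        replace hU : Reached n (c.heights.sup 0) {x} (cell U) := hU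
        rw [hc] at hU
        rw [show U.1 = U.1 - 1 + 1 + ((0 : ℕ) : ℤ) by simp, h.lowerII_iff hi.2] at h3
        have := hT _ hU
        exact ⟨⟨U.1 - 1, hU, by omega⟩, hodd⟩
    · rintro ⟨⟨z, hz, hzi⟩, hodd⟩
      replace hz : Reached n (c.heights.sup 0) {x} (z, 0) := hz
      have h3 := hT z hz
      have b := hin z hz
      have hi : 1 ≤ i ∧ i ≤ l := by omega
      have hil : i < l := by omega
      have e1 := hlow (i - 1) (by omega) z
      have e2 := hup i hil z
      rw [hp, hq] at hodd
      simp only at hodd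
      rw [dif_pos hi, dif_pos hil, Int.odd_iff] at hodd
      refine ⟨_, _, (c.alpha_eq_coe_iff i 0 _).2 ⟨hi, rfl⟩, (c.beta_eq_coe_iff i 0 _).2 ⟨hil, rfl⟩,
        by omega, ?_, (z, ((0 : ℕ) : ℤ)), ?_, Or.inl ⟨rfl, ?_⟩⟩
      · rw [Int.even_iff]
        omega
      · change Reached n (c.heights.sup 0) {x} (cell _)
        rwa [cell_upper]
      · rw [h.upperII_iff hi.2]
        simp only
        omega
  · intro z hz y
    replace hz : Reached n (c.heights.sup 0) {x} (z, 0) := hz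
    have h3 := hT z hz
    have b := hin z hz
    set i := (c.heights.A z 0).toNat with hi'
    have hi : 1 ≤ i ∧ i ≤ l := by omega
    have hil : i < l := by omega
    have hqi : q i = c.lower ⟨i - 1, by omega⟩ 0 - 1 := by rw [hq]; simp only; rw [dif_pos hi]
    have hpi : p i = c.upper ⟨i, hil⟩ 0 := by rw [hp]; simp only; rw [dif_pos hil]
    have e1 := hlow (i - 1) (by omega)
    have e2 := hup i hil
    rw [hpi, hqi]
    have key : ∀ y, c.upper ⟨i, hil⟩ 0 ≤ y → y < c.lower ⟨i - 1, by omega⟩ 0 - 1 →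
        c.heights.A y 0 = i ∧ (y, 0) ∈ c.heights.sup 0 := by
      intro y h5 h6
      have e1' := e1 y
      have e2' := e2 y
      have h7 := h0 y
      rw [mem_sup_zero]
      unfold Heights.N at h7
      omega
    constructor
    · rintro ⟨hy, hyi⟩
      have h4 := hT y hy
      have e1' := e1 y
      have e2' := e2 y
      have b3 := h.lower_bounds y 0
      omega
    · rintro ⟨h5, h6⟩
      have e1' := e1 z
      have e2' := e2 z
      have := (key y h5 h6).1
      exact ⟨hz.interval (by omega) (by omega) (fun y h7 h8 => (key y h7 h8).2) h5 h6, by omega⟩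

theorem no_oddRegionI_iff (h : IsPattern c) (h2 : ∀ x, -2 ≤ c.heights.N x 0) {start finish : Fin l → ℤ}
    (hadm : Heights.Admissible n l (topHeights start finish) c.heights) :
    (¬ ∃ V, c.OddRegionI n V) ↔
      ∀ V, ClosedIn n (c.heights.sub (-2)) V → Even {x : ℤ | (x, 0) ∈ V}.ncard := by
  have hfin : ∀ x, {y : ℤ | Reached n (c.heights.sub (-2)) {x} (y, 0)}.Finite := by
    intro x
    obtain ⟨M, hM⟩ := hadm.bounded_of_neg
    refine (Set.finite_Ioo (-M) M).subset fun y hy => hM 0 (Nat.zero_le _) y ?_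
    have : c.heights.N y 0 ≤ -2 := (closedIn_reached n _ _).mem _ hy
    omega
  -- By positivity no I-unit lies on row `n`, so there is no boundary restriction on I-regions.
  have hrow : ∀ u, u ∈ c.heights.sub (-2) → u.2 ≠ n := by
    intro u hu hn
    replace hu : c.heights.N u.1 u.2 ≤ -2 := hu
    rw [hn] at hu
    have := hadm.pos u.1
    omega
  have hcl : (∀ V, ClosedIn n (c.heights.sub (-2)) V → Even {x : ℤ | (x, 0) ∈ V}.ncard) ↔
      ∀ V, ClosedIn n (c.heights.sub (-2)) V → (∀ u ∈ V, u.2 ≠ n) →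
        Even {x : ℤ | (x, 0) ∈ V}.ncard :=
    ⟨fun h V hV _ => h V hV, fun h V hV => h V hV fun u hu => hrow u (hV.mem u hu)⟩
  have hset : {U | c.UnitI n U} = unitsOf n (c.heights.sub (-2)) := Set.ext fun U => h.unitI_iff U
  rw [hcl, even_closed_iff]
  constructor
  · intro hno x hx _
    rw [← Nat.not_odd_iff_even]
    intro hodd
    refine hno ⟨{W | Reached n (c.heights.sub (-2)) {x} (cell W)}, ?_,
      (h.odd_overlaps_iff h2 (hfin x)).2 hodd⟩
    unfold PathPair.RegionI
    rw [hset, isComponent_iff]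
    exact ⟨x, hx, rfl⟩
  · rintro hev ⟨V, hV, hodd⟩
    unfold PathPair.RegionI at hV
    rw [hset, isComponent_iff] at hV
    obtain ⟨x, hx, rfl⟩ := hV
    rw [h.odd_overlaps_iff h2 (hfin x)] at hodd
    exact Nat.not_even_iff_odd.2 hodd
      (hev x hx fun u hu => hrow u ((closedIn_reached n _ _).mem u hu))

/-- A component with a boundary unit always extends to row `n`, and units on row `n` are boundary
units. So the components without boundary units are those that avoid row `n`. -/
theorem no_oddRegionII_iff (h : IsPattern c) (h0 : ∀ x, c.heights.N x 0 ≤ 0) :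
    (¬ ∃ V, c.OddRegionII n V) ↔
      ∀ V, ClosedIn n (c.heights.sup 0) V → (∀ u ∈ V, u.2 ≠ n) →
        Even {x : ℤ | (x, 0) ∈ V}.ncard := by
  have hbd : ∀ x, (∀ u, Reached n (c.heights.sup 0) {x} u → u.2 ≠ n) →
      ∀ u, Reached n (c.heights.sup 0) {x} u →
        ¬ (c.heights.B u.1 u.2 ≤ u.2 ∨ l ≤ c.heights.A u.1 u.2) := by
    intro x hx u hu hb
    obtain ⟨y, hy⟩ := h.exists_top_of_boundary hu hb
    exact hx _ hy rfl
  have hin : ∀ x, (∀ u, Reached n (c.heights.sup 0) {x} u → u.2 ≠ n) →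
      ∀ y, Reached n (c.heights.sup 0) {x} (y, 0) →
        0 < c.heights.B y 0 ∧ c.heights.A y 0 < l := by
    intro x hx y hy
    have := hbd x hx _ hy
    simp only at this
    push_cast at this
    omega
  have hfin : ∀ x, (∀ u, Reached n (c.heights.sup 0) {x} u → u.2 ≠ n) →
      {y : ℤ | Reached n (c.heights.sup 0) {x} (y, 0)}.Finite := by
    intro x hx
    obtain ⟨M, hM⟩ := exists_fin_bound fun j => c.upper j 0
    obtain ⟨M', hM'⟩ := exists_fin_bound fun j => c.lower j 0
    refine (Set.finite_Icc (-M' - 2) M).subset fun y hy => ?_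
    obtain ⟨h3, h4⟩ := hin x hx y hy
    have b1 := h.lower_bounds y 0
    have b2 := h.upper_bounds y 0
    have e1 := (h.isCount_upper 0).lt_iff ⟨0, by omega⟩ y
    have e2 := (h.isCount_lower 0).lt_iff ⟨l - 1, by omega⟩ y
    have m1 := abs_le.1 (hM ⟨0, by omega⟩)
    have m2 := abs_le.1 (hM' ⟨l - 1, by omega⟩)
    simp only at e1 e2
    push_cast at e1 e2
    rw [Set.mem_Icc]
    omega
  have hset : {U | c.UnitII n U} = unitsOf n (c.heights.sup 0) := Set.ext fun U => h.unitII_iff U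
  rw [even_closed_iff]
  constructor
  · intro hno x hx hn
    rw [← Nat.not_odd_iff_even]
    intro hodd
    refine hno ⟨{W | Reached n (c.heights.sup 0) {x} (cell W)}, ?_,
      (h.odd_holes_iff h0 (hin x hn) (hfin x hn)).2 hodd⟩
    unfold PathPair.RegionII
    rw [← and_assoc, hset, isComponent_iff]
    refine ⟨⟨x, hx, rfl⟩, fun U hU => ?_⟩
    rw [h.boundaryUnitII_iff (x := (cell U).1) (r := (cell U).2) rfl]
    have h1 := hbd x hn _ hU
    have h2 := hn _ hU
    tauto
  · rintro hev ⟨V, hV, hodd⟩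
    unfold PathPair.RegionII at hV
    rw [← and_assoc, hset, isComponent_iff] at hV
    obtain ⟨⟨x, hx, rfl⟩, hb⟩ := hV
    have hn : ∀ u, Reached n (c.heights.sup 0) {x} u → u.2 ≠ n := by
      intro u hu hun
      have hc : cell (u.1, (u.2 : ℤ)) = u := cell_upper _ _
      refine hb (u.1, (u.2 : ℤ)) (by change Reached _ _ _ (cell _); rwa [hc]) ?_
      rw [h.boundaryUnitII_iff (x := u.1) (r := u.2) hc]
      exact ⟨hun.le, mem_sup_zero.1 ((closedIn_reached n _ _).mem u hu), Or.inr (Or.inr hun)⟩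
    rw [h.odd_holes_iff h0 (hin x hn) (hfin x hn)] at hodd
    exact Nat.not_even_iff_odd.2 hodd (hev x hx hn)

end IsPattern

/-! ### Weights -/

section antiderivative

variable {M : Type*} [AddCommGroup M]

theorem exists_antideriv (f : ℤ → M) : ∃ F : ℤ → M, ∀ x, F (x + 1) = F x + f x := by
  refine ⟨fun x => ∑ t ∈ Finset.Ico 0 x, f t - ∑ t ∈ Finset.Ico x 0, f t, fun x => ?_⟩
  beta_reduce
  rcases le_or_gt 0 x with h | h
  · have h1 : Finset.Ico 0 (x + 1) = insert x (Finset.Ico 0 x) := by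
      ext t; simp only [Finset.mem_Ico, Finset.mem_insert]; omega
    rw [h1, Finset.sum_insert (by simp), Finset.Ico_eq_empty (a := x) (by omega),
      Finset.Ico_eq_empty (a := x + 1) (by omega)]
    simp only [Finset.sum_empty, sub_zero]
    abel
  · have h1 : Finset.Ico x 0 = insert x (Finset.Ico (x + 1) 0) := by
      ext t; simp only [Finset.mem_Ico, Finset.mem_insert]; omega
    rw [h1, Finset.sum_insert (by simp), Finset.Ico_eq_empty (a := 0) (b := x) (by omega),
      Finset.Ico_eq_empty (a := 0) (b := x + 1) (by omega)]
    simp only [Finset.sum_empty, zero_sub]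
    abel

/-- After multiplication by `(-1) ^ x` this becomes an ordinary antiderivative. -/
theorem exists_alternating (f : ℤ → M) : ∃ G : ℤ → M, ∀ x, G x + G (x - 1) = f x := by
  obtain ⟨H, hH⟩ := exists_antideriv fun x => sgn (x + 1) • f (x + 1)
  refine ⟨fun x => sgn x • H x, fun x => ?_⟩
  have h1 := hH (x - 1)
  rw [sub_add_cancel] at h1
  have h2 : sgn (x - 1) = -sgn x := by unfold sgn; split_ifs <;> omega
  have h3 : sgn x * sgn x = 1 := by unfold sgn; split_ifs <;> rfl
  simp only [h1, h2, smul_add, smul_smul, h3, one_smul, neg_smul]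
  abel

theorem sum_range_of_antideriv {f F : ℤ → M} (h : ∀ x, F (x + 1) = F x + f x) (x : ℤ) (e : ℕ) :
    ∑ k ∈ Finset.range e, f (x + k) = F (x + e) - F x := by
  induction e with
  | zero => simp
  | succ e ih =>
    rw [Finset.sum_range_succ, ih]
    push_cast
    rw [← add_assoc, h]
    abel

theorem sum_Icc_symm (n : ℕ) (g : ℤ → M) : ∑ y ∈ Finset.Icc (-(n : ℤ)) (n : ℤ), g y =
    g 0 + ∑ s ∈ Finset.range n, g (-((s : ℤ) + 1)) + ∑ s ∈ Finset.range n, g ((s : ℤ) + 1) := by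
  induction n with
  | zero => simp
  | succ n ih =>
    have h1 : Finset.Icc (-((n + 1 : ℕ) : ℤ)) ((n + 1 : ℕ) : ℤ) =
        insert (-((n : ℤ) + 1)) (insert ((n : ℤ) + 1) (Finset.Icc (-(n : ℤ)) (n : ℤ))) := by
      ext t
      simp only [Finset.mem_Icc, Finset.mem_insert]
      push_cast
      omega
    rw [h1, Finset.sum_insert, Finset.sum_insert, ih, Finset.sum_range_succ, Finset.sum_range_succ]
    · abel
    · simp
    · simp only [Finset.mem_insert, Finset.mem_Icc, not_or]
      omega

/-- The contribution of an E-step to the logarithm of the weight. -/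
def logStep (n : ℕ) (U V : ℕ → ℤ → M) (x y : ℤ) (k : ℕ) : M :=
  if y < 0 then U ((n : ℤ) + 1 + y).toNat x
  else if y = 0 then (if Even k then V n x else U n x)
  else V ((n : ℤ) + 1 - y).toNat x

/-- The logarithm of the weight of a path. -/
noncomputable def Path.logWeight {n : ℕ} (U V : ℕ → ℤ → M) (p : Path n) : M :=
  ∑ y ∈ Finset.Icc (-(n : ℤ)) (n : ℤ), ∑ k ∈ Finset.range (p.e y), logStep n U V (p.left y + k) y k

/-- The weight of a path splits into contributions of its positions at the various heights, and the
positions `left (-r) - 1 - r` and `right r` contribute in the same way. -/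
theorem exists_logWeight_eq (n : ℕ) {U V : ℕ → ℤ → M} (hU : ∀ x, U 0 x = 0) (hV : ∀ x, V 0 x = 0)
    (hrel : ∀ j, j < n → ∀ x, U (j + 1) x + V (j + 1) (x - n + (j + 1) - 2) =
      U j x + V j (x - n + (j + 1) - 2)) :
    ∃ g : ℕ → ℤ → M, ∀ p : Path n, p.logWeight U V =
      ∑ r ∈ Finset.range (n + 1), (g r (p.left (-(r : ℤ)) - 1 - r) + g r (p.left ((r : ℤ) + 1))) := by
  -- By the relation, the difference of consecutive `V`'s is, up to sign and a shift, the difference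
  -- of consecutive `U`'s. One family `T` therefore provides antiderivatives `Φ` of `U` and `Ψ` of
  -- `V`.
  choose T hT using fun j : ℕ => exists_antideriv fun x => U (j + 1) x - U j x
  set Φ : ℕ → ℤ → M := fun j x => ∑ t ∈ Finset.range j, T t x with hΦ
  set Ψ : ℕ → ℤ → M := fun j x => -∑ t ∈ Finset.range j, T t (x + n - t + 1) with hΨ
  have dΦ : ∀ j x, Φ j (x + 1) = Φ j x + U j x := by
    intro j x
    induction j with
    | zero => simp [hΦ, hU]
    | succ j ih =>
      simp only [hΦ, Finset.sum_range_succ] at ih ⊢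
      rw [ih, hT]
      abel
  have dΨ : ∀ j, j ≤ n → ∀ x, Ψ j (x + 1) = Ψ j x + V j x := by
    intro j hj x
    induction j with
    | zero => simp [hΨ, hV]
    | succ j ih =>
      have ih' := ih (by omega)
      have hr := hrel j (by omega) (x + n - j + 1)
      rw [show x + n - j + 1 - n + (j + 1) - 2 = x by ring] at hr
      have hv : V (j + 1) x = V j x - (U (j + 1) (x + n - j + 1) - U j (x + n - j + 1)) := by
        rw [eq_sub_iff_add_eq, ← sub_eq_zero]
        rw [← sub_eq_zero] at hr
        rw [← hr]
        abel
      simp only [hΨ, Finset.sum_range_succ, neg_add] at ih' ⊢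
      rw [ih', hv, show x + 1 + n - j + 1 = x + n - j + 1 + 1 by ring, hT]
      abel
  -- The alternating letters on row `0` call for a function whose consecutive sums, instead of
  -- differences, are prescribed.
  obtain ⟨G, hG⟩ := exists_alternating fun x => Φ n x - Ψ n x
  have hzero : ∀ (x : ℤ) (m : ℕ), ∑ k ∈ Finset.range (2 * m), (if Even k then V n (x + k) else
      U n (x + k)) + Φ n x - Ψ n (x + 2 * m) = G (x - 1) + G (x + 2 * m) := by
    intro x m
    induction m with
    | zero =>
      have := hG x
      simp only [mul_zero, Finset.range_zero, Finset.sum_empty, Nat.cast_zero, add_zero, zero_add]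
      rw [← this, add_comm]
    | succ m ih =>
      have e1 : 2 * (m + 1) = 2 * m + 1 + 1 := by ring
      have e2 : x + 2 * ((m + 1 : ℕ) : ℤ) = x + 2 * m + 1 + 1 := by push_cast; ring
      have e3 : x + ((2 * m + 1 : ℕ) : ℤ) = x + 2 * m + 1 := by push_cast; ring
      have e4 : x + ((2 * m : ℕ) : ℤ) = x + 2 * m := by push_cast; ring
      rw [e1, Finset.sum_range_succ, Finset.sum_range_succ, if_pos (by simp), if_neg (by simp), e2,
        e3, e4]
      have g1 := hG (x + 2 * m + 1)
      have g2 := hG (x + 2 * m + 1 + 1)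
      rw [add_sub_cancel_right] at g1 g2
      have p1 := dΨ n le_rfl (x + 2 * m)
      have p2 := dΨ n le_rfl (x + 2 * m + 1)
      have p3 := dΦ n (x + 2 * m + 1)
      have g3 : G (x + 2 * m + 1 + 1) = Φ n (x + 2 * m + 1 + 1) - Ψ n (x + 2 * m + 1 + 1) -
          G (x + 2 * m + 1) := by rw [← g2]; abel
      have g4 : G (x + 2 * m) = Φ n (x + 2 * m + 1) - Ψ n (x + 2 * m + 1) -
          G (x + 2 * m + 1) := by rw [← g1]; abel
      have ih2 : ∑ k ∈ Finset.range (2 * m), (if Even k then V n (x + k) else U n (x + k)) =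
          G (x - 1) + G (x + 2 * m) + Ψ n (x + 2 * m) - Φ n x := by rw [← ih]; abel
      rw [ih2, g3, g4, p2, p3, p1]
      abel
  -- Telescoping the antiderivatives along the path leaves `T (n - r)` at `left (-r)` and at `right
  -- r + r + 1`. The shift by `r + 1` turns both into one function of the folded positions.
  refine ⟨fun r x => if r = 0 then G x else -T (n - r) (x + r + 1), fun p => ?_⟩
  have hlow : ∀ m, m ≤ n → ∑ s ∈ Finset.range m, ∑ k ∈ Finset.range (p.e (-((s : ℤ) + 1))),
      logStep n U V (p.left (-((s : ℤ) + 1)) + k) (-((s : ℤ) + 1)) k =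
      Φ n (p.left 0) - Φ (n - m) (p.left (-(m : ℤ))) -
        ∑ s ∈ Finset.range m, T (n - (s + 1)) (p.left (-((s + 1 : ℕ) : ℤ))) := by
    intro m
    induction m with
    | zero => simp
    | succ m ih =>
      intro hm
      rw [Finset.sum_range_succ, ih (by omega), Finset.sum_range_succ]
      have h1 : ∀ (x : ℤ) (k : ℕ), logStep n U V x (-((m : ℤ) + 1)) k = U (n - m) x := by
        intro x k
        rw [logStep, if_pos (by omega)]
        congr 1
        omega
      simp only [h1]
      rw [sum_range_of_antideriv (dΦ (n - m)), ← p.left_succ,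
        show -((m : ℤ) + 1) + 1 = -(m : ℤ) by ring]
      have h2 : Φ (n - m) (p.left (-((m : ℤ) + 1))) = Φ (n - (m + 1)) (p.left (-((m : ℤ) + 1))) +
          T (n - (m + 1)) (p.left (-((m : ℤ) + 1))) := by
        rw [show n - m = n - (m + 1) + 1 by omega]
        simp only [hΦ, Finset.sum_range_succ]
      rw [h2]
      push_cast
      abel
  have hupp : ∀ m, m ≤ n → ∑ s ∈ Finset.range m, ∑ k ∈ Finset.range (p.e ((s : ℤ) + 1)),
      logStep n U V (p.left ((s : ℤ) + 1) + k) ((s : ℤ) + 1) k =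
      -Ψ n (p.left 1) + Ψ (n - m) (p.left ((m : ℤ) + 1)) -
        ∑ s ∈ Finset.range m, T (n - (s + 1))
          (p.left (((s + 1 : ℕ) : ℤ) + 1) + ((s + 1 : ℕ) : ℤ) + 1) := by
    intro m
    induction m with
    | zero => simp
    | succ m ih =>
      intro hm
      rw [Finset.sum_range_succ, ih (by omega), Finset.sum_range_succ]
      have h1 : ∀ (x : ℤ) (k : ℕ), logStep n U V x ((m : ℤ) + 1) k = V (n - m) x := by
        intro x k
        rw [logStep, if_neg (by omega), if_neg (by omega)]
        congr 1
        omega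
      simp only [h1]
      rw [sum_range_of_antideriv (dΨ (n - m) (by omega)), ← p.left_succ]
      have h2 : Ψ (n - m) (p.left ((m : ℤ) + 1 + 1)) =
          Ψ (n - (m + 1)) (p.left ((m : ℤ) + 1 + 1)) -
          T (n - (m + 1)) (p.left ((m : ℤ) + 1 + 1) + (m + 1) + 1) := by
        rw [show n - m = n - (m + 1) + 1 by omega]
        simp only [hΨ, Finset.sum_range_succ]
        rw [show p.left ((m : ℤ) + 1 + 1) + n - ((n - (m + 1) : ℕ) : ℤ) + 1 =
          p.left ((m : ℤ) + 1 + 1) + (m + 1) + 1 by omega]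
        abel
      rw [h2]
      push_cast
      abel
  have h0 : ∑ k ∈ Finset.range (p.e 0), logStep n U V (p.left 0 + k) 0 k =
      G (p.left 0 - 1) + G (p.left 1) - Φ n (p.left 0) + Ψ n (p.left 1) := by
    obtain ⟨m, hm⟩ := p.even_e_zero
    have hl := p.left_succ 0
    rw [zero_add] at hl
    have h1 : p.left 1 = p.left 0 + 2 * m := by rw [hl, hm]; push_cast; ring
    have h2 := hzero (p.left 0) m
    rw [h1, hm, ← two_mul, ← h2]
    simp only [logStep, lt_irrefl, if_false, if_true]
    abel
  rw [Path.logWeight, sum_Icc_symm, h0, hlow n le_rfl, hupp n le_rfl, Finset.sum_range_succ']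
  have hg : ∀ s : ℕ, (if s + 1 = 0 then G (p.left (-((s + 1 : ℕ) : ℤ)) - 1 - ((s + 1 : ℕ) : ℤ)) else
      -T (n - (s + 1)) (p.left (-((s + 1 : ℕ) : ℤ)) - 1 - ((s + 1 : ℕ) : ℤ) + ((s + 1 : ℕ) : ℤ) + 1))
      = -T (n - (s + 1)) (p.left (-((s + 1 : ℕ) : ℤ))) := fun s => by
    rw [if_neg (by omega)]
    congr 2
    ring
  have hg' : ∀ s : ℕ, (if s + 1 = 0 then G (p.left (((s + 1 : ℕ) : ℤ) + 1)) else
      -T (n - (s + 1)) (p.left (((s + 1 : ℕ) : ℤ) + 1) + ((s + 1 : ℕ) : ℤ) + 1))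
      = -T (n - (s + 1)) (p.left (((s + 1 : ℕ) : ℤ) + 1) + ((s + 1 : ℕ) : ℤ) + 1) := fun s => by
    rw [if_neg (by omega)]
  have z1 : Φ (n - n) (p.left (-(n : ℤ))) = 0 := by simp [hΦ]
  have z2 : Ψ (n - n) (p.left ((n : ℤ) + 1)) = 0 := by simp [hΨ]
  simp only [hg, hg', Finset.sum_add_distrib, Finset.sum_neg_distrib, z1, z2, if_true,
    Nat.cast_zero, neg_zero, sub_zero, zero_add]
  abel

/-- The sum of a function over two sequences is determined by the sum of the counting functions. -/
theorem sum_eq_of_cnt {l : ℕ} {d d' e e' : Fin l → ℤ}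
    (h : ∀ x, cnt d x + cnt d' x = cnt e x + cnt e' x) (g : ℤ → M) :
    ∑ i, g (d i) + ∑ i, g (d' i) = ∑ i, g (e i) + ∑ i, g (e' i) := by
  -- The multiplicity of a value is the drop of the counting function there, so the two multisets of
  -- positions agree.
  have hcount : ∀ (d : Fin l → ℤ) (z : ℤ),
      ((Multiset.map d Finset.univ.val).count z : ℤ) = cnt d (z - 1) - cnt d z := by
    intro d z
    rw [Multiset.count_map, cnt_eq_sum, cnt_eq_sum, ← Finset.sum_sub_distrib]
    change (((Finset.univ.filter fun i => z = d i).card : ℕ) : ℤ) = _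
    rw [Finset.natCast_card_filter]
    refine Finset.sum_congr rfl fun i _ => ?_
    split_ifs <;> omega
  have hm : Multiset.map d Finset.univ.val + Multiset.map d' Finset.univ.val =
      Multiset.map e Finset.univ.val + Multiset.map e' Finset.univ.val := by
    ext z
    have h1 := h (z - 1)
    have h2 := h z
    have c1 := hcount d z
    have c2 := hcount d' z
    have c3 := hcount e z
    have c4 := hcount e' z
    rw [Multiset.count_add, Multiset.count_add]
    omega
  have := congrArg (fun m => (Multiset.map g m).sum) hm
  simp only [Multiset.map_add, Multiset.sum_add, Multiset.map_map] at this
  exact this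

end antiderivative

/-- The relations express `z_i z_ī` by the previous index, starting from `1`. Invertibility allows
the weights to be treated additively. -/
theorem isUnit_zPlain_zBar (n i : ℕ) : (∀ a, IsUnit (zPlain n i a)) ∧ ∀ a, IsUnit (zBar n i a) := by
  induction i with
  | zero => simp [zPlain, zBar, polyPlain, polyBar]
  | succ i ih =>
    by_cases hi : i + 1 ≤ n
    · have hrel : ∀ a : ℂ, zPlain n (i + 1) a * zBar n (i + 1) (a - 2 * n + 2 * ((i + 1 : ℕ) : ℂ) - 4) =
          zPlain n i a * zBar n i (a - 2 * n + 2 * ((i + 1 : ℕ) : ℂ) - 4) := by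
        intro a
        unfold zPlain zBar
        rw [← map_mul, ← map_mul, Ideal.Quotient.eq]
        exact Ideal.subset_span ⟨i + 1, a, by omega, hi, rfl⟩
      have hu : ∀ a : ℂ, IsUnit (zPlain n (i + 1) a *
          zBar n (i + 1) (a - 2 * n + 2 * ((i + 1 : ℕ) : ℂ) - 4)) := fun a => by
        rw [hrel]
        exact (ih.1 _).mul (ih.2 _)
      refine ⟨fun a => isUnit_of_mul_isUnit_left (hu a), fun a => ?_⟩
      have := isUnit_of_mul_isUnit_right (hu (a + 2 * n - 2 * ((i + 1 : ℕ) : ℂ) + 4))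
      rwa [show a + 2 * n - 2 * ((i + 1 : ℕ) : ℂ) + 4 - 2 * n + 2 * ((i + 1 : ℕ) : ℂ) - 4 = a by
        ring] at this
    · have : ¬ (1 ≤ i + 1 ∧ i + 1 ≤ n) := by omega
      simp [zPlain, zBar, polyPlain, polyBar, hi]

/-- The generators as units. -/
noncomputable def plainUnit (n : ℕ) (a : ℂ) (i : ℕ) (x : ℤ) : Additive (WeightRing n)ˣ :=
  Additive.ofMul ((isUnit_zPlain_zBar n i).1 (a + 2 * x)).unit

noncomputable def barUnit (n : ℕ) (a : ℂ) (i : ℕ) (x : ℤ) : Additive (WeightRing n)ˣ :=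
  Additive.ofMul ((isUnit_zPlain_zBar n i).2 (a + 2 * x)).unit

theorem toMul_sum_units {R ι : Type*} [CommRing R] (s : Finset ι) (f : ι → Additive Rˣ) :
    ((∑ i ∈ s, f i).toMul : R) = ∏ i ∈ s, ((f i).toMul : R) := by
  classical
  induction s using Finset.induction_on with
  | empty => simp
  | insert i s hi ih =>
    rw [Finset.sum_insert hi, Finset.prod_insert hi, toMul_add, Units.val_mul, ih]

theorem weight_eq_logWeight {n : ℕ} (a : ℂ) (p : Path n) : p.weight a =
    ((p.logWeight (plainUnit n a) (barUnit n a)).toMul : (WeightRing n)ˣ) := by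
  unfold Path.weight Path.logWeight
  rw [toMul_sum_units]
  refine Finset.prod_congr rfl fun y _ => ?_
  rw [toMul_sum_units]
  refine Finset.prod_congr rfl fun k _ => ?_
  unfold stepWeight logStep
  have h : ∀ x : ℤ, ∀ i, ((plainUnit n a i x).toMul : WeightRing n) = zPlain n i (a + 2 * x) :=
    fun x i => rfl
  have h' : ∀ x : ℤ, ∀ i, ((barUnit n a i x).toMul : WeightRing n) = zBar n i (a + 2 * x) :=
    fun x i => rfl
  split_ifs
  · rw [h]
  · rw [h']
  · rw [h]
  · rw [h']

theorem unit_rel (n : ℕ) (a : ℂ) (j : ℕ) (hj : j < n) (x : ℤ) :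
    plainUnit n a (j + 1) x + barUnit n a (j + 1) (x - n + (j + 1) - 2) =
      plainUnit n a j x + barUnit n a j (x - n + (j + 1) - 2) := by
  apply Additive.toMul.injective
  rw [toMul_add, toMul_add]
  ext
  rw [Units.val_mul, Units.val_mul]
  change zPlain n (j + 1) (a + 2 * x) * zBar n (j + 1) (a + 2 * ((x - n + (j + 1) - 2 : ℤ) : ℂ)) =
    zPlain n j (a + 2 * x) * zBar n j (a + 2 * ((x - n + (j + 1) - 2 : ℤ) : ℂ))
  have e : a + 2 * ((x - n + (j + 1) - 2 : ℤ) : ℂ) =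
      a + 2 * x - 2 * n + 2 * ((j + 1 : ℕ) : ℂ) - 4 := by
    push_cast
    ring
  rw [e]
  unfold zPlain zBar
  rw [← map_mul, ← map_mul, Ideal.Quotient.eq]
  exact Ideal.subset_span ⟨j + 1, a + 2 * x, by omega, by omega, rfl⟩

theorem unit_zero (n : ℕ) (a : ℂ) (x : ℤ) : plainUnit n a 0 x = 0 ∧ barUnit n a 0 x = 0 := by
  constructor <;> apply Additive.toMul.injective <;> ext
  · change zPlain n 0 _ = 1
    simp [zPlain, polyPlain]
  · change zBar n 0 _ = 1
    simp [zBar, polyBar]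

/-- The weight of a tuple is determined by the function `A + B`. -/
theorem weight_eq_of_total {n : ℕ} {lam mu : YoungDiagram} {p q : PathTuple n lam mu}
    (h : p.toPair.heights.total = q.toPair.heights.total) (a : ℂ) : p.weight a = q.weight a := by
  obtain ⟨g, hg⟩ := exists_logWeight_eq n (U := plainUnit n a) (V := barUnit n a) (fun x => (unit_zero n a x).1)
    (fun x => (unit_zero n a x).2) (unit_rel n a)
  have key : ∀ p : PathTuple n lam mu, p.weight a =
      ((∑ r ∈ Finset.range (n + 1), (∑ i, g r (p.toPair.lower i r - 1 - r) +
        ∑ i, g r (p.toPair.upper i r))).toMul : (WeightRing n)ˣ) := by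
    intro p
    unfold PathTuple.weight
    simp only [weight_eq_logWeight, hg]
    rw [← toMul_sum_units, Finset.sum_comm]
    congr 2
    refine Finset.sum_congr rfl fun r _ => ?_
    rw [Finset.sum_add_distrib, ← Equiv.sum_comp p.σ fun i => g r (p.toPair.upper i r)]
    simp only [PathTuple.upper_eq, PathTuple.lower_eq]
  rw [key, key]
  congr 2
  refine Finset.sum_congr rfl fun r _ => ?_
  refine sum_eq_of_cnt (d := fun i => p.toPair.lower i r - 1 - r)
    (d' := fun i => p.toPair.upper i r) (e := fun i => q.toPair.lower i r - 1 - r)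
    (e' := fun i => q.toPair.upper i r) (fun x => ?_) (g r)
  have := congrFun (congrFun h x) r
  simp only [Heights.total, PathPair.heights] at this
  omega

theorem PathPair.heights_A_zero {l : ℕ} (c : PathPair l) (x : ℤ) :
    c.heights.A x 0 = cnt (fun j => c.lower j 0 - 1) x := by
  simp [PathPair.heights]

/-! ### The two sets of tuples as sets of counting functions -/

namespace PathTuple

variable {n : ℕ} {lam mu : YoungDiagram}

/-- The conditions that characterise the counting functions of tuples in `P₂` and in `P`. -/
def IsState (n : ℕ) (lam mu : YoungDiagram) (c : ℤ) (s : Heights) : Prop :=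
  Heights.InX n (lam.colLen 0) (topHeights (starts (lam.colLen 0) mu) (starts (lam.colLen 0) lam)) c s ∧
    HasKappa fun x => s.total x 0

theorem admissible (hpos : Positivity n lam mu) (p : PathTuple n lam mu)
    (h : IsPattern p.toPair) : Heights.Admissible n (lam.colLen 0)
      (topHeights (starts (lam.colLen 0) mu) (starts (lam.colLen 0) lam)) p.toPair.heights :=
  h.admissible p.lower_of_ge p.upper_of_ge (neg_one_le_topHeights_N hpos)

theorem lower_zero_anti {l : ℕ} {c : PathPair l} (h : IsPattern c) :
    StrictAnti fun j => c.lower j 0 := fun i j hij => by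
  have := h.lower_anti 0 hij
  simp only at this ⊢
  omega

theorem isSpecial_of_mem_P₁ {p : PathTuple n lam mu} (h : p ∈ P₁ n lam mu) :
    IsSpecial (fun j => p.toPair.lower j 0) (fun j => p.toPair.upper j 0) p.σ :=
  ⟨p.lower_le_upper, p.even_upper_sub_lower, (p.mem_P₁_iff.1 h).2⟩

theorem isState_of_mem_P₂ (hpos : Positivity n lam mu) {p : PathTuple n lam mu}
    (hp : p ∈ P₂ n lam mu) : IsState n lam mu 2 p.toPair.heights := by
  have hpat := (p.mem_P₁_iff.1 hp.1).1
  have hs := (isSpecial_of_mem_P₁ hp.1).bounds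
  have hN : ∀ x, -2 ≤ p.toPair.heights.N x 0 ∧ p.toPair.heights.N x 0 ≤ 0 := by
    intro x
    obtain ⟨h1, h2, -⟩ := hs x
    unfold Heights.N
    rw [PathPair.heights_A_zero]
    change -2 ≤ _ - cnt (fun j => p.toPair.upper j 0) x ∧ _ - cnt (fun j => p.toPair.upper j 0) x ≤ 0
    omega
  have hadm := p.admissible hpos hpat
  obtain ⟨-, hno⟩ := hp
  rw [not_exists] at hno
  refine ⟨⟨hadm, fun x => (hN x).2, fun x => (hN x).1, fun x k hk => ?_, ?_, ?_⟩, ?_⟩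
  · have h1 := hN x
    -- Between `-2` and `0` there is no further even level, and the only odd level `-1` has `k = 0`;
    -- the rule is vacuous.
    rw [countAbove_eq_zero (M := x) (fun y _ hy => ?_) le_rfl]
    · rw [show k = 0 by omega]
      simp
    · have h2 := hN y
      have h3 := hy.1
      rw [Int.even_iff] at h3
      omega
  · exact (hpat.no_oddRegionI_iff (fun x => (hN x).1) hadm).1
      fun ⟨V, hV⟩ => hno V (Or.inl hV)
  · exact (hpat.no_oddRegionII_iff fun x => (hN x).2).1 fun ⟨V, hV⟩ => hno V (Or.inr hV)
  · rw [hasKappa_iff (a := fun j => p.toPair.lower j 0) (b := fun j => p.toPair.upper j 0)]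
    · exact fun x => (hs x).2.2
    · intro x
      unfold Heights.total
      rw [PathPair.heights_A_zero]
      rfl

/-- The permutation is not part of the counting functions; it is recovered from the bounds on row
`0` and on the signed count. -/
theorem exists_mem_P₂ {s : Heights} (hs : IsState n lam mu 2 s) :
    ∃ p ∈ P₂ n lam mu, p.toPair.heights = s := by
  obtain ⟨hX, hk⟩ := hs
  obtain ⟨c, hc, rfl, h1, h2⟩ := exists_pattern (starts_strictAnti _ mu) (starts_strictAnti _ lam)
    hX.adm
  have ha := lower_zero_anti hc
  have hb := hc.upper_anti 0
  have hN : ∀ x, c.heights.N x 0 = cnt (fun j => c.lower j 0 - 1) x - cnt (fun j => c.upper j 0) x :=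
    fun x => by
      unfold Heights.N
      rw [PathPair.heights_A_zero]
      rfl
  rw [hasKappa_iff (a := fun j => c.lower j 0) (b := fun j => c.upper j 0) (fun x => by
    unfold Heights.total
    rw [PathPair.heights_A_zero]
    rfl)] at hk
  obtain ⟨σ, hσ⟩ := exists_isSpecial ha.injective hb.injective
    (fun x => by have := hX.le x; have := hN x; omega)
    (fun x => by have := hX.ge x; have := hN x; omega) hk
  obtain ⟨p, rfl, rfl⟩ := exists_tuple hc h1 h2 σ hσ.le hσ.even
  refine ⟨p, ⟨p.mem_P₁_iff.2 ⟨hc, hσ.odd⟩, ?_⟩, rfl⟩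
  rintro ⟨V, hV | hV⟩
  · exact (hc.no_oddRegionI_iff (fun x => by have := hX.ge x; omega) hX.adm).2 hX.evenLow ⟨V, hV⟩
  · exact (hc.no_oddRegionII_iff hX.le).2 hX.evenHigh ⟨V, hV⟩

theorem injOn_P₂ {p q : PathTuple n lam mu} (hp : p ∈ P₂ n lam mu) (hq : q ∈ P₂ n lam mu)
    (h : p.toPair.heights = q.toPair.heights) : p = q := by
  have hpp := (p.mem_P₁_iff.1 hp.1).1
  have he := hpp.ext_heights (q.mem_P₁_iff.1 hq.1).1 h
  have hq' := isSpecial_of_mem_P₁ hq.1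
  rw [← he] at hq'
  exact ext_toPair ((isSpecial_of_mem_P₁ hp.1).unique (hpp.upper_anti 0).injective hq') he

theorem injOn_P {p q : PathTuple n lam mu} (hp : p ∈ P n lam mu) (hq : q ∈ P n lam mu)
    (h : p.toPair.heights = q.toPair.heights) : p = q :=
  ext_toPair (hp.1.trans hq.1.symm)
    ((p.mem_P_iff.1 hp).2.1.ext_heights (q.mem_P_iff.1 hq).2.1 h)

theorem bottom_bounds {l : ℕ} {c : PathPair l} (h : IsPattern c) (x : ℤ) :
    -(l : ℤ) ≤ c.heights.N x 0 := by
  have h1 := h.lower_bounds x 0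
  have h2 := h.upper_bounds x 0
  unfold Heights.N
  omega

theorem rule_iff_of_large {N : ℤ → ℤ} {c : ℤ} (hc : ∀ x, N x ≠ -c) :
    (∀ x k, N x = 2 * k - 1 →
      Even (k + (countAbove (fun y => Even (N y) ∧ N y ≠ 0 ∧ N y ≠ -c) x : ℤ))) ↔
    ∀ x k, N x = 2 * k - 1 → Even (k + (countAbove (fun y => Even (N y) ∧ N y ≠ 0) x : ℤ)) := by
  have : ∀ x, countAbove (fun y => Even (N y) ∧ N y ≠ 0 ∧ N y ≠ -c) x =
      countAbove (fun y => Even (N y) ∧ N y ≠ 0) x :=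
    countAbove_congr fun y => by
      have := hc y
      tauto
  simp only [this]

/-- On row `0` the level is at least `-l`. For `c > l` a closed set in `N ≤ -c` thus misses row `0`,
and the exceptional level `-c` in the rule never occurs. -/
theorem isState_of_mem_P (hpos : Positivity n lam mu) {c : ℤ} (hc : (lam.colLen 0 : ℤ) < c)
    {p : PathTuple n lam mu} (hp : p ∈ P n lam mu) : IsState n lam mu c p.toPair.heights := by
  obtain ⟨hσ, hpat, hodd, hno⟩ := p.mem_P_iff.1 hp
  have ha := lower_zero_anti hpat
  have hb := hpat.upper_anti 0
  have hbd := bottom_bounds hpat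
  have hN : ∀ x, p.toPair.heights.N x 0 =
      cnt (fun j => p.toPair.lower j 0 - 1) x - cnt (fun j => p.toPair.upper j 0) x := fun x => by
    unfold Heights.N
    rw [PathPair.heights_A_zero]
    rfl
  have hle := p.lower_le_upper
  have hev := p.even_upper_sub_lower
  rw [hσ] at hle hev
  obtain ⟨h1, h2, h3⟩ := (isAdjacentSpecial_iff ha hb).1 ⟨hle, hev, hodd⟩
  have hN0 : ∀ x, p.toPair.heights.N x 0 ≤ 0 := fun x => by
    have := h1 x
    rw [hN]
    omega
  refine ⟨⟨p.admissible hpos hpat, hN0, fun x => by have := hbd x; omega, ?_, fun V hV => ?_,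
    (hpat.no_oddRegionII_iff hN0).1 hno⟩, ?_⟩
  · rw [rule_iff_of_large (N := fun x => p.toPair.heights.N x 0) fun x h => by
      have := hbd x
      omega]
    simpa only [hN] using h3
  · have : {x : ℤ | (x, 0) ∈ V} = ∅ := by
      rw [Set.eq_empty_iff_forall_notMem]
      intro x hx
      have h4 : p.toPair.heights.N x 0 ≤ -c := hV.mem _ hx
      have := hbd x
      omega
    rw [this, Set.ncard_empty]
    exact Even.zero
  · rw [hasKappa_iff (a := fun j => p.toPair.lower j 0) (b := fun j => p.toPair.upper j 0)]
    · exact h2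
    · intro x
      unfold Heights.total
      rw [PathPair.heights_A_zero]
      rfl

theorem exists_mem_P {c : ℤ} (hlc : (lam.colLen 0 : ℤ) < c) {s : Heights}
    (hs : IsState n lam mu c s) : ∃ p ∈ P n lam mu, p.toPair.heights = s := by
  obtain ⟨hX, hk⟩ := hs
  obtain ⟨c', hc, rfl, h1, h2⟩ := exists_pattern (starts_strictAnti _ mu) (starts_strictAnti _ lam)
    hX.adm
  have ha := lower_zero_anti hc
  have hb := hc.upper_anti 0
  have hbd := bottom_bounds hc
  have hN : ∀ x, c'.heights.N x 0 =
      cnt (fun j => c'.lower j 0 - 1) x - cnt (fun j => c'.upper j 0) x := fun x => by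
    unfold Heights.N
    rw [PathPair.heights_A_zero]
    rfl
  rw [hasKappa_iff (a := fun j => c'.lower j 0) (b := fun j => c'.upper j 0) (fun x => by
    unfold Heights.total
    rw [PathPair.heights_A_zero]
    rfl)] at hk
  have hrule := hX.rule
  rw [rule_iff_of_large (N := fun x => c'.heights.N x 0) fun x h => by
    have := hbd x
    omega] at hrule
  have hadj := (isAdjacentSpecial_iff ha hb).2
    ⟨fun x => by have := hX.le x; have := hN x; omega, hk, by simpa only [hN] using hrule⟩
  obtain ⟨p, hσ, rfl⟩ := exists_tuple hc h1 h2 1 hadj.le hadj.even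
  exact ⟨p, p.mem_P_iff.2 ⟨hσ, hc, hadj.odd, (hc.no_oddRegionII_iff hX.le).2 hX.evenHigh⟩, rfl⟩

end PathTuple

end TypeC

/-! ### The bijection -/

theorem mainTheorem6 (n : ℕ) (hn : 1 ≤ n) (lam mu : YoungDiagram) (hle : mu ≤ lam)
    (hpos : TypeC.Positivity n lam mu) :
    ∃ φ : TypeC.P₂ n lam mu → TypeC.P n lam mu, Function.Bijective φ ∧
      ∀ (a : ℂ) (p : TypeC.P₂ n lam mu), (φ p).1.weight a = p.1.weight a := by
  obtain ⟨E, hE⟩ := TypeC.Heights.exists_equiv_inX n (lam.colLen 0)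
    (TypeC.topHeights (TypeC.starts (lam.colLen 0) mu) (TypeC.starts (lam.colLen 0) lam))
    (lam.colLen 0)
  -- After `l` doublings the level exceeds `l`, so the chain has arrived at the conditions for `P`.
  have hc : (lam.colLen 0 : ℤ) < 2 ^ (lam.colLen 0 + 1) := by
    have h1 : lam.colLen 0 + 1 < 2 ^ (lam.colLen 0 + 1) := Nat.lt_two_pow_self
    have h2 : ((lam.colLen 0 + 1 : ℕ) : ℤ) < ((2 ^ (lam.colLen 0 + 1) : ℕ) : ℤ) :=
      Nat.cast_lt.2 h1
    push_cast at h2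
    omega
  have hex : ∀ p : TypeC.P₂ n lam mu, ∃ q : TypeC.P n lam mu, q.1.toPair.heights =
      (E ⟨p.1.toPair.heights, (TypeC.PathTuple.isState_of_mem_P₂ hpos p.2).1⟩).1 := by
    intro p
    have hp := TypeC.PathTuple.isState_of_mem_P₂ hpos p.2
    -- The signed-count condition is a property of `A + B` alone, so it passes through the
    -- equivalence.
    obtain ⟨q, hq, hq'⟩ := TypeC.PathTuple.exists_mem_P hc (s := (E ⟨_, hp.1⟩).1)
      ⟨(E ⟨_, hp.1⟩).2, by rw [hE]; exact hp.2⟩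
    exact ⟨⟨q, hq⟩, hq'⟩
  choose φ hφ using hex
  refine ⟨φ, ⟨fun p p' h => ?_, fun q => ?_⟩, fun a p => ?_⟩
  · have h1 := hφ p
    rw [h, hφ p'] at h1
    have h2 := congrArg Subtype.val (E.injective (Subtype.ext h1))
    exact Subtype.ext (TypeC.PathTuple.injOn_P₂ p.2 p'.2 h2.symm)
  · have hq := TypeC.PathTuple.isState_of_mem_P hpos hc q.2
    set s := E.symm ⟨_, hq.1⟩ with hs
    have hEs : E s = ⟨_, hq.1⟩ := E.apply_symm_apply _
    obtain ⟨p, hp, hp'⟩ := TypeC.PathTuple.exists_mem_P₂ (n := n) (lam := lam) (mu := mu) (s := s.1)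
      ⟨s.2, by rw [← hE, hEs]; exact hq.2⟩
    refine ⟨⟨p, hp⟩, Subtype.ext (TypeC.PathTuple.injOn_P (φ _).2 q.2 ?_)⟩
    rw [hφ]
    have : (⟨p.toPair.heights, (TypeC.PathTuple.isState_of_mem_P₂ hpos hp).1⟩ :
        {s // TypeC.Heights.InX n (lam.colLen 0)
          (TypeC.topHeights (TypeC.starts (lam.colLen 0) mu) (TypeC.starts (lam.colLen 0) lam)) 2 s}) = s := Subtype.ext hp'
    simp only [this, hEs]
  · refine TypeC.weight_eq_of_total ?_ a
    rw [hφ, hE]
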